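/- Let $M$ be an $n$-dimensional smooth manifold (Hausdorff, second countable) with a smooth positive measure $dx$ (for example the one induced by a volume form), let $X_1,\dots,X_N$ be smooth vector fields on $M$, $\nabla_X=(X_1,\dots,X_N)$, and let $\Omega\subset M$ be a relatively compact domain (nonempty, open and connected). Let $p:\overline\Omega\to(1,\infty)$ be continuous on $\overline\Omega$ and of class $C^1$ in $\Omega$, and let $g:\Omega\to(0,\infty)$ be measurable and bounded. Let $W^{1,p(x)}(\Omega)$ be the space of all $u\in L^{p(x)}(\Omega)$ whose weak horizontal gradient $\nabla_Xu$ exists with $|\nabla_Xu|\in L^{p(x)}(\Omega)$, with the norm $\|u\|_{L^{p(x)}}+\|\nabla_Xu\|_{L^{p(x)}}$ (Luxemburg norms), and let $W^{1,p(x)}_0(\Omega)$ be the closure of $C_0^\infty(\Omega)$ in it. Call $u\in W_0^{1,p(x)}(\Omega)$ a solution for $\lambda\in\mathbb R$ if $$\int_\Omega|\nabla_Xu|^{p(x)-2}\langle\nabla_Xu,\nabla_X\phi\rangle\,dx=\lambda\int_\Omega g(x)|u|^{p(x)-2}u\,\phi\,dx\qquad\text{for all }\phi\in W_0^{1,p(x)}(\Omega).$$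 If there is a solution $u\neq0$ for $\lambda$, then $\lambda$ is called an eigenvalue and $u$ an eigenfunction corresponding to $\lambda$. Put $$\lambda_{1,p}(\Omega)=\inf_{u\in W_0^{1,p(x)}(\Omega)\setminus\{0\}}\frac{\int_\Omega|\nabla_Xu|^{p(x)}dx}{\int_\Omega g(x)|u|^{p(x)}dx}.$$ Suppose that for some $\lambda>0$ there is a solution $v\in W_0^{1,p(x)}(\Omega)$ with $v>0$ and $\nabla_Xp\cdot\nabla_Xv=0$ a.e. in $\Omega$. Then $$\lambda_{1,p}(\Omega)=\lambda,$$ and $\lambda$ is the least positive eigenvalue. Moreover, if the iterated commutators of $X_1,\dots,X_N$ span the tangent space at every point of $\Omega$ (Hörmander's condition), then the eigenvalue $\lambda_{1,p}(\Omega)$ is simple: if $u_1$ and $u$ are eigenfunctions corresponding to $\lambda_{1,p}(\Omega)$, then $u=c\,u_1$ a.e. in $\Omega$ for some constant $c\in\mathbb R$. -/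

import Mathlib

open MeasureTheory Set Filter Topology
open scoped Manifold ContDiff

noncomputable section

namespace SubLaplace

variable {n N : ℕ} {M : Type*} [TopologicalSpace M] [ChartedSpace (EuclideanSpace ℝ (Fin n)) M]

/-- A vector field on the `n`-dimensional manifold `M`. -/
abbrev VField (n : ℕ) (M : Type*) [TopologicalSpace M]
    [ChartedSpace (EuclideanSpace ℝ (Fin n)) M] : Type _ :=
  (x : M) → TangentSpace (𝓡 n) x

/-- The vector field `V` is smooth (as a section of the tangent bundle). -/
def IsSmoothField [IsManifold (𝓡 n) ∞ M] (V : VField n M) : Prop :=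
  ContMDiff (𝓡 n) (𝓡 n).tangent ∞ (fun x => (⟨x, V x⟩ : TangentBundle (𝓡 n) M))

/-- The vector fields obtained from the family `X` by iterated commutators
(including the members of `X` themselves). -/
inductive IsIteratedBracket (X : Fin N → VField n M) : VField n M → Prop
  | base (k : Fin N) : IsIteratedBracket X (X k)
  | bracket (V W : VField n M) : IsIteratedBracket X V → IsIteratedBracket X W →
      IsIteratedBracket X (VectorField.mlieBracket (𝓡 n) V W)

/-- Hörmander's condition on `Ω`: at each point of `Ω` the iterated commutators of the family span
the tangent space. -/
def HormanderOn (X : Fin N → VField n M) (Ω : Set M) : Prop :=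
  ∀ x ∈ Ω, Submodule.span ℝ
    {w : TangentSpace (𝓡 n) x | ∃ V : VField n M, IsIteratedBracket X V ∧ w = V x} = ⊤

/-- `μ` is a smooth positive measure: in each chart it is given by a smooth, strictly positive
density with respect to Lebesgue measure. The measures induced by volume forms are of this kind
(the density being the absolute value of the coefficient of the form in the chart). -/
def IsSmoothVolume (n : ℕ) {M : Type*} [TopologicalSpace M]
    [ChartedSpace (EuclideanSpace ℝ (Fin n)) M] [MeasurableSpace M] (μ : Measure M) : Prop :=
  ∀ e ∈ atlas (EuclideanSpace ℝ (Fin n)) M, ∃ ρ : EuclideanSpace ℝ (Fin n) → ℝ,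
    ContDiffOn ℝ ∞ ρ e.target ∧ (∀ y ∈ e.target, 0 < ρ y) ∧
    ∀ A : Set M, MeasurableSet A → A ⊆ e.source →
      μ A = ∫⁻ y in e '' A, ENNReal.ofReal (ρ y)

/-- The coefficients `(a₁, …, aₙ)` of the vector field `V` in the chart `e`, as a function of the
chart coordinates. -/
def chartField (e : OpenPartialHomeomorph M (EuclideanSpace ℝ (Fin n))) (V : VField n M)
    (y : EuclideanSpace ℝ (Fin n)) : EuclideanSpace ℝ (Fin n) :=
  mfderiv (𝓡 n) (𝓡 n) e (e.symm y) (V (e.symm y))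

/-- The formal adjoint `V^* φ = - ∑ⱼ ∂ⱼ (aⱼ φ)` of `V` in the coordinates of the chart `e`. -/
def chartAdjoint (e : OpenPartialHomeomorph M (EuclideanSpace ℝ (Fin n))) (V : VField n M)
    (φ : EuclideanSpace ℝ (Fin n) → ℝ) (y : EuclideanSpace ℝ (Fin n)) : ℝ :=
  - ∑ j : Fin n, fderiv ℝ (fun z => chartField e V z j * φ z) y (EuclideanSpace.single j 1)

/-- `w` is the weak derivative of `u` along `V` in the open set `Ω`: in each chart,
`∫ w φ dy = ∫ u V^* φ dy` for all test functions `φ`. (It is only used for locally integrable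
`u` and `w`.) -/
def HasWeakDerivAlong (Ω : Set M) (V : VField n M) (u w : M → ℝ) : Prop :=
  ∀ e ∈ atlas (EuclideanSpace ℝ (Fin n)) M, ∀ φ : EuclideanSpace ℝ (Fin n) → ℝ,
    ContDiff ℝ ∞ φ → HasCompactSupport φ → tsupport φ ⊆ e.target ∩ e.symm ⁻¹' Ω →
      ∫ y, w (e.symm y) * φ y = ∫ y, u (e.symm y) * chartAdjoint e V φ y

/-- `φ ∈ C_0^∞(Ω)`: smooth with compact support in `Ω`. -/
def IsTestFunction (n : ℕ) {M : Type*} [TopologicalSpace M]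
    [ChartedSpace (EuclideanSpace ℝ (Fin n)) M] (Ω : Set M) (φ : M → ℝ) : Prop :=
  ContMDiff (𝓡 n) 𝓘(ℝ, ℝ) ∞ φ ∧ HasCompactSupport φ ∧ tsupport φ ⊆ Ω

/-- The classical horizontal gradient `∇_X φ = (X₁ φ, …, X_N φ)`. -/
def hGrad (X : Fin N → VField n M) (φ : M → ℝ) (x : M) : EuclideanSpace ℝ (Fin N) :=
  WithLp.toLp 2 (fun k => (mfderiv (𝓡 n) 𝓘(ℝ, ℝ) φ x (X k x) : ℝ))

/-- `u ∈ L^{p(·)}(Ω)`, for a function with values in a normed space. -/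
def MemLpVar {M : Type*} [MeasurableSpace M] {F : Type*} [NormedAddCommGroup F]
    [MeasurableSpace F] (μ : Measure M) (Ω : Set M) (p : M → ℝ) (u : M → F) : Prop :=
  AEMeasurable u (μ.restrict Ω) ∧ ∫⁻ x in Ω, ENNReal.ofReal (‖u x‖ ^ p x) ∂μ < ⊤

/-- The Luxemburg norm of `L^{p(·)}(Ω)` (equal to `⊤` if no admissible `t` exists). -/
def luxNorm {M : Type*} [MeasurableSpace M] {F : Type*} [NormedAddCommGroup F]
    (μ : Measure M) (Ω : Set M) (p : M → ℝ) (u : M → F) : ENNReal :=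
  sInf (ENNReal.ofReal ''
    {t : ℝ | 0 < t ∧ ∫⁻ x in Ω, ENNReal.ofReal ((‖u x‖ / t) ^ p x) ∂μ ≤ 1})

/-- `u ∈ W^{1,p(·)}(Ω)`, with weak horizontal gradient `∇_X u = G`. -/
def MemW [MeasurableSpace M] (μ : Measure M) (Ω : Set M) (p : M → ℝ) (X : Fin N → VField n M)
    (u : M → ℝ) (G : M → EuclideanSpace ℝ (Fin N)) : Prop :=
  MemLpVar μ Ω p u ∧ MemLpVar μ Ω p G ∧ ∀ k, HasWeakDerivAlong Ω (X k) u (fun x => G x k)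

/-- `u ∈ W_0^{1,p(·)}(Ω)`, with weak horizontal gradient `∇_X u = G`: the closure of `C_0^∞(Ω)` in
`W^{1,p(·)}(Ω)`, whose norm is `‖u‖_{p(·)} + ‖∇_X u‖_{p(·)}`. -/
def MemW0 [MeasurableSpace M] (μ : Measure M) (Ω : Set M) (p : M → ℝ) (X : Fin N → VField n M)
    (u : M → ℝ) (G : M → EuclideanSpace ℝ (Fin N)) : Prop :=
  MemW μ Ω p X u G ∧ ∃ φ : ℕ → M → ℝ, (∀ i, IsTestFunction n Ω (φ i)) ∧
    Tendsto (fun i => luxNorm μ Ω p (fun x => u x - φ i x)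
      + luxNorm μ Ω p (fun x => G x - hGrad X (φ i) x)) atTop (𝓝 0)

/-- `u ∈ W_0^{1,p(·)}(Ω)` (with `∇_X u = G`) is a weak solution of
`-∇_X^*(|∇_X u|^{p(x)-2} ∇_X u) = lam g |u|^{p(x)-2} u` in `Ω`, `u = 0` on `∂Ω`. -/
def IsWeakSolution [MeasurableSpace M] (μ : Measure M) (Ω : Set M) (p g : M → ℝ)
    (X : Fin N → VField n M) (lam : ℝ) (u : M → ℝ) (G : M → EuclideanSpace ℝ (Fin N)) : Prop :=
  MemW0 μ Ω p X u G ∧ ∀ (φ : M → ℝ) (H : M → EuclideanSpace ℝ (Fin N)), MemW0 μ Ω p X φ H →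
    ∫ x in Ω, ‖G x‖ ^ (p x - 2) * inner ℝ (G x) (H x) ∂μ
      - lam * ∫ x in Ω, g x * |u x| ^ (p x - 2) * u x * φ x ∂μ = 0

/-- `u` is an eigenfunction corresponding to `lam`: a weak solution that is not (a.e.) zero. -/
def IsEigenfunction [MeasurableSpace M] (μ : Measure M) (Ω : Set M) (p g : M → ℝ)
    (X : Fin N → VField n M) (lam : ℝ) (u : M → ℝ) : Prop :=
  ¬ (u =ᵐ[μ.restrict Ω] 0) ∧ ∃ G, IsWeakSolution μ Ω p g X lam u G

/-- `lam` is an eigenvalue. -/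
def IsEigenvalue [MeasurableSpace M] (μ : Measure M) (Ω : Set M) (p g : M → ℝ)
    (X : Fin N → VField n M) (lam : ℝ) : Prop :=
  ∃ u, IsEigenfunction μ Ω p g X lam u

/-- The Rayleigh quotients `∫ |∇_X u|^{p(x)} / ∫ g |u|^{p(x)}` of the nonzero elements `u` of
`W_0^{1,p(·)}(Ω)`. -/
def rayleighSet [MeasurableSpace M] (μ : Measure M) (Ω : Set M) (p g : M → ℝ)
    (X : Fin N → VField n M) : Set ℝ :=
  {r | ∃ (u : M → ℝ) (G : M → EuclideanSpace ℝ (Fin N)),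
    MemW0 μ Ω p X u G ∧ ¬ (u =ᵐ[μ.restrict Ω] 0) ∧
    r = (∫ x in Ω, ‖G x‖ ^ p x ∂μ) / ∫ x in Ω, g x * |u x| ^ p x ∂μ}

/-- The principal eigenvalue `λ_{1,p}(Ω)`, the infimum of the Rayleigh quotients. -/
def principalEigenvalue [MeasurableSpace M] (μ : Measure M) (Ω : Set M) (p g : M → ℝ)
    (X : Fin N → VField n M) : ℝ :=
  sInf (rayleighSet μ Ω p g X)

end SubLaplace

end

/-! The proof is Picone's inequality for a variable exponent. For u in W₀ the formal test function
|u|^p v^{1-p} has, besides the usual terms, logarithmic terms proportional to ∇_X p, coming from the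
derivative of the exponent. They are paired only with ∇_X v, so ∇_X p · ∇_X v = 0 removes them, and
|∇u|^p - |∇v|^{p-2}⟨∇v, ∇(|u|^p v^{1-p})⟩ becomes the expression `picone`. By Cauchy–Schwarz and
Young this is nonnegative, and it vanishes only if ∇u = (u/v)∇v. Integrating and using the equation
of v gives λ ∫ g|u|^p ≤ ∫ |∇u|^p. Hence λ bounds every Rayleigh quotient from below, and v attains
it. Since an eigenfunction tested with itself has its eigenvalue as Rayleigh quotient, λ is also the
least eigenvalue.

For simplicity, an eigenfunction u for λ makes the integrated Picone function zero, so ∇u = (u/v)∇v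
a.e. Then arctan(u/v), which is bounded whatever u and v are, has zero weak horizontal gradient. The
formal adjoints respect brackets, so all iterated commutators annihilate it weakly. Under
Hörmander's condition these contain a local frame, so all weak partial derivatives vanish; the
function is locally constant, and constant because Ω is connected. Every eigenfunction is thus a
multiple of v.

The analytic difficulty is that v need not be bounded away from 0 and that p is only C¹. Elements of
W₀ are therefore handled as a.e. limits of C¹ functions of compact support, dominated in p-th power
(`MemW0.exists_dominated`, `memW0_of_dominated`). The admissible test functions are (√(φ²+δ²)^p -
δ^p)(v+ε)^{1-p} (`memW0_quotient`), and the passage δ, ε → 0 is made in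
`IsPositiveSolution.lintegral_picone_le` by dominated convergence and Fatou. Picone's inequality for
a cutoff also shows that |∇v|/v is locally integrable (`IsPositiveSolution.integrableOn_norm_div`),
which is the domination needed to differentiate arctan(u/v). -/

namespace SubLaplace

variable {n N : ℕ} {M : Type*} [TopologicalSpace M] [ChartedSpace (EuclideanSpace ℝ (Fin n)) M]

/-! ### Smooth volumes in charts -/

section ChartMeasure

set_option linter.unusedSectionVars false

variable [MeasurableSpace M] [BorelSpace M] {μ : Measure M}

theorem aemeasurable_chart_symm (e : OpenPartialHomeomorph M (EuclideanSpace ℝ (Fin n)))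
    {ν : Measure (EuclideanSpace ℝ (Fin n))} (hν : ∀ᵐ y ∂ν, y ∈ e.target) :
    AEMeasurable e.symm ν := by
  have h : ν.restrict e.target = ν := Measure.restrict_eq_self_of_ae_mem hν
  rw [← h]
  exact e.continuousOn_symm.aemeasurable e.open_target.measurableSet

/-- In a chart, a smooth volume is Lebesgue measure with a positive continuous density. -/
theorem IsSmoothVolume.exists_density (hμ : IsSmoothVolume n μ)
    {e : OpenPartialHomeomorph M (EuclideanSpace ℝ (Fin n))}
    (he : e ∈ atlas (EuclideanSpace ℝ (Fin n)) M) :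
    ∃ ρ : EuclideanSpace ℝ (Fin n) → ℝ, ContinuousOn ρ e.target ∧ (∀ y ∈ e.target, 0 < ρ y) ∧
      μ.restrict e.source = Measure.map e.symm
        ((volume.restrict e.target).withDensity (fun y => ENNReal.ofReal (ρ y))) := by
  obtain ⟨ρ, hρ, hpos, hA⟩ := hμ e he
  refine ⟨ρ, hρ.continuousOn, hpos, ?_⟩
  have hae : ∀ᵐ y ∂((volume.restrict e.target).withDensity (fun y => ENNReal.ofReal (ρ y))),
      y ∈ e.target := (withDensity_absolutelyContinuous _ _).ae_le
        (ae_restrict_mem e.open_target.measurableSet)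
  ext B hB
  classical
  have hm : MeasurableSet (e.target ∩ e.symm ⁻¹' B) := by
    -- The inverse chart is continuous only on the target; a constant off the target gives a
    -- globally measurable map with the same preimage inside it.
    have := (e.continuousOn_symm.measurable_piecewise (g := fun _ => e.symm (0 : _))
      continuousOn_const e.open_target.measurableSet) hB
    convert e.open_target.measurableSet.inter this using 1
    ext y
    by_cases hy : y ∈ e.target <;> simp [hy, Set.piecewise]
  rw [Measure.restrict_apply hB,
    Measure.map_apply_of_aemeasurable (aemeasurable_chart_symm e hae) hB,
    hA _ (hB.inter e.open_source.measurableSet) inter_subset_right]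
  rw [inter_comm, e.image_source_inter_eq']
  have h1 : ((volume.restrict e.target).withDensity (fun y => ENNReal.ofReal (ρ y)))
      (e.symm ⁻¹' B) = ((volume.restrict e.target).withDensity (fun y => ENNReal.ofReal (ρ y)))
      (e.target ∩ e.symm ⁻¹' B) := by
    refine measure_congr ?_
    filter_upwards [hae] with y hy
    exact propext ⟨fun h => ⟨hy, h⟩, fun h => h.2⟩
  rw [h1, withDensity_apply _ hm, Measure.restrict_restrict hm,
    inter_eq_self_of_subset_left inter_subset_left]

/-- An almost everywhere property is inherited by chart coordinates. -/
theorem IsSmoothVolume.ae_chart (hμ : IsSmoothVolume n μ)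
    {e : OpenPartialHomeomorph M (EuclideanSpace ℝ (Fin n))}
    (he : e ∈ atlas (EuclideanSpace ℝ (Fin n)) M) {Ω : Set M} (hΩ : IsOpen Ω) {P : M → Prop}
    (h : ∀ᵐ x ∂(μ.restrict Ω), P x) :
    ∀ᵐ y ∂(volume.restrict (e.target ∩ e.symm ⁻¹' Ω)), P (e.symm y) := by
  obtain ⟨ρ, hρ, hpos, hmap⟩ := hμ.exists_density he
  have hae : ∀ᵐ y ∂((volume.restrict e.target).withDensity (fun y => ENNReal.ofReal (ρ y))),
      y ∈ e.target := (withDensity_absolutelyContinuous _ _).ae_le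
        (ae_restrict_mem e.open_target.measurableSet)
  have h1 : ∀ᵐ x ∂(μ.restrict e.source), x ∈ Ω → P x :=
    ae_restrict_of_ae ((ae_restrict_iff' hΩ.measurableSet).1 h)
  rw [hmap] at h1
  have h2 := ae_of_ae_map (aemeasurable_chart_symm e hae) h1
  have hρm : AEMeasurable (fun y => ENNReal.ofReal (ρ y)) (volume.restrict e.target) :=
    (hρ.aemeasurable e.open_target.measurableSet).ennreal_ofReal
  rw [ae_withDensity_iff' hρm] at h2
  have hU : IsOpen (e.target ∩ e.symm ⁻¹' Ω) := e.isOpen_inter_preimage_symm hΩ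
  have h3 := ae_restrict_of_ae_restrict_of_subset (s := e.target ∩ e.symm ⁻¹' Ω)
    inter_subset_left h2
  filter_upwards [h3, ae_restrict_mem hU.measurableSet] with y hy hyU
  exact hy (by simpa using hpos y hyU.1) hyU.2

/-- The converse transfer, from coordinates to the manifold. The exceptional set is enlarged to a
measurable null set because the density formula is available for measurable sets only. -/
theorem IsSmoothVolume.ae_of_ae_chart (hμ : IsSmoothVolume n μ)
    {e : OpenPartialHomeomorph M (EuclideanSpace ℝ (Fin n))}
    (he : e ∈ atlas (EuclideanSpace ℝ (Fin n)) M) {U : Set (EuclideanSpace ℝ (Fin n))}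
    (hUo : IsOpen U) {P : M → Prop}
    (h : ∀ᵐ y ∂(volume.restrict U), P (e.symm y)) :
    ∀ᵐ x ∂(μ.restrict (e.source ∩ e ⁻¹' U)), P x := by
  obtain ⟨ρ, -, -, hA⟩ := hμ e he
  have hVo : IsOpen (e.source ∩ e ⁻¹' U) := e.isOpen_inter_preimage hUo
  obtain ⟨T, hT, hTm, hT0⟩ := exists_measurable_superset_of_null
    (show volume {y | ¬ (y ∈ U → P (e.symm y))} = 0 from
      (ae_restrict_iff' hUo.measurableSet).1 h)
  rw [ae_restrict_iff' hVo.measurableSet]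
  have hTU : MeasurableSet (T ∩ U) := hTm.inter hUo.measurableSet
  classical
  have hmeas : MeasurableSet (e.source ∩ e ⁻¹' (T ∩ U)) := by
    by_cases hne : Nonempty (EuclideanSpace ℝ (Fin n))
    · have := (e.continuousOn.measurable_piecewise (g := fun _ => Classical.choice hne)
        continuousOn_const e.open_source.measurableSet) hTU
      convert e.open_source.measurableSet.inter this using 1
      ext y
      by_cases hy : y ∈ e.source <;> simp [hy, Set.piecewise]
    · exact absurd ⟨0⟩ hne
  refine measure_mono_null (t := e.source ∩ e ⁻¹' (T ∩ U)) ?_ ?_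
  · intro x hx
    simp only [mem_ofPred_eq, not_forall, mem_compl_iff] at hx
    obtain ⟨⟨hxs, hxU⟩, hxP⟩ := hx
    refine ⟨hxs, hT ?_, hxU⟩
    simp only [mem_ofPred_eq, not_forall]
    exact ⟨hxU, by rwa [e.left_inv hxs]⟩
  · rw [hA _ hmeas inter_subset_left]
    refine setLIntegral_measure_zero _ _ (measure_mono_null ?_ hT0)
    rintro _ ⟨x, hx, rfl⟩
    exact hx.2.1

/-- Integrability on compact sets is inherited by chart coordinates. -/
theorem IsSmoothVolume.integrableOn_chart (hμ : IsSmoothVolume n μ)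
    {e : OpenPartialHomeomorph M (EuclideanSpace ℝ (Fin n))}
    (he : e ∈ atlas (EuclideanSpace ℝ (Fin n)) M) {K : Set (EuclideanSpace ℝ (Fin n))}
    (hK : IsCompact K) (hKt : K ⊆ e.target) {h : M → ℝ}
    (hh : IntegrableOn h (e.symm '' K) μ) :
    IntegrableOn (fun y => h (e.symm y)) K := by
  obtain ⟨ρ, hρ, hpos, hmap⟩ := hμ.exists_density he
  set τ := (volume.restrict e.target).withDensity (fun y => ENNReal.ofReal (ρ y)) with hτ
  have hae : ∀ᵐ y ∂τ, y ∈ e.target := (withDensity_absolutelyContinuous _ _).ae_le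
        (ae_restrict_mem e.open_target.measurableSet)
  have hes := aemeasurable_chart_symm e hae
  classical
  have hKm : MeasurableSet K := hK.measurableSet
  have hLm : MeasurableSet (e.symm '' K) := by
    have h1 : e.symm '' K = e.source ∩ e ⁻¹' K := by
      ext x
      constructor
      · rintro ⟨y, hy, rfl⟩
        exact ⟨e.map_target (hKt hy), by simpa [e.right_inv (hKt hy)] using hy⟩
      · rintro ⟨hx, hxK⟩
        exact ⟨e x, hxK, e.left_inv hx⟩
    rw [h1]
    have := (e.continuousOn.measurable_piecewise (g := fun _ => 0)
        continuousOn_const e.open_source.measurableSet) hKm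
    convert e.open_source.measurableSet.inter this using 1
    ext y
    by_cases hy : y ∈ e.source <;> simp [hy, Set.piecewise]
  have hsub : e.symm '' K ⊆ e.source := by
    rintro _ ⟨y, hy, rfl⟩
    exact e.map_target (hKt hy)
  have h0 : μ.restrict (e.symm '' K) = Measure.map e.symm (τ.restrict K) := by
    have h2 : μ.restrict (e.symm '' K) = (μ.restrict e.source).restrict (e.symm '' K) := by
      rw [Measure.restrict_restrict hLm, inter_eq_self_of_subset_left hsub]
    rw [h2, hmap, Measure.restrict_map_of_aemeasurable hes hLm]
    congr 1
    refine Measure.restrict_congr_set ?_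
    filter_upwards [hae] with y hy
    refine propext ⟨?_, fun h => ⟨y, h, rfl⟩⟩
    rintro ⟨z, hz, hzy⟩
    have : z = y := e.symm.injOn (hKt hz) hy hzy
    exact this ▸ hz
  have h3 : Integrable (fun y => h (e.symm y)) (τ.restrict K) := by
    have hh' := hh
    rw [IntegrableOn, h0] at hh'
    exact (integrable_map_measure hh'.aestronglyMeasurable hes.restrict).1 hh'
  have hρm : AEMeasurable (fun y => ENNReal.ofReal (ρ y)) ((volume.restrict e.target).restrict K) :=
    ((hρ.aemeasurable e.open_target.measurableSet).ennreal_ofReal).restrict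
  rw [hτ, restrict_withDensity hKm, Measure.restrict_restrict hKm,
    inter_eq_self_of_subset_left hKt] at h3
  have hρK : ContinuousOn ρ K := hρ.mono hKt
  have hm2 : AEMeasurable (fun y => (ρ y).toNNReal) (volume.restrict K) :=
    (hρK.aemeasurable hKm).real_toNNReal
  have h4 : Integrable (fun y => ((ρ y).toNNReal : ℝ) • h (e.symm y)) (volume.restrict K) :=
    (integrable_withDensity_iff_integrable_smul₀ hm2).1 h3
  have h5 : IntegrableOn (fun y => ((ρ y).toNNReal : ℝ) • h (e.symm y)) K := h4
  -- The density is bounded away from 0 on the compact set K, so it can be divided out.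
  have h6 := h5.continuousOn_mul (g := fun y => (ρ y)⁻¹)
    (hρK.inv₀ (fun y hy => (hpos y (hKt hy)).ne')) hK
  refine h6.congr_fun (fun y hy => ?_) hKm
  have := hpos y (hKt hy)
  simp only [smul_eq_mul, Real.coe_toNNReal _ this.le]
  field_simp

/-- The density is bounded near a point and unit balls have finite Lebesgue measure. This makes
relatively compact sets have finite measure. -/
theorem IsSmoothVolume.isLocallyFiniteMeasure (hμ : IsSmoothVolume n μ) :
    IsLocallyFiniteMeasure μ := by
  refine ⟨fun x => ?_⟩
  set e := chartAt (EuclideanSpace ℝ (Fin n)) x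
  obtain ⟨ρ, hρ, hpos, hA⟩ := hμ e (chart_mem_atlas _ x)
  have hx : x ∈ e.source := mem_chart_source _ x
  have hc : ContinuousAt ρ (e x) :=
    hρ.continuousOn.continuousAt (e.open_target.mem_nhds (e.map_source hx))
  have h1 : ∀ᶠ y in 𝓝 (e x), ρ y < ρ (e x) + 1 := hc.eventually_lt_const (by linarith)
  obtain ⟨U, hU, hUo, hxU⟩ := eventually_nhds_iff.1
    (h1.and ((e.open_target.mem_nhds (e.map_source hx)) : ∀ᶠ y in 𝓝 (e x), y ∈ e.target))
  have hB : ∀ᶠ y in 𝓝 (e x), y ∈ Metric.ball (e x) 1 := Metric.ball_mem_nhds _ one_pos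
  set W := e.source ∩ e ⁻¹' (U ∩ Metric.ball (e x) 1) with hW
  have hWo : IsOpen W := e.isOpen_inter_preimage (hUo.inter Metric.isOpen_ball)
  refine ⟨W, hWo.mem_nhds ⟨hx, hxU, Metric.mem_ball_self one_pos⟩, ?_⟩
  rw [hA W hWo.measurableSet inter_subset_left]
  have hsub : e '' W ⊆ U ∩ Metric.ball (e x) 1 := by
    rintro _ ⟨z, hz, rfl⟩; exact hz.2
  calc ∫⁻ y in e '' W, ENNReal.ofReal (ρ y)
      ≤ ∫⁻ y in U ∩ Metric.ball (e x) 1, ENNReal.ofReal (ρ y) := lintegral_mono_set hsub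
    _ ≤ ∫⁻ y in U ∩ Metric.ball (e x) 1, ENNReal.ofReal (ρ (e x) + 1) := by
        refine setLIntegral_mono' (hUo.inter Metric.isOpen_ball).measurableSet (fun y hy => ?_)
        exact ENNReal.ofReal_le_ofReal (hU y hy.1).1.le
    _ < ⊤ := by
        rw [setLIntegral_const]
        exact ENNReal.mul_lt_top ENNReal.ofReal_lt_top
          ((measure_mono inter_subset_right).trans_lt measure_ball_lt_top)

/-- A strictly positive density cannot integrate to 0 over a nonempty open set. It lets a.e.
statements be evaluated at some point of an open set. -/
theorem IsSmoothVolume.isOpenPosMeasure (hμ : IsSmoothVolume n μ) : μ.IsOpenPosMeasure := by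
  refine ⟨fun U hU ⟨x, hxU⟩ h0 => ?_⟩
  set e := chartAt (EuclideanSpace ℝ (Fin n)) x
  obtain ⟨ρ, hρ, hpos, hA⟩ := hμ e (chart_mem_atlas _ x)
  have hx : x ∈ e.source := mem_chart_source _ x
  have h1 : μ (U ∩ e.source) = 0 := measure_mono_null inter_subset_left h0
  rw [hA _ (hU.inter e.open_source).measurableSet inter_subset_right] at h1
  have ho : IsOpen (e '' (U ∩ e.source)) :=
    e.isOpen_image_of_subset_source (hU.inter e.open_source) inter_subset_right
  have hsub : e '' (U ∩ e.source) ⊆ e.target := by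
    rintro _ ⟨z, hz, rfl⟩; exact e.map_source hz.2
  have hρm : AEMeasurable (fun y => ENNReal.ofReal (ρ y))
      (volume.restrict (e '' (U ∩ e.source))) :=
    ((hρ.continuousOn.mono hsub).aemeasurable ho.measurableSet).ennreal_ofReal
  rw [lintegral_eq_zero_iff' hρm] at h1
  have h2 : ∀ᵐ y ∂(volume.restrict (e '' (U ∩ e.source))), False := by
    filter_upwards [h1, ae_restrict_mem ho.measurableSet] with y hy hyU
    have := hpos y (hsub hyU)
    simp only [Pi.zero_apply, ENNReal.ofReal_eq_zero] at hy
    linarith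
  rw [ae_iff] at h2
  simp only [not_false_eq_true, ofPred_true, Measure.restrict_apply_univ] at h2
  exact (ho.measure_pos volume ⟨_, x, ⟨hxU, hx⟩, rfl⟩).ne' h2

end ChartMeasure

end SubLaplace

namespace SubLaplace

variable {n N : ℕ} {M : Type*} [TopologicalSpace M] [ChartedSpace (EuclideanSpace ℝ (Fin n)) M]

/-! ### Horizontal gradients and vector fields in charts -/

section ChartCalculus

/-- `φ` is differentiable at `x` with horizontal gradient `η`. -/
def HasHGradAt (X : Fin N → VField n M) (φ : M → ℝ) (η : EuclideanSpace ℝ (Fin N)) (x : M) :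
    Prop :=
  MDifferentiableAt (𝓡 n) 𝓘(ℝ, ℝ) φ x ∧ hGrad X φ x = η

variable {X : Fin N → VField n M} {a b : M → ℝ} {α β : EuclideanSpace ℝ (Fin N)} {x : M}

theorem hasHGradAt_of_contMDiffAt (h : ContMDiffAt (𝓡 n) 𝓘(ℝ, ℝ) 1 a x) :
    HasHGradAt X a (hGrad X a x) x :=
  ⟨h.mdifferentiableAt one_ne_zero, rfl⟩

/-- The one chain rule from which the sum, product, power and quotient rules for horizontal
gradients are all derived. -/
theorem HasHGradAt.comp₂ {F : ℝ × ℝ → ℝ} {L : ℝ × ℝ →L[ℝ] ℝ} (ha : HasHGradAt X a α x)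
    (hb : HasHGradAt X b β x) (hF : HasFDerivAt F L (a x, b x)) :
    HasHGradAt X (fun z => F (a z, b z)) (L (1, 0) • α + L (0, 1) • β) x := by
  have ha1 := ha.1.hasMFDerivAt
  have hb1 := hb.1.hasMFDerivAt
  have h1 : HasMFDerivAt (𝓡 n) 𝓘(ℝ, ℝ × ℝ) (fun z => (a z, b z)) x
      (ContinuousLinearMap.prod (mfderiv (𝓡 n) 𝓘(ℝ, ℝ) a x) (mfderiv (𝓡 n) 𝓘(ℝ, ℝ) b x)) :=
    ⟨ha1.1.prodMk hb1.1, HasFDerivWithinAt.prodMk ha1.2 hb1.2⟩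
  have h2 : HasMFDerivAt (𝓡 n) 𝓘(ℝ, ℝ) (fun z => F (a z, b z)) x _ :=
    HasMFDerivAt.comp x hF.hasMFDerivAt h1
  refine ⟨h2.mdifferentiableAt, ?_⟩
  rw [← ha.2, ← hb.2]
  ext k
  simp only [hGrad, h2.mfderiv]
  set s : ℝ := mfderiv (𝓡 n) 𝓘(ℝ, ℝ) a x (X k x)
  set t : ℝ := mfderiv (𝓡 n) 𝓘(ℝ, ℝ) b x (X k x)
  have h3 : ((s, t) : ℝ × ℝ) = s • ((1 : ℝ), (0 : ℝ)) + t • ((0 : ℝ), (1 : ℝ)) := by simp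
  have h4 : L (s, t) = L (1, 0) * s + L (0, 1) * t := by
    rw [h3, map_add, map_smul, map_smul, smul_eq_mul, smul_eq_mul]
    ring
  exact h4

theorem hasFDerivAt_coord_fst (q : ℝ × ℝ) :
    HasFDerivAt (fun q : ℝ × ℝ => q.1) (ContinuousLinearMap.fst ℝ ℝ ℝ) q := hasFDerivAt_fst

theorem hasFDerivAt_coord_snd (q : ℝ × ℝ) :
    HasFDerivAt (fun q : ℝ × ℝ => q.2) (ContinuousLinearMap.snd ℝ ℝ ℝ) q := hasFDerivAt_snd

theorem HasHGradAt.comp {F : ℝ → ℝ} {F' : ℝ} (ha : HasHGradAt X a α x)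
    (hF : HasDerivAt F F' (a x)) : HasHGradAt X (fun z => F (a z)) (F' • α) x := by
  have h : HasFDerivAt (fun q : ℝ × ℝ => F q.1) _ (a x, a x) :=
    HasDerivAt.comp_hasFDerivAt (a x, a x) (f := fun q : ℝ × ℝ => q.1) hF (hasFDerivAt_coord_fst _)
  simpa using ha.comp₂ ha h

theorem HasHGradAt.mul (ha : HasHGradAt X a α x) (hb : HasHGradAt X b β x) :
    HasHGradAt X (fun z => a z * b z) (b x • α + a x • β) x := by
  have h : HasFDerivAt (fun q : ℝ × ℝ => q.1 * q.2) _ (a x, b x) :=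
    (hasFDerivAt_coord_fst _).mul (hasFDerivAt_coord_snd _)
  simpa using ha.comp₂ hb h

theorem HasHGradAt.add (ha : HasHGradAt X a α x) (hb : HasHGradAt X b β x) :
    HasHGradAt X (fun z => a z + b z) (α + β) x := by
  have h : HasFDerivAt (fun q : ℝ × ℝ => q.1 + q.2) _ (a x, b x) :=
    (hasFDerivAt_coord_fst _).add (hasFDerivAt_coord_snd _)
  simpa using ha.comp₂ hb h

theorem HasHGradAt.sub (ha : HasHGradAt X a α x) (hb : HasHGradAt X b β x) :
    HasHGradAt X (fun z => a z - b z) (α - β) x := by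
  have h : HasFDerivAt (fun q : ℝ × ℝ => q.1 - q.2) _ (a x, b x) :=
    (hasFDerivAt_coord_fst _).sub (hasFDerivAt_coord_snd _)
  simpa [sub_eq_add_neg] using ha.comp₂ hb h

theorem hGrad_eq_zero_of_notMem_tsupport (h : x ∉ tsupport a) : hGrad X a x = 0 := by
  have h1 : a =ᶠ[𝓝 x] fun _ => 0 := notMem_tsupport_iff_eventuallyEq.1 h
  ext k
  simp only [hGrad, h1.mfderiv_eq, mfderiv_const]
  rfl

variable [IsManifold (𝓡 n) ∞ M]

theorem chart_mdifferentiable {e : OpenPartialHomeomorph M (EuclideanSpace ℝ (Fin n))}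
    (he : e ∈ atlas (EuclideanSpace ℝ (Fin n)) M) : e.MDifferentiable (𝓡 n) (𝓡 n) :=
  have : IsManifold (𝓡 n) 1 M := IsManifold.of_le (n := ∞) (by norm_num)
  mdifferentiable_of_mem_atlas he

theorem contMDiffAt_chart_symm {e : OpenPartialHomeomorph M (EuclideanSpace ℝ (Fin n))}
    (he : e ∈ atlas (EuclideanSpace ℝ (Fin n)) M) {y : EuclideanSpace ℝ (Fin n)}
    (hy : y ∈ e.target) : ContMDiffAt (𝓡 n) (𝓡 n) ∞ e.symm y :=
  contMDiffAt_symm_of_mem_maximalAtlas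
    (IsManifold.subset_maximalAtlas he) hy

theorem contMDiffAt_chart {e : OpenPartialHomeomorph M (EuclideanSpace ℝ (Fin n))}
    (he : e ∈ atlas (EuclideanSpace ℝ (Fin n)) M)
    (hx : x ∈ e.source) : ContMDiffAt (𝓡 n) (𝓡 n) ∞ e x :=
  contMDiffAt_of_mem_maximalAtlas
    (IsManifold.subset_maximalAtlas he) hx

/-- The derivatives of a chart and of its inverse are mutually inverse. The pullback form gives
access to the smoothness and bracket theorems for pulled-back fields. -/
theorem chartField_eq_mpullback {e : OpenPartialHomeomorph M (EuclideanSpace ℝ (Fin n))}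
    (he : e ∈ atlas (EuclideanSpace ℝ (Fin n)) M) (V : VField n M)
    {y : EuclideanSpace ℝ (Fin n)} (hy : y ∈ e.target) :
    chartField e V y = VectorField.mpullback (𝓡 n) (𝓡 n) e.symm V y := by
  have hd := chart_mdifferentiable he
  rw [VectorField.mpullback_apply, chartField]
  have h1 := hd.comp_symm_deriv hy
  have h2 := hd.symm_comp_deriv (e.map_target hy)
  rw [e.right_inv hy] at h2
  rw [ContinuousLinearMap.inverse_eq h2 h1]
  rfl

theorem isInvertible_mfderiv_chart_symm {e : OpenPartialHomeomorph M (EuclideanSpace ℝ (Fin n))}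
    (he : e ∈ atlas (EuclideanSpace ℝ (Fin n)) M)
    {y : EuclideanSpace ℝ (Fin n)} (hy : y ∈ e.target) :
    (mfderiv (𝓡 n) (𝓡 n) e.symm y).IsInvertible :=
  ⟨(chart_mdifferentiable he).symm.mfderiv (x := y) hy, rfl⟩

theorem IsSmoothField.contDiffOn_chartField {V : VField n M} (hV : IsSmoothField V)
    {e : OpenPartialHomeomorph M (EuclideanSpace ℝ (Fin n))}
    (he : e ∈ atlas (EuclideanSpace ℝ (Fin n)) M) :
    ContDiffOn ℝ ∞ (chartField e V) e.target := by
  have : IsManifold (𝓡 n) 1 M := IsManifold.of_le (n := ∞) (by norm_num)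
  intro y hy
  have h1 : ContMDiffAt (𝓡 n) (𝓡 n).tangent ∞
      (fun z => (⟨z, VectorField.mpullback (𝓡 n) (𝓡 n) e.symm V z⟩ :
        TangentBundle (𝓡 n) (EuclideanSpace ℝ (Fin n)))) y :=
    ContMDiffAt.mpullback_vectorField_preimage (n := ∞) (hV (e.symm y))
      (contMDiffAt_chart_symm he hy)
      (isInvertible_mfderiv_chart_symm he hy) (by simp)
  have h2 := contMDiffAt_vectorSpace_iff_contDiffAt.1 h1
  refine (h2.congr_of_eventuallyEq ?_).contDiffWithinAt
  filter_upwards [e.open_target.mem_nhds hy] with z hz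
  exact chartField_eq_mpullback he V hz

/-- The derivative of a function along a field does not depend on coordinates: chain rule, together
with the fact that the derivatives of chart and inverse chart cancel. -/
theorem mfderiv_eq_fderiv_chart {e : OpenPartialHomeomorph M (EuclideanSpace ℝ (Fin n))}
    (he : e ∈ atlas (EuclideanSpace ℝ (Fin n)) M) (V : VField n M)
    {y : EuclideanSpace ℝ (Fin n)} (hy : y ∈ e.target)
    (ha : MDifferentiableAt (𝓡 n) 𝓘(ℝ, ℝ) a (e.symm y)) :
    DifferentiableAt ℝ (fun z => a (e.symm z)) y ∧
    mfderiv (𝓡 n) 𝓘(ℝ, ℝ) a (e.symm y) (V (e.symm y))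
      = fderiv ℝ (fun z => a (e.symm z)) y (chartField e V y) := by
  have hd := chart_mdifferentiable he
  have h1 : MDifferentiableAt (𝓡 n) 𝓘(ℝ, ℝ) (a ∘ e.symm) y :=
    MDifferentiableAt.comp y ha (hd.mdifferentiableAt_symm hy)
  refine ⟨mdifferentiableAt_iff_differentiableAt.1 h1, ?_⟩
  have h2 : mfderiv (𝓡 n) 𝓘(ℝ, ℝ) (a ∘ e.symm) y =
      (mfderiv (𝓡 n) 𝓘(ℝ, ℝ) a (e.symm y)).comp (mfderiv (𝓡 n) (𝓡 n) e.symm y) :=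
    mfderiv_comp y ha (hd.mdifferentiableAt_symm hy)
  rw [mfderiv_eq_fderiv] at h2
  change _ = fderiv ℝ (a ∘ e.symm) y (chartField e V y)
  rw [h2]
  have h3 := hd.symm_comp_deriv (e.map_target hy)
  rw [e.right_inv hy] at h3
  have h4 := congrArg (fun L => L (V (e.symm y))) h3
  exact (congrArg (mfderiv (𝓡 n) 𝓘(ℝ, ℝ) a (e.symm y)) h4).symm

theorem contDiffAt_comp_chart_symm {e : OpenPartialHomeomorph M (EuclideanSpace ℝ (Fin n))}
    (he : e ∈ atlas (EuclideanSpace ℝ (Fin n)) M) {m : ℕ∞}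
    {y : EuclideanSpace ℝ (Fin n)} (hy : y ∈ e.target)
    (ha : ContMDiffAt (𝓡 n) 𝓘(ℝ, ℝ) m a (e.symm y)) :
    ContDiffAt ℝ m (fun z => a (e.symm z)) y :=
  contMDiffAt_iff_contDiffAt.1
    (ContMDiffAt.comp y ha ((contMDiffAt_chart_symm he hy).of_le (by exact_mod_cast le_top)))

theorem continuousAt_mfderiv_apply {V : VField n M} (hV : IsSmoothField V)
    (ha : ContMDiffAt (𝓡 n) 𝓘(ℝ, ℝ) 1 a x) :
    ContinuousAt (fun z => (mfderiv (𝓡 n) 𝓘(ℝ, ℝ) a z (V z) : ℝ)) x := by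
  have : IsManifold (𝓡 n) 1 M := IsManifold.of_le (n := ∞) (by norm_num)
  set e := chartAt (EuclideanSpace ℝ (Fin n)) x
  have he : e ∈ atlas (EuclideanSpace ℝ (Fin n)) M := chart_mem_atlas _ x
  have hx : x ∈ e.source := mem_chart_source _ x
  have hy : e x ∈ e.target := e.map_source hx
  have h1 : ContDiffAt ℝ 1 (fun z => a (e.symm z)) (e x) :=
    contDiffAt_comp_chart_symm (m := 1) he hy (by simpa [e.left_inv hx] using ha)
  have h2 : ContinuousAt (fun y => fderiv ℝ (fun z => a (e.symm z)) y (chartField e V y)) (e x) :=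
    (h1.continuousAt_fderiv one_ne_zero).clm_apply
      ((hV.contDiffOn_chartField he).continuousOn.continuousAt (e.open_target.mem_nhds hy))
  have h3 : ContinuousAt
      (fun z => fderiv ℝ (fun z => a (e.symm z)) (e z) (chartField e V (e z))) x :=
    ContinuousAt.comp (f := e) h2 (e.continuousAt hx)
  refine h3.congr ?_
  filter_upwards [e.open_source.mem_nhds hx,
    (contMDiffAt_iff_contMDiffAt_nhds (by simp)).1 ha] with z hz hza
  have h4 := (mfderiv_eq_fderiv_chart he V (e.map_source hz)
    (by rw [e.left_inv hz]; exact hza.mdifferentiableAt one_ne_zero)).2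
  rw [e.left_inv hz] at h4
  exact h4.symm

theorem continuousAt_hGrad (hX : ∀ k, IsSmoothField (X k))
    (ha : ContMDiffAt (𝓡 n) 𝓘(ℝ, ℝ) 1 a x) : ContinuousAt (hGrad X a) x := by
  have h : ContinuousAt (fun z => fun k => (mfderiv (𝓡 n) 𝓘(ℝ, ℝ) a z (X k z) : ℝ)) x :=
    continuousAt_pi.2 fun k => continuousAt_mfderiv_apply (hX k) ha
  exact (PiLp.continuous_toLp 2 _).continuousAt.comp h

theorem continuous_hGrad (hX : ∀ k, IsSmoothField (X k))
    (ha : ContMDiff (𝓡 n) 𝓘(ℝ, ℝ) 1 a) : Continuous (hGrad X a) :=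
  continuous_iff_continuousAt.2 fun x => continuousAt_hGrad hX (ha x)

end ChartCalculus

end SubLaplace

namespace SubLaplace

/-! ### Products with compactly supported functions -/

section TestFunctions

set_option linter.unusedSectionVars false

variable {E : Type*} [NormedAddCommGroup E] [NormedSpace ℝ E]

theorem tsupport_mul_subset_right' {c φ : E → ℝ} : tsupport (fun z => c z * φ z) ⊆ tsupport φ :=
  closure_mono fun z hz => by
    simp only [Function.mem_support] at hz ⊢
    exact right_ne_zero_of_mul hz

/-- The factor `c` may be arbitrary off U, since the product vanishes near each point outside the
support of φ. This handles field coefficients, which are smooth only on the chart target. -/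
theorem contDiff_mul_of_tsupport_subset {m : ℕ∞} {c φ : E → ℝ} {U : Set E} (hU : IsOpen U)
    (hc : ContDiffOn ℝ m c U) (hφ : ContDiff ℝ m φ) (hs : tsupport φ ⊆ U) :
    ContDiff ℝ m (fun z => c z * φ z) := by
  refine contDiff_iff_contDiffAt.2 fun x => ?_
  by_cases hx : x ∈ tsupport φ
  · exact ((hc x (hs hx)).contDiffAt (hU.mem_nhds (hs hx))).mul hφ.contDiffAt
  · have h1 : φ =ᶠ[𝓝 x] fun _ => 0 := notMem_tsupport_iff_eventuallyEq.1 hx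
    refine (contDiffAt_const (c := (0 : ℝ))).congr_of_eventuallyEq ?_
    filter_upwards [h1] with z hz
    simp [hz]

theorem integrable_mul_of_tsupport_subset [MeasurableSpace E] [BorelSpace E] {τ : Measure E}
    [IsFiniteMeasureOnCompacts τ]
    {c g : E → ℝ} {U : Set E} (hc : ContinuousOn c U) (hg : Continuous g)
    (hgc : HasCompactSupport g) (hs : tsupport g ⊆ U) :
    Integrable (fun z => c z * g z) τ := by
  have h1 : IntegrableOn (fun z => c z * g z) (tsupport g) τ :=
    ((hc.mono hs).mul hg.continuousOn).integrableOn_compact hgc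
  refine (integrableOn_iff_integrable_of_support_subset ?_).1 h1
  intro z hz
  exact subset_tsupport _ (right_ne_zero_of_mul hz)

end TestFunctions

variable {n N : ℕ} {M : Type*} [TopologicalSpace M] [ChartedSpace (EuclideanSpace ℝ (Fin n)) M]

/-! ### Weak derivatives along a field and their limits -/

section WeakDerivative

/-- The classical derivative of `φ` along `V`. -/
noncomputable def dirDeriv (V : VField n M) (φ : M → ℝ) (x : M) : ℝ :=
  mfderiv (𝓡 n) 𝓘(ℝ, ℝ) φ x (V x)

variable [IsManifold (𝓡 n) ∞ M] {V : VField n M}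
  {e : OpenPartialHomeomorph M (EuclideanSpace ℝ (Fin n))} {φ : EuclideanSpace ℝ (Fin n) → ℝ}

theorem contDiffOn_chartField_coord (hV : IsSmoothField V)
    (he : e ∈ atlas (EuclideanSpace ℝ (Fin n)) M) (j : Fin n) :
    ContDiffOn ℝ ∞ (fun z => chartField e V z j) e.target :=
  (contDiffOn_piLp 2).1 (hV.contDiffOn_chartField he) j

theorem contDiff_chartField_mul (hV : IsSmoothField V)
    (he : e ∈ atlas (EuclideanSpace ℝ (Fin n)) M) (hφ : ContDiff ℝ ∞ φ)
    (hs : tsupport φ ⊆ e.target) (j : Fin n) :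
    ContDiff ℝ ∞ (fun z => chartField e V z j * φ z) :=
  contDiff_mul_of_tsupport_subset e.open_target (contDiffOn_chartField_coord hV he j) hφ hs

theorem contDiff_chartAdjoint (hV : IsSmoothField V)
    (he : e ∈ atlas (EuclideanSpace ℝ (Fin n)) M) (hφ : ContDiff ℝ ∞ φ)
    (hs : tsupport φ ⊆ e.target) : ContDiff ℝ ∞ (chartAdjoint e V φ) := by
  refine ContDiff.neg (ContDiff.sum fun j _ => ?_)
  exact ((contDiff_chartField_mul hV he hφ hs j).fderiv_right (m := ∞) (by simp)).clm_apply
    contDiff_const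

omit [IsManifold (𝓡 n) ∞ M] in
theorem tsupport_chartAdjoint_subset : tsupport (chartAdjoint e V φ) ⊆ tsupport φ := by
  refine closure_minimal (fun y hy => ?_) (isClosed_tsupport _)
  by_contra hn
  apply hy
  unfold chartAdjoint
  rw [neg_eq_zero]
  refine Finset.sum_eq_zero fun j _ => ?_
  have h1 : φ =ᶠ[𝓝 y] fun _ => 0 := notMem_tsupport_iff_eventuallyEq.1 hn
  have h2 : (fun z => chartField e V z j * φ z) =ᶠ[𝓝 y] fun _ => 0 := by
    filter_upwards [h1] with z hz
    simp [hz]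
  rw [h2.fderiv_eq]
  simp

/-- The classical derivative along a smooth field is the weak one. -/
theorem hasWeakDerivAlong_mfderiv (hV : IsSmoothField V) {Ω : Set M} {f : M → ℝ}
    (hf : ∀ x ∈ Ω, ContMDiffAt (𝓡 n) 𝓘(ℝ, ℝ) 1 f x) :
    HasWeakDerivAlong Ω V f (dirDeriv V f) := by
  intro e he φ hφ hφc hφs
  set U := e.target ∩ e.symm ⁻¹' Ω
  set F : EuclideanSpace ℝ (Fin n) → ℝ := fun y => f (e.symm y) with hF
  have hst : tsupport φ ⊆ e.target := hφs.trans inter_subset_left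
  have hFd : ∀ y ∈ U, ContDiffAt ℝ 1 F y := fun y hy =>
    contDiffAt_comp_chart_symm (m := 1) he hy.1 (hf _ hy.2)
  have hFc : ContinuousOn F U := fun y hy => (hFd y hy).continuousAt.continuousWithinAt
  have hDc : ∀ v, ContinuousOn (fun y => fderiv ℝ F y v) U := fun v y hy =>
    (((hFd y hy).continuousAt_fderiv one_ne_zero).clm_apply continuousAt_const).continuousWithinAt
  set g : Fin n → EuclideanSpace ℝ (Fin n) → ℝ := fun j z => chartField e V z j * φ z with hg
  have hgs : ∀ j, ContDiff ℝ ∞ (g j) := contDiff_chartField_mul hV he hφ hst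
  have hgt : ∀ j, tsupport (g j) ⊆ tsupport φ := fun j => tsupport_mul_subset_right'
  have hgc : ∀ j, HasCompactSupport (g j) := fun j =>
    hφc.of_isClosed_subset (isClosed_tsupport _) (hgt j)
  have hgd : ∀ j v, Continuous (fun y => fderiv ℝ (g j) y v) := fun j v =>
    ((hgs j).continuous_fderiv (by simp)).clm_apply continuous_const
  have hgdc : ∀ j v, HasCompactSupport (fun y => fderiv ℝ (g j) y v) := fun j v =>
    (hgc j).fderiv_apply (𝕜 := ℝ) v
  have hgdt : ∀ j v, tsupport (fun y => fderiv ℝ (g j) y v) ⊆ U := fun j v =>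
    (tsupport_fderiv_apply_subset ℝ v).trans ((hgt j).trans hφs)
  have hI1 : ∀ j v, Integrable (fun y => fderiv ℝ F y v * g j y) := fun j v =>
    integrable_mul_of_tsupport_subset (hDc v) (hgs j).continuous (hgc j) ((hgt j).trans hφs)
  have hI2 : ∀ j v, Integrable (fun y => F y * fderiv ℝ (g j) y v) := fun j v =>
    integrable_mul_of_tsupport_subset hFc (hgd j v) (hgdc j v) (hgdt j v)
  have hI3 : ∀ j, Integrable (fun y => F y * g j y) := fun j =>
    integrable_mul_of_tsupport_subset hFc (hgs j).continuous (hgc j) ((hgt j).trans hφs)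
  -- Integration by parts coordinate by coordinate. `F` is C¹ only on U, but each g j = aⱼφ has
  -- compact support there.
  have hparts : ∀ j v, ∫ y, F y * fderiv ℝ (g j) y v = - ∫ y, fderiv ℝ F y v * g j y :=
    fun j v => integral_mul_fderiv_eq_neg_fderiv_mul_of_integrable (hI1 j v) (hI2 j v) (hI3 j)
      (fun y hy => (hFd y (hφs (hgt j hy))).differentiableAt one_ne_zero)
      (fun y _ => (hgs j).differentiable (by simp) y)
  have hL : ∀ y, dirDeriv V f (e.symm y) * φ y
      = ∑ j, fderiv ℝ F y (EuclideanSpace.single j 1) * g j y := by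
    intro y
    by_cases hy : y ∈ tsupport φ
    · rw [dirDeriv, (mfderiv_eq_fderiv_chart he V (hst hy)
        ((hf _ (hφs hy).2).mdifferentiableAt one_ne_zero)).2]
      have h1 : chartField e V y
          = ∑ j, chartField e V y j • EuclideanSpace.single j (1 : ℝ) := by
        ext k
        simp [Finset.sum_apply, Pi.single_apply]
      conv_lhs => rw [h1, map_sum]
      rw [Finset.sum_mul]
      refine Finset.sum_congr rfl fun j _ => ?_
      rw [map_smul, smul_eq_mul, hg]
      ring
    · have : φ y = 0 := image_eq_zero_of_notMem_tsupport hy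
      simp [hg, this]
  calc ∫ y, dirDeriv V f (e.symm y) * φ y
      = ∫ y, ∑ j, fderiv ℝ F y (EuclideanSpace.single j 1) * g j y :=
        integral_congr_ae (Eventually.of_forall hL)
    _ = ∑ j, ∫ y, fderiv ℝ F y (EuclideanSpace.single j 1) * g j y :=
        integral_finsetSum _ fun j _ => hI1 j _
    _ = - ∑ j, ∫ y, F y * fderiv ℝ (g j) y (EuclideanSpace.single j 1) := by
        rw [← Finset.sum_neg_distrib]
        refine Finset.sum_congr rfl fun j _ => ?_
        rw [hparts, neg_neg]
    _ = ∫ y, f (e.symm y) * chartAdjoint e V φ y := by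
        rw [← integral_finsetSum _ fun j _ => hI2 j _, ← integral_neg]
        refine integral_congr_ae (Eventually.of_forall fun y => ?_)
        simp only [chartAdjoint, hF, hg, mul_neg, Finset.mul_sum]

omit [IsManifold (𝓡 n) ∞ M] in
-- Dominated convergence in coordinates. The test function sees only a compact part of Ω, so local
-- integrability of the majorant suffices; this generality is needed for |∇_X v|/v.
theorem tendsto_integral_chart [T2Space M] [MeasurableSpace M] [BorelSpace M] {μ : Measure M}
    (hμ : IsSmoothVolume n μ) (he : e ∈ atlas (EuclideanSpace ℝ (Fin n)) M) {Ω : Set M}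
    (hΩ : IsOpen Ω) {f : ℕ → M → ℝ} {f₀ h : M → ℝ}
    (hf : ∀ i, AEStronglyMeasurable (f i) (μ.restrict Ω))
    (hh : ∀ K, IsCompact K → K ⊆ Ω → IntegrableOn h K μ)
    (hle : ∀ i, ∀ᵐ x ∂(μ.restrict Ω), |f i x| ≤ h x)
    (hlim : ∀ᵐ x ∂(μ.restrict Ω), Tendsto (fun i => f i x) atTop (𝓝 (f₀ x)))
    (hφ : Continuous φ) (hφc : HasCompactSupport φ)
    (hφs : tsupport φ ⊆ e.target ∩ e.symm ⁻¹' Ω) :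
    Tendsto (fun i => ∫ y, f i (e.symm y) * φ y) atTop (𝓝 (∫ y, f₀ (e.symm y) * φ y)) := by
  have hcont : ContinuousOn e.symm (tsupport φ) :=
    e.continuousOn_symm.mono (hφs.trans inter_subset_left)
  have hK : IsCompact (e.symm '' tsupport φ) := IsCompact.image_of_continuousOn hφc hcont
  have hKΩ : e.symm '' tsupport φ ⊆ Ω := by
    rintro _ ⟨y, hy, rfl⟩
    exact (hφs hy).2
  have hst : tsupport φ ⊆ e.target := hφs.trans inter_subset_left
  have hred : ∀ w : M → ℝ, ∫ y, w (e.symm y) * φ y = ∫ y in tsupport φ, w (e.symm y) * φ y :=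
    fun w => (setIntegral_eq_integral_of_forall_compl_eq_zero fun y hy => by
      rw [image_eq_zero_of_notMem_tsupport hy, mul_zero]).symm
  simp only [hred]
  have hhK := hh _ hK hKΩ
  have hhc : IntegrableOn (fun y => h (e.symm y)) (tsupport φ) :=
    hμ.integrableOn_chart he hφc hst hhK
  have hfc : ∀ i, IntegrableOn (fun y => f i (e.symm y)) (tsupport φ) := fun i =>
    hμ.integrableOn_chart he hφc hst (Integrable.mono' hhK
      ((hf i).mono_measure (Measure.restrict_mono hKΩ le_rfl))
      (ae_restrict_of_ae_restrict_of_subset hKΩ (hle i)))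
  refine tendsto_integral_of_dominated_convergence (fun y => h (e.symm y) * |φ y|) (fun i => ?_)
    ?_ (fun i => ?_) ?_
  · exact (hfc i).aestronglyMeasurable.mul hφ.aestronglyMeasurable
  · exact hhc.mul_continuousOn hφ.abs.continuousOn hφc
  · filter_upwards [ae_restrict_of_ae_restrict_of_subset hφs (hμ.ae_chart he hΩ (hle i))] with y hy
    rw [Real.norm_eq_abs, abs_mul]
    gcongr
  · filter_upwards [ae_restrict_of_ae_restrict_of_subset hφs (hμ.ae_chart he hΩ hlim)] with y hy
    exact hy.mul_const _

/-- Weak derivatives pass to locally dominated almost everywhere limits. -/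
theorem hasWeakDerivAlong_of_dominated [T2Space M] [MeasurableSpace M] [BorelSpace M]
    {μ : Measure M} (hμ : IsSmoothVolume n μ) (hV : IsSmoothField V) {Ω : Set M} (hΩ : IsOpen Ω)
    {f w : ℕ → M → ℝ} {f₀ w₀ h : M → ℝ}
    (hf : ∀ i, AEStronglyMeasurable (f i) (μ.restrict Ω))
    (hw : ∀ i, AEStronglyMeasurable (w i) (μ.restrict Ω))
    (hh : ∀ K, IsCompact K → K ⊆ Ω → IntegrableOn h K μ)
    (hfle : ∀ i, ∀ᵐ x ∂(μ.restrict Ω), |f i x| ≤ h x)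
    (hwle : ∀ i, ∀ᵐ x ∂(μ.restrict Ω), |w i x| ≤ h x)
    (hflim : ∀ᵐ x ∂(μ.restrict Ω), Tendsto (fun i => f i x) atTop (𝓝 (f₀ x)))
    (hwlim : ∀ᵐ x ∂(μ.restrict Ω), Tendsto (fun i => w i x) atTop (𝓝 (w₀ x)))
    (hd : ∀ i, HasWeakDerivAlong Ω V (f i) (w i)) : HasWeakDerivAlong Ω V f₀ w₀ := by
  intro e he φ hφ hφc hφs
  have hst : tsupport φ ⊆ e.target := hφs.trans inter_subset_left
  have h1 := tendsto_integral_chart hμ he hΩ hw hh hwle hwlim hφ.continuous hφc hφs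
  have h2 := tendsto_integral_chart hμ he hΩ hf hh hfle hflim
    (contDiff_chartAdjoint hV he hφ hst).continuous
    (hφc.of_isClosed_subset (isClosed_tsupport _) tsupport_chartAdjoint_subset)
    (tsupport_chartAdjoint_subset.trans hφs)
  refine tendsto_nhds_unique h1 (h2.congr fun i => ?_)
  exact (hd i e he φ hφ hφc hφs).symm

end WeakDerivative

end SubLaplace

namespace SubLaplace

/-! ### Mollification of C¹ functions -/

section Mollification

open scoped Convolution

variable {E : Type*} [NormedAddCommGroup E] [InnerProductSpace ℝ E] [FiniteDimensional ℝ E]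
  [MeasurableSpace E] [BorelSpace E]

/-- Differentiation falls on F, and the result is again a convolution with scalar multiplication, so
the same bump estimate applies to F and to its derivative. -/
theorem normed_convolution_precompR (η : ContDiffBump (0 : E)) {F : E → ℝ} (hF : ContDiff ℝ 1 F)
    (hc : HasCompactSupport F) (x : E) :
    HasFDerivAt (η.normed volume ⋆[ContinuousLinearMap.lsmul ℝ ℝ, volume] F)
      ((η.normed volume ⋆[ContinuousLinearMap.lsmul ℝ ℝ, volume] (fderiv ℝ F)) x) x := by
  have h := hc.hasFDerivAt_convolution_right (ContinuousLinearMap.lsmul ℝ ℝ)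
    ((η.continuous_normed (μ := volume)).locallyIntegrable (μ := volume)) hF x
  have key : (η.normed volume ⋆[ContinuousLinearMap.lsmul ℝ ℝ, volume] (fderiv ℝ F)) x =
      (η.normed volume ⋆[(ContinuousLinearMap.lsmul ℝ ℝ).precompR E, volume] (fderiv ℝ F)) x := by
    refine integral_congr_ae (Eventually.of_forall fun t => ?_)
    ext v
    rfl
  rw [key]
  exact h

/-- `C¹` functions with compact support are approximated in `C¹` by smooth ones. -/
theorem exists_contDiff_near {F : E → ℝ} (hF : ContDiff ℝ 1 F) (hc : HasCompactSupport F)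
    {K : Set E} (hK : IsCompact K) (hs : tsupport F ⊆ interior K) {ε : ℝ} (hε : 0 < ε) :
    ∃ G : E → ℝ, ContDiff ℝ ∞ G ∧ tsupport G ⊆ K ∧
      ∀ x, |G x - F x| ≤ ε ∧ ‖fderiv ℝ G x - fderiv ℝ F x‖ ≤ ε := by
  have hu1 : UniformContinuous F := hc.uniformContinuous_of_continuous hF.continuous
  have hu2 : UniformContinuous (fderiv ℝ F) :=
    (hc.fderiv (𝕜 := ℝ)).uniformContinuous_of_continuous (hF.continuous_fderiv one_ne_zero)
  obtain ⟨δ₁, hδ₁, h1⟩ := Metric.uniformContinuous_iff.1 hu1 ε hε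
  obtain ⟨δ₂, hδ₂, h2⟩ := Metric.uniformContinuous_iff.1 hu2 ε hε
  obtain ⟨δ₃, hδ₃, h3⟩ := IsCompact.exists_thickening_subset_open hc isOpen_interior hs
  -- The radius respects the uniform continuity of F, that of its derivative, and the distance from
  -- the support of F to the complement of the interior of K.
  set r := min δ₁ (min δ₂ δ₃) with hr
  have hr0 : 0 < r := lt_min hδ₁ (lt_min hδ₂ hδ₃)
  let η : ContDiffBump (0 : E) := ⟨r / 2, r, by linarith, by linarith⟩
  set G := η.normed volume ⋆[ContinuousLinearMap.lsmul ℝ ℝ, volume] F with hG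
  refine ⟨G, ?_, ?_, fun x => ⟨?_, ?_⟩⟩
  · exact η.hasCompactSupport_normed.contDiff_convolution_left _ η.contDiff_normed
      hF.continuous.locallyIntegrable
  · refine closure_minimal (fun x hx => ?_) hK.isClosed
    have h4 := support_convolution_subset_swap (ContinuousLinearMap.lsmul ℝ ℝ) hx
    obtain ⟨a, ha, b, hb, rfl⟩ := Set.mem_add.1 h4
    rw [η.support_normed_eq] at hb
    refine interior_subset (h3 ?_)
    rw [Metric.mem_thickening_iff]
    refine ⟨a, subset_tsupport _ ha, ?_⟩
    have : dist (a + b) a = ‖b‖ := by simp [dist_eq_norm]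
    rw [this]
    exact (mem_ball_zero_iff.1 hb).trans_le ((min_le_right _ _).trans (min_le_right _ _))
  · rw [← Real.dist_eq]
    refine η.dist_normed_convolution_le hF.continuous.aestronglyMeasurable fun y hy => ?_
    exact (h1 ((Metric.mem_ball.1 hy).trans_le (min_le_left _ _))).le
  · rw [(normed_convolution_precompR η hF hc x).fderiv, ← dist_eq_norm]
    refine η.dist_normed_convolution_le
      (hF.continuous_fderiv one_ne_zero).aestronglyMeasurable fun y hy => ?_
    exact (h2 ((Metric.mem_ball.1 hy).trans_le ((min_le_right _ _).trans (min_le_left _ _)))).le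

end Mollification

theorem euclidean_norm_le_sum {N : ℕ} (v : EuclideanSpace ℝ (Fin N)) : ‖v‖ ≤ ∑ k, |v k| := by
  rw [EuclideanSpace.norm_eq]
  refine Real.sqrt_le_iff.2 ⟨Finset.sum_nonneg fun _ _ => abs_nonneg _, ?_⟩
  simp only [Real.norm_eq_abs]
  exact Finset.sum_sq_le_sq_sum_of_nonneg fun _ _ => abs_nonneg _

variable {n N : ℕ} {M : Type*} [TopologicalSpace M] [ChartedSpace (EuclideanSpace ℝ (Fin n)) M]

/-! ### Test functions are C¹-dense among compactly supported C¹ functions -/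

section Approximation

theorem IsTestFunction.add {Ω : Set M} {φ ψ : M → ℝ} (hφ : IsTestFunction n Ω φ)
    (hψ : IsTestFunction n Ω ψ) : IsTestFunction n Ω (fun x => φ x + ψ x) := by
  refine ⟨hφ.1.add hψ.1, hφ.2.1.add hψ.2.1, ?_⟩
  exact (tsupport_add φ ψ).trans (union_subset hφ.2.2 hψ.2.2)

/-- `φ` is a `C¹` function that is approximated in `C¹` by test functions. -/
def IsC1Approximable (X : Fin N → VField n M) (Ω : Set M) (φ : M → ℝ) : Prop :=
  ContMDiff (𝓡 n) 𝓘(ℝ, ℝ) 1 φ ∧ ∀ ε : ℝ, 0 < ε → ∃ ψ : M → ℝ, IsTestFunction n Ω ψ ∧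
    ∀ x, |ψ x - φ x| ≤ ε ∧ ‖hGrad X ψ x - hGrad X φ x‖ ≤ ε

variable {X : Fin N → VField n M} {Ω : Set M}

theorem IsC1Approximable.zero : IsC1Approximable X Ω (fun _ => 0) := by
  refine ⟨contMDiff_const, fun ε hε => ⟨fun _ => 0, ⟨contMDiff_const, ?_, ?_⟩, fun x => ?_⟩⟩
  · exact HasCompactSupport.zero
  · simp [tsupport]
  · simp [hε.le]

theorem IsC1Approximable.add {φ ψ : M → ℝ} (hφ : IsC1Approximable X Ω φ)
    (hψ : IsC1Approximable X Ω ψ) : IsC1Approximable X Ω (fun x => φ x + ψ x) := by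
  refine ⟨hφ.1.add hψ.1, fun ε hε => ?_⟩
  obtain ⟨a, ha, ha'⟩ := hφ.2 (ε / 2) (half_pos hε)
  obtain ⟨b, hb, hb'⟩ := hψ.2 (ε / 2) (half_pos hε)
  refine ⟨_, ha.add hb, fun x => ⟨?_, ?_⟩⟩
  · calc |a x + b x - (φ x + ψ x)| = |(a x - φ x) + (b x - ψ x)| := by ring_nf
      _ ≤ |a x - φ x| + |b x - ψ x| := abs_add_le _ _
      _ ≤ ε := by linarith [(ha' x).1, (hb' x).1]
  · have h1 := (hasHGradAt_of_contMDiffAt (X := X) ((ha.1.of_le (by simp)) x)).add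
      (hasHGradAt_of_contMDiffAt (X := X) ((hb.1.of_le (by simp)) x))
    have h2 := (hasHGradAt_of_contMDiffAt (X := X) (hφ.1 x)).add
      (hasHGradAt_of_contMDiffAt (X := X) (hψ.1 x))
    rw [h1.2, h2.2]
    calc ‖hGrad X a x + hGrad X b x - (hGrad X φ x + hGrad X ψ x)‖
        = ‖(hGrad X a x - hGrad X φ x) + (hGrad X b x - hGrad X ψ x)‖ := by congr 1; abel
      _ ≤ ‖hGrad X a x - hGrad X φ x‖ + ‖hGrad X b x - hGrad X ψ x‖ := norm_add_le _ _
      _ ≤ ε := by linarith [(ha' x).2, (hb' x).2]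

theorem IsC1Approximable.finset_sum {ι : Type*} (s : Finset ι) {φ : ι → M → ℝ}
    (h : ∀ i ∈ s, IsC1Approximable X Ω (φ i)) :
    IsC1Approximable X Ω (fun x => ∑ i ∈ s, φ i x) := by
  classical
  induction s using Finset.induction_on with
  | empty => simpa using IsC1Approximable.zero
  | insert i s hi ih =>
    simp only [Finset.sum_insert hi]
    exact (h i (Finset.mem_insert_self _ _)).add
      (ih fun j hj => h j (Finset.mem_insert_of_mem hj))

variable [IsManifold (𝓡 n) ∞ M]

/-- The function is mollified in coordinates and carried back. Field coefficients are bounded on a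
compact neighbourhood of the support, so Euclidean C¹ closeness gives closeness of horizontal
gradients. -/
theorem isC1Approximable_of_chart [T2Space M] (hX : ∀ k, IsSmoothField (X k)) (hΩ : IsOpen Ω)
    {e : OpenPartialHomeomorph M (EuclideanSpace ℝ (Fin n))}
    (he : e ∈ atlas (EuclideanSpace ℝ (Fin n)) M) {φ : M → ℝ}
    (hφ : ContMDiff (𝓡 n) 𝓘(ℝ, ℝ) 1 φ) (hc : HasCompactSupport φ)
    (hs : tsupport φ ⊆ e.source ∩ Ω) : IsC1Approximable X Ω φ := by
  classical
  refine ⟨hφ, fun ε hε => ?_⟩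
  set U := e.target ∩ e.symm ⁻¹' Ω
  have hU : IsOpen U := e.isOpen_inter_preimage_symm hΩ
  have hKc : IsCompact (e '' tsupport φ) :=
    IsCompact.image_of_continuousOn hc (e.continuousOn.mono (hs.trans inter_subset_left))
  have hKU : e '' tsupport φ ⊆ U := by
    rintro _ ⟨x, hx, rfl⟩
    exact ⟨e.map_source (hs hx).1, by simpa [e.left_inv (hs hx).1] using (hs hx).2⟩
  set F : EuclideanSpace ℝ (Fin n) → ℝ := fun y => if y ∈ e.target then φ (e.symm y) else 0
    with hF
  have hFe : ∀ x ∈ e.source, F (e x) = φ x := fun x hx => by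
    simp [hF, e.map_source hx, e.left_inv hx]
  have hFs : tsupport F ⊆ e '' tsupport φ := by
    refine closure_minimal (fun y hy => ?_) hKc.isClosed
    by_cases hyt : y ∈ e.target
    · have h1 : φ (e.symm y) ≠ 0 := by simpa [hF, hyt] using hy
      exact ⟨e.symm y, subset_tsupport _ h1, e.right_inv hyt⟩
    · simp [hF, hyt] at hy
  have hFeq : ∀ y ∈ e.target, F =ᶠ[𝓝 y] fun z => φ (e.symm z) := fun y hy => by
    filter_upwards [e.open_target.mem_nhds hy] with z hz
    simp [hF, hz]
  have hFd : ContDiff ℝ 1 F := by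
    refine contDiff_iff_contDiffAt.2 fun y => ?_
    by_cases hy : y ∈ tsupport F
    · have hyU := hKU (hFs hy)
      exact (contDiffAt_comp_chart_symm (m := 1) he hyU.1 (hφ _)).congr_of_eventuallyEq
        (hFeq y hyU.1)
    · exact contDiffAt_const.congr_of_eventuallyEq (notMem_tsupport_iff_eventuallyEq.1 hy)
  have hFc : HasCompactSupport F := hKc.of_isClosed_subset (isClosed_tsupport _) hFs
  obtain ⟨K, hK, hK1, hK2⟩ := exists_compact_between hFc hU (hFs.trans hKU)
  have hCex : ∀ k, ∃ C, ∀ y ∈ K, ‖chartField e (X k) y‖ ≤ C := fun k =>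
    hK.exists_bound_of_continuousOn
      (((hX k).contDiffOn_chartField he).continuousOn.mono (hK2.trans inter_subset_left))
  choose C hC using hCex
  set D : ℝ := ∑ k, |C k| with hD
  have hD0 : 0 ≤ D := Finset.sum_nonneg fun _ _ => abs_nonneg _
  -- `D` adds up bounds for the fields on K, so the horizontal error is at most ε'D. The extra 1
  -- avoids division by 0 and gives ε' ≤ ε for the values themselves.
  set ε' := ε / (D + 1) with hε'
  have hε'0 : 0 < ε' := by positivity
  have hε'1 : ε' ≤ ε := div_le_self hε.le (by linarith)
  obtain ⟨G, hG, hGK, hGF⟩ := exists_contDiff_near hFd hFc hK hK1 hε'0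
  set ψ : M → ℝ := fun x => if x ∈ e.source then G (e x) else 0 with hψ
  have hLc : IsCompact (e.symm '' K) :=
    hK.image_of_continuousOn (e.continuousOn_symm.mono (hK2.trans inter_subset_left))
  have hLs : e.symm '' K ⊆ e.source ∩ Ω := by
    rintro _ ⟨y, hy, rfl⟩
    exact ⟨e.map_target (hK2 hy).1, (hK2 hy).2⟩
  have hψs : tsupport ψ ⊆ e.symm '' K := by
    refine closure_minimal (fun x hx => ?_) hLc.isClosed
    by_cases hxs : x ∈ e.source
    · have h1 : G (e x) ≠ 0 := by simpa [hψ, hxs] using hx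
      exact ⟨e x, hGK (subset_tsupport _ h1), e.left_inv hxs⟩
    · simp [hψ, hxs] at hx
  have hφs : tsupport φ ⊆ e.symm '' K := fun x hx => by
    refine ⟨e x, interior_subset (hK1 ?_), e.left_inv (hs hx).1⟩
    by_contra hn
    have h1 : F =ᶠ[𝓝 (e x)] fun _ => 0 := notMem_tsupport_iff_eventuallyEq.1 hn
    have h2 : φ =ᶠ[𝓝 x] fun _ => 0 := by
      filter_upwards [(e.continuousAt (hs hx).1).eventually h1,
        e.open_source.mem_nhds (hs hx).1] with z hz hzs
      rw [← hFe z hzs, hz]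
    exact notMem_tsupport_iff_eventuallyEq.2 h2 hx
  have hψeq : ∀ x ∈ e.source, ψ =ᶠ[𝓝 x] fun z => G (e z) := fun x hx => by
    filter_upwards [e.open_source.mem_nhds hx] with z hz
    simp [hψ, hz]
  have hψd : ContMDiff (𝓡 n) 𝓘(ℝ, ℝ) ∞ ψ := by
    refine contMDiff_of_tsupport fun x hx => ?_
    have hxs := (hLs (hψs hx)).1
    refine ContMDiffAt.congr_of_eventuallyEq ?_ (hψeq x hxs)
    exact hG.contDiffAt.contMDiffAt.comp x (contMDiffAt_chart he hxs)
  refine ⟨ψ, ⟨hψd, hLc.of_isClosed_subset (isClosed_tsupport _) hψs,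
    hψs.trans (hLs.trans inter_subset_right)⟩, fun x => ?_⟩
  by_cases hx : x ∈ e.symm '' K
  · have hxs := (hLs hx).1
    have hxK : e x ∈ K := by
      obtain ⟨y, hy, rfl⟩ := hx
      rwa [e.right_inv (hK2 hy).1]
    have hxt := e.map_source hxs
    constructor
    · have h1 : ψ x = G (e x) := by simp [hψ, hxs]
      rw [h1, ← hFe x hxs]
      exact ((hGF _).1).trans hε'1
    · have hcomp : ∀ k, |(hGrad X ψ x - hGrad X φ x) k| ≤ ε' * |C k| := fun k => by
        have h1 := (mfderiv_eq_fderiv_chart he (X k) hxt (a := ψ)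
          ((hψd _).mdifferentiableAt (by simp))).2
        have h2 := (mfderiv_eq_fderiv_chart he (X k) hxt (a := φ)
          ((hφ _).mdifferentiableAt one_ne_zero)).2
        rw [e.left_inv hxs] at h1 h2
        have h3 : (fun z => ψ (e.symm z)) =ᶠ[𝓝 (e x)] G := by
          filter_upwards [e.open_target.mem_nhds hxt] with z hz
          simp [hψ, e.map_target hz, e.right_inv hz]
        rw [h3.fderiv_eq] at h1
        rw [← (hFeq _ hxt).fderiv_eq] at h2
        have h4 : (hGrad X ψ x - hGrad X φ x) k
            = (fderiv ℝ G (e x) - fderiv ℝ F (e x)) (chartField e (X k) (e x)) :=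
          congrArg₂ (fun s t : ℝ => s - t) h1 h2
        rw [h4, ← Real.norm_eq_abs]
        refine (ContinuousLinearMap.le_opNorm _ _).trans ?_
        gcongr
        · exact (hGF _).2
        · exact (hC k _ hxK).trans (le_abs_self _)
      calc ‖hGrad X ψ x - hGrad X φ x‖ ≤ ∑ k, |(hGrad X ψ x - hGrad X φ x) k| :=
            euclidean_norm_le_sum _
        _ ≤ ∑ k, ε' * |C k| := Finset.sum_le_sum fun k _ => hcomp k
        _ = ε' * D := by rw [hD, Finset.mul_sum]
        _ ≤ ε := by
            rw [hε', div_mul_eq_mul_div, div_le_iff₀ (by linarith)]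
            nlinarith
  · have h1 : x ∉ tsupport ψ := fun h => hx (hψs h)
    have h2 : x ∉ tsupport φ := fun h => hx (hφs h)
    rw [image_eq_zero_of_notMem_tsupport h1, image_eq_zero_of_notMem_tsupport h2,
      hGrad_eq_zero_of_notMem_tsupport h1, hGrad_eq_zero_of_notMem_tsupport h2]
    simp [hε.le]

/-- `C¹` functions with compact support in `Ω` are approximated in `C¹` by test functions. -/
theorem isC1Approximable_of_hasCompactSupport [T2Space M] [SecondCountableTopology M]
    (hX : ∀ k, IsSmoothField (X k)) (hΩ : IsOpen Ω) {φ : M → ℝ}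
    (hφ : ContMDiff (𝓡 n) 𝓘(ℝ, ℝ) 1 φ) (hc : HasCompactSupport φ) (hs : tsupport φ ⊆ Ω) :
    IsC1Approximable X Ω φ := by
  have : LocallyCompactSpace M :=
    ChartedSpace.locallyCompactSpace (EuclideanSpace ℝ (Fin n)) M
  obtain ⟨f, hf⟩ := SmoothPartitionOfUnity.exists_isSubordinate (𝓡 n) (isClosed_tsupport φ)
    (fun x : M => (chartAt (EuclideanSpace ℝ (Fin n)) x).source ∩ Ω)
    (fun x => (chartAt _ x).open_source.inter hΩ)
    (fun x hx => mem_iUnion.2 ⟨x, mem_chart_source _ x, hs hx⟩)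
  -- Only finitely many members of the partition of unity meet the compact support, so φ is a finite
  -- sum of functions each living in one chart.
  have hfin := f.locallyFinite.finite_nonempty_inter_compact hc
  have hsum : φ = fun x => ∑ i ∈ hfin.toFinset, f i x * φ x := by
    funext x
    by_cases hx : x ∈ tsupport φ
    · have h1 := f.sum_eq_one hx
      have h2 : ∑ᶠ i, f i x = ∑ i ∈ hfin.toFinset, f i x := by
        refine finsum_eq_sum_of_support_subset _ fun i hi => ?_
        rw [Finite.coe_toFinset]
        exact ⟨x, hi, hx⟩
      rw [← Finset.sum_mul, ← h2, h1, one_mul]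
    · simp [image_eq_zero_of_notMem_tsupport hx]
  rw [hsum]
  refine IsC1Approximable.finset_sum _ fun i _ => ?_
  have ht : tsupport (fun x => f i x * φ x) ⊆ tsupport φ :=
    closure_mono fun z hz => right_ne_zero_of_mul hz
  have ht' : tsupport (fun x => f i x * φ x) ⊆ tsupport (f i) :=
    closure_mono fun z hz => left_ne_zero_of_mul hz
  exact isC1Approximable_of_chart hX hΩ (chart_mem_atlas _ i)
    (((f i).contMDiff.of_le (by simp)).mul hφ)
    (hc.of_isClosed_subset (isClosed_tsupport _) ht) (ht'.trans (hf i))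

end Approximation

end SubLaplace

namespace SubLaplace

/-! ### Power inequalities with constants uniform in the exponent -/

section Powers

theorem add_rpow_le_two_rpow_mul {a b p P : ℝ} (ha : 0 ≤ a) (hb : 0 ≤ b) (hp : 0 ≤ p)
    (hP : p ≤ P) : (a + b) ^ p ≤ 2 ^ P * (a ^ p + b ^ p) := by
  have h1 : (a + b) ^ p ≤ (2 * max a b) ^ p := by
    refine Real.rpow_le_rpow (by positivity) ?_ hp
    linarith [le_max_left a b, le_max_right a b]
  rw [Real.mul_rpow (by norm_num) (by positivity)] at h1
  refine h1.trans ?_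
  gcongr
  · exact one_le_two
  · rcases le_total a b with h | h
    · rw [max_eq_right h]
      linarith [Real.rpow_nonneg ha p]
    · rw [max_eq_left h]
      linarith [Real.rpow_nonneg hb p]

theorem le_one_add_rpow {a p : ℝ} (ha : 0 ≤ a) (hp : 1 ≤ p) : a ≤ 1 + a ^ p := by
  rcases le_total a 1 with h | h
  · linarith [Real.rpow_nonneg ha p]
  · linarith [Real.self_le_rpow_of_one_le h hp]

end Powers

/-! ### Luxemburg norm, modular and dominated convergence -/

section Modular

variable {M : Type*} [MeasurableSpace M] {F : Type*} [NormedAddCommGroup F]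
  {μ : Measure M} {Ω : Set M} {p : M → ℝ} {P : ℝ}

/-- An admissible t < ε ≤ 1 satisfies t^p ≤ t because p > 1, so scaling by t costs at most a factor
t. -/
theorem modular_le_of_luxNorm_lt (hp : ∀ᵐ x ∂(μ.restrict Ω), 1 < p x ∧ p x ≤ P) {u : M → F}
    {ε : ℝ} (hε1 : ε ≤ 1) (h : luxNorm μ Ω p u < ENNReal.ofReal ε) :
    ∫⁻ x in Ω, ENNReal.ofReal (‖u x‖ ^ p x) ∂μ ≤ ENNReal.ofReal ε := by
  obtain ⟨_, ⟨t, ⟨ht0, ht⟩, rfl⟩, htε⟩ := sInf_lt_iff.1 h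
  have htε' : t < ε := by
    by_contra hn
    exact absurd htε (not_lt.2 (ENNReal.ofReal_le_ofReal (not_lt.1 hn)))
  calc ∫⁻ x in Ω, ENNReal.ofReal (‖u x‖ ^ p x) ∂μ
      ≤ ∫⁻ x in Ω, ENNReal.ofReal t * ENNReal.ofReal ((‖u x‖ / t) ^ p x) ∂μ := by
        refine lintegral_mono_ae ?_
        filter_upwards [hp] with x hx
        rw [← ENNReal.ofReal_mul ht0.le]
        refine ENNReal.ofReal_le_ofReal ?_
        have h1 : ‖u x‖ ^ p x = t ^ p x * (‖u x‖ / t) ^ p x := by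
          rw [← Real.mul_rpow ht0.le (by positivity)]
          congr 1
          field_simp
        rw [h1]
        gcongr
        calc t ^ p x ≤ t ^ (1 : ℝ) :=
              Real.rpow_le_rpow_of_exponent_ge ht0 (by linarith) hx.1.le
          _ = t := Real.rpow_one t
    _ = ENNReal.ofReal t * ∫⁻ x in Ω, ENNReal.ofReal ((‖u x‖ / t) ^ p x) ∂μ :=
        lintegral_const_mul' _ _ ENNReal.ofReal_ne_top
    _ ≤ ENNReal.ofReal t * 1 := by gcongr
    _ ≤ ENNReal.ofReal ε := by rw [mul_one]; exact ENNReal.ofReal_le_ofReal htε'.le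

/-- For ε ≤ 1 and p ≤ P one has ε^{-p} ≤ ε^{-P}, so ε itself is admissible. With the preceding
bound, norm convergence and modular convergence coincide. -/
theorem luxNorm_le_of_modular_le (hp : ∀ᵐ x ∂(μ.restrict Ω), 1 < p x ∧ p x ≤ P) {u : M → F}
    {ε : ℝ} (hε0 : 0 < ε) (hε1 : ε ≤ 1)
    (h : ∫⁻ x in Ω, ENNReal.ofReal (‖u x‖ ^ p x) ∂μ ≤ ENNReal.ofReal (ε ^ P)) :
    luxNorm μ Ω p u ≤ ENNReal.ofReal ε := by
  refine sInf_le ⟨ε, ⟨hε0, ?_⟩, rfl⟩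
  have hεP : 0 < ε ^ P := Real.rpow_pos_of_pos hε0 _
  calc ∫⁻ x in Ω, ENNReal.ofReal ((‖u x‖ / ε) ^ p x) ∂μ
      ≤ ∫⁻ x in Ω, ENNReal.ofReal (ε ^ P)⁻¹ * ENNReal.ofReal (‖u x‖ ^ p x) ∂μ := by
        refine lintegral_mono_ae ?_
        filter_upwards [hp] with x hx
        rw [← ENNReal.ofReal_mul (by positivity)]
        refine ENNReal.ofReal_le_ofReal ?_
        rw [Real.div_rpow (norm_nonneg _) hε0.le, div_eq_inv_mul]
        gcongr ?_ * _
        exact inv_anti₀ hεP (Real.rpow_le_rpow_of_exponent_ge hε0 hε1 hx.2)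
    _ = ENNReal.ofReal (ε ^ P)⁻¹ * ∫⁻ x in Ω, ENNReal.ofReal (‖u x‖ ^ p x) ∂μ :=
        lintegral_const_mul' _ _ ENNReal.ofReal_ne_top
    _ ≤ ENNReal.ofReal (ε ^ P)⁻¹ * ENNReal.ofReal (ε ^ P) := by gcongr
    _ = 1 := by
        rw [← ENNReal.ofReal_mul (by positivity), inv_mul_cancel₀ hεP.ne', ENNReal.ofReal_one]

theorem tendsto_luxNorm_of_modular (hp : ∀ᵐ x ∂(μ.restrict Ω), 1 < p x ∧ p x ≤ P)
    {u : ℕ → M → F}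
    (h : Tendsto (fun i => ∫⁻ x in Ω, ENNReal.ofReal (‖u i x‖ ^ p x) ∂μ) atTop (𝓝 0)) :
    Tendsto (fun i => luxNorm μ Ω p (u i)) atTop (𝓝 0) := by
  rw [ENNReal.tendsto_nhds_zero] at h ⊢
  intro ε hε
  obtain ⟨δ, hδ0, hδ1, hδε⟩ : ∃ δ : ℝ, 0 < δ ∧ δ ≤ 1 ∧ ENNReal.ofReal δ ≤ ε := by
    refine ⟨(min ε 1).toReal, ENNReal.toReal_pos ?_ ?_, ?_, ?_⟩
    · exact (lt_min hε one_pos).ne'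
    · exact ((min_le_right _ _).trans_lt ENNReal.one_lt_top).ne
    · exact ENNReal.toReal_le_of_le_ofReal zero_le_one (by simp)
    · rw [ENNReal.ofReal_toReal ((min_le_right _ _).trans_lt ENNReal.one_lt_top).ne]
      exact min_le_left _ _
  filter_upwards [h (ENNReal.ofReal (δ ^ P))
    (ENNReal.ofReal_pos.2 (Real.rpow_pos_of_pos hδ0 _))] with i hi
  exact (luxNorm_le_of_modular_le hp hδ0 hδ1 hi).trans hδε

/-- Fast modular convergence gives dominated almost everywhere convergence. -/
theorem exists_dominating_of_modular [MeasurableSpace F] [BorelSpace F]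
    [SecondCountableTopology F]
    (hp : ∀ᵐ x ∂(μ.restrict Ω), 1 < p x ∧ p x ≤ P) (hpm : AEMeasurable p (μ.restrict Ω))
    {u : M → F} {f : ℕ → M → F} (hu : MemLpVar μ Ω p u)
    (hf : ∀ k, AEMeasurable (f k) (μ.restrict Ω))
    (h : ∀ k, ∫⁻ x in Ω, ENNReal.ofReal (‖u x - f k x‖ ^ p x) ∂μ ≤ ENNReal.ofReal ((1 / 2) ^ k)) :
    ∃ H : M → ℝ, Integrable H (μ.restrict Ω) ∧
      (∀ k, ∀ᵐ x ∂(μ.restrict Ω), ‖f k x‖ ^ p x ≤ H x) ∧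
      ∀ᵐ x ∂(μ.restrict Ω), Tendsto (fun k => f k x) atTop (𝓝 (u x)) := by
  have hmk : ∀ k, AEMeasurable (fun x => ENNReal.ofReal (‖u x - f k x‖ ^ p x)) (μ.restrict Ω) :=
    fun k => (((hu.1.sub (hf k)).norm).pow hpm).ennreal_ofReal
  -- The modular integrands are summed. The sum has finite integral by the geometric bound, so it is
  -- finite a.e.; it dominates each term and forces the terms to 0.
  set S : M → ENNReal := fun x => ∑' k, ENNReal.ofReal (‖u x - f k x‖ ^ p x) with hS
  have hSfin : ∫⁻ x in Ω, S x ∂μ ≠ ⊤ := by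
    rw [hS, lintegral_tsum hmk]
    refine ne_top_of_le_ne_top ?_ (ENNReal.tsum_le_tsum h)
    rw [← ENNReal.ofReal_tsum_of_nonneg (fun k => by positivity) summable_geometric_two]
    exact ENNReal.ofReal_ne_top
  have hSm : AEMeasurable S (μ.restrict Ω) := AEMeasurable.tsum hmk
  have hSae : ∀ᵐ x ∂(μ.restrict Ω), S x < ⊤ := ae_lt_top' hSm hSfin
  have hum : AEMeasurable (fun x => ENNReal.ofReal (‖u x‖ ^ p x)) (μ.restrict Ω) :=
    (hu.1.norm.pow hpm).ennreal_ofReal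
  refine ⟨fun x => 2 ^ P * (‖u x‖ ^ p x + (S x).toReal), ?_, fun k => ?_, ?_⟩
  · refine Integrable.const_mul
      (Integrable.add ?_ (integrable_toReal_of_lintegral_ne_top hSm hSfin)) _
    have := integrable_toReal_of_lintegral_ne_top hum hu.2.ne
    refine this.congr (Eventually.of_forall fun x => ?_)
    exact ENNReal.toReal_ofReal (by positivity)
  · filter_upwards [hSae, hp] with x hx hpx
    have h1 : ‖u x - f k x‖ ^ p x ≤ (S x).toReal := by
      rw [← ENNReal.ofReal_le_iff_le_toReal hx.ne]
      exact ENNReal.le_tsum k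
    have hp0 : 0 ≤ p x := by linarith [hpx.1]
    calc ‖f k x‖ ^ p x ≤ (‖u x‖ + ‖u x - f k x‖) ^ p x := by
          refine Real.rpow_le_rpow (norm_nonneg _) ?_ hp0
          calc ‖f k x‖ = ‖u x - (u x - f k x)‖ := by congr 1; abel
            _ ≤ _ := norm_sub_le _ _
      _ ≤ 2 ^ P * (‖u x‖ ^ p x + ‖u x - f k x‖ ^ p x) :=
          add_rpow_le_two_rpow_mul (norm_nonneg _) (norm_nonneg _) hp0 hpx.2
      _ ≤ _ := by gcongr
  · filter_upwards [hSae, hp] with x hx hpx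
    have h1 := ENNReal.tendsto_atTop_zero_of_tsum_ne_top hx.ne
    have h2 : Tendsto (fun k => ‖u x - f k x‖ ^ p x) atTop (𝓝 0) := by
      have := (ENNReal.tendsto_toReal ENNReal.zero_ne_top).comp h1
      refine this.congr fun k => ?_
      exact ENNReal.toReal_ofReal (by positivity)
    have hp0 : 0 < p x := by linarith [hpx.1]
    have h3 : Tendsto (fun k => ‖u x - f k x‖) atTop (𝓝 0) := by
      have := h2.rpow_const (p := (p x)⁻¹) (Or.inr (by positivity))
      rw [Real.zero_rpow (by positivity)] at this
      refine this.congr fun k => ?_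
      rw [← Real.rpow_mul (norm_nonneg _), mul_inv_cancel₀ hp0.ne', Real.rpow_one]
    rw [tendsto_iff_norm_sub_tendsto_zero]
    exact h3.congr fun k => norm_sub_rev _ _

theorem tendsto_modular_of_dominated [MeasurableSpace F] [BorelSpace F]
    [SecondCountableTopology F]
    (hp : ∀ᵐ x ∂(μ.restrict Ω), 1 < p x ∧ p x ≤ P) (hpm : AEMeasurable p (μ.restrict Ω))
    {u : M → F} {f : ℕ → M → F} (hu : AEMeasurable u (μ.restrict Ω))
    (hf : ∀ k, AEMeasurable (f k) (μ.restrict Ω)) {H : M → ℝ} (hH : Integrable H (μ.restrict Ω))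
    (hle : ∀ k, ∀ᵐ x ∂(μ.restrict Ω), ‖f k x‖ ^ p x ≤ H x)
    (hule : ∀ᵐ x ∂(μ.restrict Ω), ‖u x‖ ^ p x ≤ H x)
    (hlim : ∀ᵐ x ∂(μ.restrict Ω), Tendsto (fun k => f k x) atTop (𝓝 (u x))) :
    Tendsto (fun k => ∫⁻ x in Ω, ENNReal.ofReal (‖u x - f k x‖ ^ p x) ∂μ) atTop (𝓝 0) := by
  have h0 : ∫⁻ x in Ω, (0 : ENNReal) ∂μ = 0 := lintegral_zero
  rw [← h0]
  refine tendsto_lintegral_of_dominated_convergence' (fun x => ENNReal.ofReal (2 ^ P * (H x + H x)))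
    (fun k => (((hu.sub (hf k)).norm).pow hpm).ennreal_ofReal) (fun k => ?_) ?_ ?_
  · filter_upwards [hle k, hule, hp] with x h1 h2 hpx
    refine ENNReal.ofReal_le_ofReal ?_
    have hp0 : 0 ≤ p x := by linarith [hpx.1]
    calc ‖u x - f k x‖ ^ p x ≤ (‖u x‖ + ‖f k x‖) ^ p x :=
          Real.rpow_le_rpow (norm_nonneg _) (norm_sub_le _ _) hp0
      _ ≤ 2 ^ P * (‖u x‖ ^ p x + ‖f k x‖ ^ p x) :=
          add_rpow_le_two_rpow_mul (norm_nonneg _) (norm_nonneg _) hp0 hpx.2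
      _ ≤ _ := by gcongr
  · exact ((hH.add hH).const_mul _).lintegral_lt_top.ne
  · filter_upwards [hlim, hp] with x hx hpx
    have hp0 : 0 < p x := by linarith [hpx.1]
    have h1 : Tendsto (fun k => ‖u x - f k x‖ ^ p x) atTop (𝓝 0) := by
      have h2 : Tendsto (fun k => ‖u x - f k x‖) atTop (𝓝 0) := by
        simpa using ((tendsto_const_nhds (x := u x)).sub hx).norm
      have := h2.rpow_const (p := p x) (Or.inr hp0.le)
      rwa [Real.zero_rpow hp0.ne'] at this
    simpa using ENNReal.tendsto_ofReal h1

theorem rpow_norm_le_of_tendsto (hp : ∀ᵐ x ∂(μ.restrict Ω), 1 < p x ∧ p x ≤ P)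
    {u : M → F} {f : ℕ → M → F} {H : M → ℝ}
    (hle : ∀ k, ∀ᵐ x ∂(μ.restrict Ω), ‖f k x‖ ^ p x ≤ H x)
    (hlim : ∀ᵐ x ∂(μ.restrict Ω), Tendsto (fun k => f k x) atTop (𝓝 (u x))) :
    ∀ᵐ x ∂(μ.restrict Ω), ‖u x‖ ^ p x ≤ H x := by
  filter_upwards [ae_all_iff.2 hle, hlim, hp] with x h1 h2 hpx
  exact le_of_tendsto (h2.norm.rpow_const (Or.inr (by linarith [hpx.1])))
    (Eventually.of_forall h1)

theorem memLpVar_of_le [MeasurableSpace F] {u : M → F}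
    (hu : AEMeasurable u (μ.restrict Ω)) {H : M → ℝ} (hH : Integrable H (μ.restrict Ω))
    (hle : ∀ᵐ x ∂(μ.restrict Ω), ‖u x‖ ^ p x ≤ H x) : MemLpVar μ Ω p u :=
  ⟨hu, (lintegral_mono_ae (hle.mono fun _ hx => ENNReal.ofReal_le_ofReal hx)).trans_lt
    hH.lintegral_lt_top⟩

theorem MemLpVar.integrable_rpow [MeasurableSpace F] [BorelSpace F]
    (hpm : AEMeasurable p (μ.restrict Ω)) {u : M → F} (hu : MemLpVar μ Ω p u) :
    Integrable (fun x => ‖u x‖ ^ p x) (μ.restrict Ω) := by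
  refine ⟨(hu.1.norm.pow hpm).aestronglyMeasurable, ?_⟩
  rw [hasFiniteIntegral_iff_ofReal (Eventually.of_forall fun x => by positivity)]
  exact hu.2

end Modular

variable {n N : ℕ} {M : Type*} [TopologicalSpace M] [ChartedSpace (EuclideanSpace ℝ (Fin n)) M]

/-! ### W₀ through dominated a.e. limits -/

section Sobolev

variable [T2Space M] [SecondCountableTopology M] [IsManifold (𝓡 n) ∞ M] [MeasurableSpace M]
  [BorelSpace M] {μ : Measure M} {X : Fin N → VField n M} {Ω : Set M} {p : M → ℝ} {P : ℝ}
  {u : M → ℝ} {G : M → EuclideanSpace ℝ (Fin N)}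

omit [T2Space M] [SecondCountableTopology M] in
/-- Elements of `W₀` are dominated almost everywhere limits of test functions. -/
theorem MemW0.exists_dominated (hX : ∀ k, IsSmoothField (X k))
    (hp : ∀ᵐ x ∂(μ.restrict Ω), 1 < p x ∧ p x ≤ P) (hpm : AEMeasurable p (μ.restrict Ω))
    (hu : MemW0 μ Ω p X u G) :
    ∃ (φ : ℕ → M → ℝ) (H : M → ℝ), (∀ i, IsTestFunction n Ω (φ i)) ∧
      Integrable H (μ.restrict Ω) ∧
      (∀ i, ∀ᵐ x ∂(μ.restrict Ω), ‖φ i x‖ ^ p x ≤ H x) ∧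
      (∀ i, ∀ᵐ x ∂(μ.restrict Ω), ‖hGrad X (φ i) x‖ ^ p x ≤ H x) ∧
      (∀ᵐ x ∂(μ.restrict Ω), Tendsto (fun i => φ i x) atTop (𝓝 (u x))) ∧
      ∀ᵐ x ∂(μ.restrict Ω), Tendsto (fun i => hGrad X (φ i) x) atTop (𝓝 (G x)) := by
  obtain ⟨⟨hu1, hG1, -⟩, φ, hφ, hlim⟩ := hu
  have h1 : ∀ k : ℕ, ∃ i, luxNorm μ Ω p (fun x => u x - φ i x)
      + luxNorm μ Ω p (fun x => G x - hGrad X (φ i) x) < ENNReal.ofReal ((1 / 2) ^ k) := fun k =>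
    (hlim.eventually_lt_const (ENNReal.ofReal_pos.2 (by positivity))).exists
  -- A single subsequence, converging at rate 2^{-k}, serves for the functions and their gradients
  -- at once.
  choose i hi using h1
  have hk1 : ∀ k : ℕ, ((1 : ℝ) / 2) ^ k ≤ 1 := fun k => pow_le_one₀ (by norm_num) (by norm_num)
  obtain ⟨H₁, hH₁, hle₁, hlim₁⟩ := exists_dominating_of_modular hp hpm hu1
    (f := fun k => φ (i k)) (fun k => (hφ (i k)).1.continuous.measurable.aemeasurable)
    (fun k => modular_le_of_luxNorm_lt hp (hk1 k) (le_self_add.trans_lt (hi k)))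
  obtain ⟨H₂, hH₂, hle₂, hlim₂⟩ := exists_dominating_of_modular hp hpm hG1
    (f := fun k => hGrad X (φ (i k)))
    (fun k => (continuous_hGrad hX ((hφ (i k)).1.of_le (by simp))).measurable.aemeasurable)
    (fun k => modular_le_of_luxNorm_lt hp (hk1 k) (le_add_self.trans_lt (hi k)))
  refine ⟨fun k => φ (i k), fun x => H₁ x + H₂ x, fun k => hφ (i k), hH₁.add hH₂,
    fun k => ?_, fun k => ?_, hlim₁, hlim₂⟩
  · filter_upwards [hle₁ k, hle₂ k] with x h1 h2
    linarith [Real.rpow_nonneg (norm_nonneg (hGrad X (φ (i k)) x)) (p x)]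
  · filter_upwards [hle₁ k, hle₂ k] with x h1 h2
    linarith [Real.rpow_nonneg (norm_nonneg (φ (i k) x)) (p x)]

/-- Dominated almost everywhere limits of `C¹` functions with compact support belong to `W₀`. -/
theorem memW0_of_dominated [IsFiniteMeasure (μ.restrict Ω)] (hμ : IsSmoothVolume n μ)
    (hX : ∀ k, IsSmoothField (X k)) (hΩ : IsOpen Ω)
    (hp : ∀ᵐ x ∂(μ.restrict Ω), 1 < p x ∧ p x ≤ P) (hpm : AEMeasurable p (μ.restrict Ω))
    {φ : ℕ → M → ℝ} {H : M → ℝ} (hφ : ∀ i, ContMDiff (𝓡 n) 𝓘(ℝ, ℝ) 1 (φ i))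
    (hφc : ∀ i, HasCompactSupport (φ i)) (hφs : ∀ i, tsupport (φ i) ⊆ Ω)
    (hH : Integrable H (μ.restrict Ω))
    (hle : ∀ i, ∀ᵐ x ∂(μ.restrict Ω), ‖φ i x‖ ^ p x ≤ H x)
    (hgle : ∀ i, ∀ᵐ x ∂(μ.restrict Ω), ‖hGrad X (φ i) x‖ ^ p x ≤ H x)
    (hlim : ∀ᵐ x ∂(μ.restrict Ω), Tendsto (fun i => φ i x) atTop (𝓝 (u x)))
    (hglim : ∀ᵐ x ∂(μ.restrict Ω), Tendsto (fun i => hGrad X (φ i) x) atTop (𝓝 (G x))) :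
    MemW0 μ Ω p X u G := by
  -- W₀ is defined by smooth test functions, so each C¹ function is replaced by one at C¹ distance
  -- 1/(i+1).
  have happ : ∀ i : ℕ, ∃ ψ : M → ℝ, IsTestFunction n Ω ψ ∧
      ∀ x, |ψ x - φ i x| ≤ 1 / ((i : ℝ) + 1) ∧
        ‖hGrad X ψ x - hGrad X (φ i) x‖ ≤ 1 / ((i : ℝ) + 1) := fun i =>
    (isC1Approximable_of_hasCompactSupport hX hΩ (hφ i) (hφc i) (hφs i)).2 _ (by positivity)
  choose ψ hψ hψn using happ
  have hsmall : ∀ i : ℕ, 1 / ((i : ℝ) + 1) ≤ 1 := fun i => by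
    rw [div_le_one (by positivity)]
    linarith [(Nat.cast_nonneg i : (0 : ℝ) ≤ i)]
  have hφm : ∀ i, AEMeasurable (φ i) (μ.restrict Ω) := fun i =>
    (hφ i).continuous.measurable.aemeasurable
  have hφgm : ∀ i, AEMeasurable (hGrad X (φ i)) (μ.restrict Ω) := fun i =>
    (continuous_hGrad hX (hφ i)).measurable.aemeasurable
  have hψm : ∀ i, AEMeasurable (ψ i) (μ.restrict Ω) := fun i =>
    (hψ i).1.continuous.measurable.aemeasurable
  have hψgm : ∀ i, AEMeasurable (hGrad X (ψ i)) (μ.restrict Ω) := fun i =>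
    (continuous_hGrad hX ((hψ i).1.of_le (by simp))).measurable.aemeasurable
  have hum : AEMeasurable u (μ.restrict Ω) := aemeasurable_of_tendsto_metrizable_ae _ hφm hlim
  have hGm : AEMeasurable G (μ.restrict Ω) := aemeasurable_of_tendsto_metrizable_ae _ hφgm hglim
  have hule := rpow_norm_le_of_tendsto hp hle hlim
  have hGle := rpow_norm_le_of_tendsto hp hgle hglim
  have hH0 : ∀ᵐ x ∂(μ.restrict Ω), 0 ≤ H x := hule.mono fun x hx =>
    (Real.rpow_nonneg (norm_nonneg _) _).trans hx
  set H' : M → ℝ := fun x => 2 ^ P * (H x + 1) + H x with hH'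
  have hH'i : Integrable H' (μ.restrict Ω) :=
    ((hH.add (integrable_const 1)).const_mul _).add hH
  have hHH' : ∀ᵐ x ∂(μ.restrict Ω), H x ≤ H' x := hH0.mono fun x hx => by
    have : (0 : ℝ) ≤ 2 ^ P * (H x + 1) := by positivity
    simp only [hH']
    linarith
  -- A perturbation of size at most 1 changes the p-th power majorant only to H', which is still
  -- integrable because Ω has finite measure.
  have hpert : ∀ {F : Type} [NormedAddCommGroup F] (a b : F) (x : M) (i : ℕ), 1 < p x ∧ p x ≤ P →
      0 ≤ H x → ‖b‖ ^ p x ≤ H x → ‖a - b‖ ≤ 1 / ((i : ℝ) + 1) → ‖a‖ ^ p x ≤ H' x := by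
    intro F _ a b x i hpx hx hb hab
    have hp0 : 0 ≤ p x := by linarith [hpx.1]
    have h1 : ‖a‖ ≤ ‖b‖ + 1 := by
      have : ‖a‖ ≤ ‖b‖ + ‖a - b‖ := by
        calc ‖a‖ = ‖b + (a - b)‖ := by congr 1; abel
          _ ≤ _ := norm_add_le _ _
      linarith [hsmall i]
    calc ‖a‖ ^ p x ≤ (‖b‖ + 1) ^ p x := Real.rpow_le_rpow (norm_nonneg _) h1 hp0
      _ ≤ 2 ^ P * (‖b‖ ^ p x + 1 ^ p x) :=
          add_rpow_le_two_rpow_mul (norm_nonneg _) zero_le_one hp0 hpx.2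
      _ ≤ 2 ^ P * (H x + 1) := by rw [Real.one_rpow]; gcongr
      _ ≤ H' x := by simp only [hH']; linarith
  have hψle : ∀ i, ∀ᵐ x ∂(μ.restrict Ω), ‖ψ i x‖ ^ p x ≤ H' x := fun i => by
    filter_upwards [hle i, hp, hH0] with x h1 h2 h3
    exact hpert _ _ x i h2 h3 h1 (hψn i x).1
  have hψgle : ∀ i, ∀ᵐ x ∂(μ.restrict Ω), ‖hGrad X (ψ i) x‖ ^ p x ≤ H' x := fun i => by
    filter_upwards [hgle i, hp, hH0] with x h1 h2 h3
    exact hpert _ _ x i h2 h3 h1 (hψn i x).2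
  have hzero : Tendsto (fun i : ℕ => 1 / ((i : ℝ) + 1)) atTop (𝓝 0) :=
    tendsto_one_div_add_atTop_nhds_zero_nat
  have hψlim : ∀ᵐ x ∂(μ.restrict Ω), Tendsto (fun i => ψ i x) atTop (𝓝 (u x)) := by
    filter_upwards [hlim] with x hx
    have h1 : Tendsto (fun i => ψ i x - φ i x) atTop (𝓝 0) :=
      squeeze_zero_norm (fun i => (hψn i x).1) hzero
    simpa using h1.add hx
  have hψglim : ∀ᵐ x ∂(μ.restrict Ω), Tendsto (fun i => hGrad X (ψ i) x) atTop (𝓝 (G x)) := by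
    filter_upwards [hglim] with x hx
    have h1 : Tendsto (fun i => hGrad X (ψ i) x - hGrad X (φ i) x) atTop (𝓝 0) :=
      squeeze_zero_norm (fun i => (hψn i x).2) hzero
    simpa using h1.add hx
  have hule' : ∀ᵐ x ∂(μ.restrict Ω), ‖u x‖ ^ p x ≤ H' x := by
    filter_upwards [hule, hHH'] with x h1 h2 using h1.trans h2
  have hGle' : ∀ᵐ x ∂(μ.restrict Ω), ‖G x‖ ^ p x ≤ H' x := by
    filter_upwards [hGle, hHH'] with x h1 h2 using h1.trans h2
  refine ⟨⟨memLpVar_of_le hum hH hule, memLpVar_of_le hGm hH hGle, fun k => ?_⟩, ψ, hψ, ?_⟩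
  -- Since p > 1, |a| ≤ 1 + |a|^p turns the p-th power majorant into a majorant of the functions and
  -- derivatives themselves.
  · refine hasWeakDerivAlong_of_dominated hμ (hX k) hΩ (f := φ)
      (w := fun i => dirDeriv (X k) (φ i)) (h := fun x => 1 + H x)
      (fun i => (hφm i).aestronglyMeasurable) (fun i => ?_) (fun K _ hKΩ => ?_)
      (fun i => ?_) (fun i => ?_) hlim ?_
      (fun i => hasWeakDerivAlong_mfderiv (hX k) fun x _ => hφ i x)
    · have h1 : Continuous (fun x => hGrad X (φ i) x k) :=
        (EuclideanSpace.proj k).continuous.comp (continuous_hGrad hX (hφ i))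
      exact h1.measurable.aestronglyMeasurable
    · exact ((integrable_const (1 : ℝ)).add hH).mono_measure (Measure.restrict_mono hKΩ le_rfl)
    · filter_upwards [hle i, hp] with x h1 h2
      exact (le_one_add_rpow (abs_nonneg _) h2.1.le).trans (by gcongr; exact h1)
    · filter_upwards [hgle i, hp] with x h1 h2
      have h3 : |dirDeriv (X k) (φ i) x| ≤ ‖hGrad X (φ i) x‖ :=
        PiLp.norm_apply_le (hGrad X (φ i) x) k
      exact h3.trans ((le_one_add_rpow (norm_nonneg _) h2.1.le).trans (by gcongr))
    · filter_upwards [hglim] with x hx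
      exact ((EuclideanSpace.proj (𝕜 := ℝ) k).continuous.tendsto _).comp hx
  · have h1 := tendsto_luxNorm_of_modular hp
      (tendsto_modular_of_dominated hp hpm hum hψm hH'i hψle hule' hψlim)
    have h2 := tendsto_luxNorm_of_modular hp
      (tendsto_modular_of_dominated hp hpm hGm hψgm hH'i hψgle hGle' hψglim)
    simpa using h1.add h2

end Sobolev

end SubLaplace

namespace SubLaplace

variable {n N : ℕ} {M : Type*} [TopologicalSpace M] [ChartedSpace (EuclideanSpace ℝ (Fin n)) M]

/-! ### Rules for powers and square roots -/

section Rules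

variable {X : Fin N → VField n M} {a b : M → ℝ} {α β : EuclideanSpace ℝ (Fin N)} {x : M}

theorem HasHGradAt.rpow (ha : HasHGradAt X a α x) (hb : HasHGradAt X b β x) (h : 0 < a x) :
    HasHGradAt X (fun z => a z ^ b z)
      ((b x * a x ^ (b x - 1)) • α + (a x ^ b x * Real.log (a x)) • β) x := by
  have h1 := (Real.hasStrictFDerivAt_rpow_of_pos (a x, b x) h).hasFDerivAt
  simpa using ha.comp₂ hb h1

theorem HasHGradAt.add_const (ha : HasHGradAt X a α x) (c : ℝ) :
    HasHGradAt X (fun z => a z + c) α x := by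
  simpa using ha.comp ((hasDerivAt_id (a x)).add_const c)

theorem HasHGradAt.const_sub (ha : HasHGradAt X a α x) (c : ℝ) :
    HasHGradAt X (fun z => c - a z) (-α) x := by
  simpa using ha.comp ((hasDerivAt_id (a x)).const_sub c)

theorem HasHGradAt.sqrt_sq_add (ha : HasHGradAt X a α x) {δ : ℝ} (hδ : 0 < δ) :
    HasHGradAt X (fun z => √(a z ^ 2 + δ ^ 2)) ((a x / √(a x ^ 2 + δ ^ 2)) • α) x := by
  have h1 : HasDerivAt (fun t : ℝ => √(t ^ 2 + δ ^ 2)) _ (a x) :=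
    (((hasDerivAt_pow 2 (a x)).add_const (δ ^ 2)).sqrt (by positivity))
  convert ha.comp h1 using 2
  simp only [Nat.cast_ofNat]
  field_simp
  norm_num

theorem contMDiffAt_rpow (ha : ContMDiffAt (𝓡 n) 𝓘(ℝ, ℝ) 1 a x)
    (hb : ContMDiffAt (𝓡 n) 𝓘(ℝ, ℝ) 1 b x) (h : 0 < a x) :
    ContMDiffAt (𝓡 n) 𝓘(ℝ, ℝ) 1 (fun z => a z ^ b z) x := by
  have h1 : ContDiffAt ℝ 1 (fun q : ℝ × ℝ => q.1 ^ q.2) (a x, b x) :=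
    Real.contDiffAt_rpow_of_ne _ h.ne'
  exact h1.contMDiffAt.comp x (ha.prodMk_space hb)

theorem contMDiffAt_sqrt_sq_add {m : ℕ∞} (ha : ContMDiffAt (𝓡 n) 𝓘(ℝ, ℝ) m a x) {δ : ℝ}
    (hδ : 0 < δ) : ContMDiffAt (𝓡 n) 𝓘(ℝ, ℝ) m (fun z => √(a z ^ 2 + δ ^ 2)) x := by
  have h1 : ContDiffAt ℝ m (fun t : ℝ => √(t ^ 2 + δ ^ 2)) (a x) :=
    ((contDiffAt_id.pow 2).add contDiffAt_const).sqrt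
      (by simp only [id]; positivity)
  exact h1.contMDiffAt.comp x ha

end Rules

section SqrtBounds

theorem abs_le_sqrt_sq_add (a δ : ℝ) : |a| ≤ √(a ^ 2 + δ ^ 2) :=
  Real.abs_le_sqrt (by linarith [sq_nonneg δ])

theorem le_sqrt_sq_add (a δ : ℝ) : δ ≤ √(a ^ 2 + δ ^ 2) :=
  Real.le_sqrt_of_sq_le (by linarith [sq_nonneg a])

theorem sqrt_sq_add_le (a : ℝ) {δ : ℝ} (hδ : 0 ≤ δ) : √(a ^ 2 + δ ^ 2) ≤ |a| + δ := by
  rw [Real.sqrt_le_left (by positivity), add_sq, sq_abs]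
  have : 0 ≤ 2 * |a| * δ := by positivity
  linarith

theorem norm_div_sqrt_smul_le {F : Type*} [NormedAddCommGroup F] [NormedSpace ℝ F] (a δ : ℝ)
    (ξ : F) : ‖(a / √(a ^ 2 + δ ^ 2)) • ξ‖ ≤ ‖ξ‖ := by
  rw [norm_smul, Real.norm_eq_abs, abs_div, abs_of_nonneg (Real.sqrt_nonneg _)]
  exact mul_le_of_le_one_left (norm_nonneg _)
    (div_le_one_of_le₀ (abs_le_sqrt_sq_add a δ) (Real.sqrt_nonneg _))

end SqrtBounds

/-! ### Positive approximants of a positive element of W₀ -/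

section PositiveApproximants

variable [IsManifold (𝓡 n) ∞ M] [MeasurableSpace M]
  [BorelSpace M] {μ : Measure M} {X : Fin N → VField n M} {Ω : Set M} {p : M → ℝ} {P : ℝ}
  {v : M → ℝ} {Gv : M → EuclideanSpace ℝ (Fin N)}

/-- Replacing φ by √(φ²+δ²) gives positivity and does not increase the gradient. As v > 0, the
values tend to |v| = v and the gradient factor φ/√(φ²+δ²) tends to 1. Compact support is lost, but
these functions enter only multiplied by compactly supported ones or in local statements. -/
theorem MemW0.exists_pos_dominated [IsFiniteMeasure (μ.restrict Ω)] (hX : ∀ k, IsSmoothField (X k))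
    (hp : ∀ᵐ x ∂(μ.restrict Ω), 1 < p x ∧ p x ≤ P) (hpm : AEMeasurable p (μ.restrict Ω))
    (hv : MemW0 μ Ω p X v Gv) (hv0 : ∀ᵐ x ∂(μ.restrict Ω), 0 < v x) :
    ∃ (V : ℕ → M → ℝ) (H : M → ℝ), (∀ i, ContMDiff (𝓡 n) 𝓘(ℝ, ℝ) 1 (V i)) ∧
      (∀ i x, 0 < V i x) ∧ Integrable H (μ.restrict Ω) ∧
      (∀ i, ∀ᵐ x ∂(μ.restrict Ω), V i x ^ p x ≤ H x) ∧
      (∀ i, ∀ᵐ x ∂(μ.restrict Ω), ‖hGrad X (V i) x‖ ^ p x ≤ H x) ∧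
      (∀ᵐ x ∂(μ.restrict Ω), Tendsto (fun i => V i x) atTop (𝓝 (v x))) ∧
      ∀ᵐ x ∂(μ.restrict Ω), Tendsto (fun i => hGrad X (V i) x) atTop (𝓝 (Gv x)) := by
  obtain ⟨φ, H, hφ, hH, hle, hgle, hlim, hglim⟩ := hv.exists_dominated hX hp hpm
  set δ : ℕ → ℝ := fun i => 1 / ((i : ℝ) + 1) with hδ
  have hδ0 : ∀ i, 0 < δ i := fun i => by simp only [hδ]; positivity
  have hδ1 : ∀ i, δ i ≤ 1 := fun i => by
    simp only [hδ]
    rw [div_le_one (by positivity)]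
    linarith [(Nat.cast_nonneg i : (0 : ℝ) ≤ i)]
  have hδlim : Tendsto δ atTop (𝓝 0) := tendsto_one_div_add_atTop_nhds_zero_nat
  have hgrad : ∀ i x, hGrad X (fun z => √(φ i z ^ 2 + δ i ^ 2)) x
      = (φ i x / √(φ i x ^ 2 + δ i ^ 2)) • hGrad X (φ i) x := fun i x =>
    ((hasHGradAt_of_contMDiffAt (((hφ i).1 x).of_le (by simp))).sqrt_sq_add (hδ0 i)).2
  have hroot : ∀ᵐ x ∂(μ.restrict Ω),
      Tendsto (fun i => √(φ i x ^ 2 + δ i ^ 2)) atTop (𝓝 (v x)) := by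
    filter_upwards [hlim, hv0] with x hx hx0
    have h1 := ((hx.pow 2).add (hδlim.pow 2)).sqrt
    rwa [zero_pow two_ne_zero, add_zero, Real.sqrt_sq hx0.le] at h1
  refine ⟨fun i x => √(φ i x ^ 2 + δ i ^ 2), fun x => 2 ^ P * (H x + 1) + H x, fun i x => ?_,
    fun i x => ?_, ((hH.add (integrable_const 1)).const_mul _).add hH, fun i => ?_,
    fun i => ?_, hroot, ?_⟩
  · exact contMDiffAt_sqrt_sq_add (m := 1) (((hφ i).1 x).of_le (by simp)) (hδ0 i)
  · have := hδ0 i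
    positivity
  · filter_upwards [hle i, hp] with x hx hpx
    have hp0 : 0 ≤ p x := by linarith [hpx.1]
    have hH0 : 0 ≤ H x := (Real.rpow_nonneg (norm_nonneg _) _).trans hx
    calc √(φ i x ^ 2 + δ i ^ 2) ^ p x ≤ (|φ i x| + 1) ^ p x :=
          Real.rpow_le_rpow (Real.sqrt_nonneg _)
            ((sqrt_sq_add_le _ (hδ0 i).le).trans (by linarith [hδ1 i])) hp0
      _ ≤ 2 ^ P * (|φ i x| ^ p x + 1 ^ p x) :=
          add_rpow_le_two_rpow_mul (abs_nonneg _) zero_le_one hp0 hpx.2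
      _ ≤ 2 ^ P * (H x + 1) := by rw [Real.one_rpow]; gcongr; exact hx
      _ ≤ _ := by linarith
  · filter_upwards [hgle i, hp] with x hx hpx
    have hp0 : 0 ≤ p x := by linarith [hpx.1]
    have hH0 : 0 ≤ H x := (Real.rpow_nonneg (norm_nonneg _) _).trans hx
    rw [hgrad]
    have h1 := Real.rpow_le_rpow (norm_nonneg _)
      (norm_div_sqrt_smul_le (φ i x) (δ i) (hGrad X (φ i) x)) hp0
    have h2 : (0 : ℝ) ≤ 2 ^ P * (H x + 1) := by positivity
    linarith
  · filter_upwards [hlim, hglim, hroot, hv0] with x hx hgx hrx hx0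
    simp only [hgrad]
    have h1 := (hx.div hrx hx0.ne').smul hgx
    rwa [div_self hx0.ne', one_smul] at h1

end PositiveApproximants

/-! ### Admissibility of A (v + ε)^{1-p} -/

section Quotients

variable [T2Space M] [SecondCountableTopology M] [IsManifold (𝓡 n) ∞ M] [MeasurableSpace M]
  [BorelSpace M] {μ : Measure M} {X : Fin N → VField n M} {Ω : Set M} {p : M → ℝ} {P : ℝ}
  {v : M → ℝ} {Gv : M → EuclideanSpace ℝ (Fin N)}

/-- The gradient of `A (V + ε)^{1-p}` in terms of the value `s` and gradient `ξ` of `V`. -/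
noncomputable def quotientGrad (X : Fin N → VField n M) (p A : M → ℝ) (ε : ℝ) (x : M) (s : ℝ)
    (ξ : EuclideanSpace ℝ (Fin N)) : EuclideanSpace ℝ (Fin N) :=
  (s + ε) ^ (1 - p x) • hGrad X A x +
    A x • (((1 - p x) * (s + ε) ^ (-p x)) • ξ -
      ((s + ε) ^ (1 - p x) * Real.log (s + ε)) • hGrad X p x)

omit [T2Space M] [SecondCountableTopology M] [IsManifold (𝓡 n) ∞ M] [MeasurableSpace M]
  [BorelSpace M] in
theorem hasHGradAt_quotient {A V : M → ℝ} {x : M} {ε : ℝ}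
    (hA : ContMDiffAt (𝓡 n) 𝓘(ℝ, ℝ) 1 A x) (hV : ContMDiffAt (𝓡 n) 𝓘(ℝ, ℝ) 1 V x)
    (hp : ContMDiffAt (𝓡 n) 𝓘(ℝ, ℝ) 1 p x) (h : 0 < V x + ε) :
    HasHGradAt X (fun z => A z * (V z + ε) ^ (1 - p z))
      (quotientGrad X p A ε x (V x) (hGrad X V x)) x := by
  have h1 := (hasHGradAt_of_contMDiffAt (X := X) hA).mul
    (((hasHGradAt_of_contMDiffAt (X := X) hV).add_const ε).rpow
      ((hasHGradAt_of_contMDiffAt (X := X) hp).const_sub 1) h)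
  convert h1 using 1
  rw [quotientGrad, smul_neg, ← sub_eq_add_neg, show 1 - p x - 1 = -p x by ring]

/-- The bound log t ≤ t - 1, applied to t and to 1/t. It shows that the logarithm in `quotientGrad`
grows at most linearly. -/
theorem abs_log_le_add_inv {t ε : ℝ} (hε : 0 < ε) (ht : ε ≤ t) : |Real.log t| ≤ t + 1 / ε := by
  have ht0 : 0 < t := hε.trans_le ht
  rw [abs_le]
  constructor
  · have h1 := Real.log_le_sub_one_of_pos (inv_pos.2 ht0)
    rw [Real.log_inv] at h1
    have h2 : t⁻¹ ≤ 1 / ε := by rw [one_div]; exact inv_anti₀ hε ht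
    linarith
  · have h1 := Real.log_le_sub_one_of_pos ht0
    have h2 : 0 < 1 / ε := by positivity
    linarith

/-- For `A ∈ C¹_c(Ω)` and `0 < v ∈ W₀`, the function `A (v + ε)^{1-p}` belongs to `W₀`. -/
theorem memW0_quotient [IsFiniteMeasure (μ.restrict Ω)] (hμ : IsSmoothVolume n μ)
    (hX : ∀ k, IsSmoothField (X k)) (hΩ : IsOpen Ω)
    (hp : ∀ x ∈ Ω, 1 < p x ∧ p x ≤ P) (hpd : ContMDiffOn (𝓡 n) 𝓘(ℝ, ℝ) 1 p Ω)
    (hv : MemW0 μ Ω p X v Gv) (hv0 : ∀ᵐ x ∂(μ.restrict Ω), 0 < v x)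
    {A : M → ℝ} (hA : ContMDiff (𝓡 n) 𝓘(ℝ, ℝ) 1 A) (hAc : HasCompactSupport A)
    (hAs : tsupport A ⊆ Ω) {ε : ℝ} (hε0 : 0 < ε) (hε1 : ε ≤ 1) :
    MemW0 μ Ω p X (fun x => A x * (v x + ε) ^ (1 - p x))
      (fun x => quotientGrad X p A ε x (v x) (Gv x)) := by
  have hpae : ∀ᵐ x ∂(μ.restrict Ω), 1 < p x ∧ p x ≤ P :=
    (ae_restrict_mem hΩ.measurableSet).mono fun x hx => hp x hx
  have hpm : AEMeasurable p (μ.restrict Ω) := hpd.continuousOn.aemeasurable hΩ.measurableSet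
  have hpat : ∀ x ∈ Ω, ContMDiffAt (𝓡 n) 𝓘(ℝ, ℝ) 1 p x := fun x hx =>
    (hpd x hx).contMDiffAt (hΩ.mem_nhds hx)
  obtain ⟨V, H, hV, hVpos, hH, hle, hgle, hlim, hglim⟩ :=
    hv.exists_pos_dominated hX hpae hpm hv0
  obtain ⟨C₁, hC₁⟩ := hAc.exists_bound_of_continuousOn (f := A) hA.continuous.continuousOn
  obtain ⟨C₂, hC₂⟩ := hAc.exists_bound_of_continuousOn (f := hGrad X A)
    (continuous_hGrad hX hA).continuousOn
  obtain ⟨C₃, hC₃⟩ := hAc.exists_bound_of_continuousOn (f := hGrad X p)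
    (fun x hx => (continuousAt_hGrad hX (hpat x (hAs hx))).continuousWithinAt)
  -- As ε ≤ 1, this bounds (s+ε)^q for every s ≥ 0 and every exponent q between -P and 0.
  set T := ε ^ (-P) with hT
  have hT0 : 0 < T := Real.rpow_pos_of_pos hε0 _
  have hP : ∀ x ∈ Ω, 1 ≤ P := fun x hx => ((hp x hx).1.le.trans (hp x hx).2)
  have hexp : ∀ x ∈ Ω, ∀ s : ℝ, 0 ≤ s →
      (s + ε) ^ (1 - p x) ≤ T ∧ (s + ε) ^ (-p x) ≤ T := by
    intro x hx s hs
    have h1 : ∀ q : ℝ, -P ≤ q → q ≤ 0 → (s + ε) ^ q ≤ T := fun q hq hq0 =>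
      (Real.rpow_le_rpow_of_nonpos hε0 (by linarith) hq0).trans
        (Real.rpow_le_rpow_of_exponent_ge hε0 hε1 hq)
    have := hp x hx
    exact ⟨h1 _ (by linarith) (by linarith), h1 _ (by linarith) (by linarith)⟩
  set C := 1 + T * |C₂| + |C₁| * T + |C₁| * (P * T) + |C₁| * (T * |C₃|) * (2 + 1 / ε) with hC
  -- For fixed ε both the function and its gradient grow at most linearly in s and |ξ|, uniformly in
  -- x. Off the support of A both are zero.
  have hbound : ∀ x ∈ Ω, ∀ (s : ℝ) (ξ : EuclideanSpace ℝ (Fin N)), 0 ≤ s →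
      |A x * (s + ε) ^ (1 - p x)| ≤ C * (1 + (s + ‖ξ‖)) ∧
      ‖quotientGrad X p A ε x s ξ‖ ≤ C * (1 + (s + ‖ξ‖)) ∧ 1 ≤ C := by
    intro x hx s ξ hs
    have hP1 := hP x hx
    have hC1 : 1 ≤ C := by
      have : 0 ≤ T * |C₂| + |C₁| * T + |C₁| * (P * T) + |C₁| * (T * |C₃|) * (2 + 1 / ε) := by
        positivity
      linarith
    by_cases hxA : x ∈ tsupport A
    · obtain ⟨he1, he2⟩ := hexp x hx s hs
      have hs0 : 0 < s + ε := by linarith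
      have ha : |A x| ≤ |C₁| := (hC₁ x hxA).trans (le_abs_self _)
      have hb : ‖hGrad X A x‖ ≤ |C₂| := (hC₂ x hxA).trans (le_abs_self _)
      have hc : ‖hGrad X p x‖ ≤ |C₃| := (hC₃ x hxA).trans (le_abs_self _)
      have hl := abs_log_le_add_inv hε0 (show ε ≤ s + ε by linarith)
      have hpx := hp x hx
      have hq : |1 - p x| ≤ P := by rw [abs_le]; constructor <;> linarith
      have hn1 : 0 ≤ (s + ε) ^ (1 - p x) := by positivity
      have hn2 : 0 ≤ (s + ε) ^ (-p x) := by positivity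
      have hξ := norm_nonneg ξ
      refine ⟨?_, ?_, hC1⟩
      · rw [abs_mul, abs_of_nonneg hn1]
        calc |A x| * (s + ε) ^ (1 - p x) ≤ |C₁| * T := by gcongr
          _ ≤ C * 1 := by
            have : 0 ≤ 1 + T * |C₂| + |C₁| * (P * T) + |C₁| * (T * |C₃|) * (2 + 1 / ε) := by
              positivity
            linarith
          _ ≤ C * (1 + (s + ‖ξ‖)) := by gcongr; linarith
      · calc ‖quotientGrad X p A ε x s ξ‖
            ≤ ‖(s + ε) ^ (1 - p x) • hGrad X A x‖ +
              ‖A x • (((1 - p x) * (s + ε) ^ (-p x)) • ξ -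
                ((s + ε) ^ (1 - p x) * Real.log (s + ε)) • hGrad X p x)‖ := norm_add_le _ _
          _ ≤ T * |C₂| + |C₁| * (P * T * ‖ξ‖ + T * (s + ε + 1 / ε) * |C₃|) := by
            gcongr ?_ + ?_
            · rw [norm_smul, Real.norm_eq_abs, abs_of_nonneg hn1]
              gcongr
            · rw [norm_smul, Real.norm_eq_abs]
              gcongr
              refine (norm_sub_le _ _).trans ?_
              gcongr ?_ + ?_
              · rw [norm_smul, Real.norm_eq_abs, abs_mul, abs_of_nonneg hn2]
                gcongr
              · rw [norm_smul, Real.norm_eq_abs, abs_mul, abs_of_nonneg hn1]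
                gcongr
          _ ≤ C * (1 + (s + ‖ξ‖)) := by
            have e1 : T * (s + ε + 1 / ε) * |C₃| ≤ T * |C₃| * ((2 + 1 / ε) * (1 + (s + ‖ξ‖))) := by
              have : s + ε + 1 / ε ≤ (2 + 1 / ε) * (1 + (s + ‖ξ‖)) := by
                have h0 : 0 ≤ 1 / ε := by positivity
                have h2 : 0 ≤ 1 / ε * (s + ‖ξ‖) := by positivity
                nlinarith
              calc T * (s + ε + 1 / ε) * |C₃| = T * |C₃| * (s + ε + 1 / ε) := by ring
                _ ≤ _ := by gcongr
            have e2 : T * |C₂| ≤ T * |C₂| * (1 + (s + ‖ξ‖)) :=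
              le_mul_of_one_le_right (by positivity) (by linarith)
            have e3 : P * T * ‖ξ‖ ≤ P * T * (1 + (s + ‖ξ‖)) := by gcongr; linarith
            have e4 : 0 ≤ (1 + |C₁| * T) * (1 + (s + ‖ξ‖)) := by positivity
            calc T * |C₂| + |C₁| * (P * T * ‖ξ‖ + T * (s + ε + 1 / ε) * |C₃|)
                ≤ T * |C₂| * (1 + (s + ‖ξ‖)) + |C₁| * (P * T * (1 + (s + ‖ξ‖)) +
                  T * |C₃| * ((2 + 1 / ε) * (1 + (s + ‖ξ‖)))) := by gcongr
              _ ≤ C * (1 + (s + ‖ξ‖)) := by rw [hC]; nlinarith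
    · have h0 : A x = 0 := image_eq_zero_of_notMem_tsupport hxA
      have h1 : hGrad X A x = 0 := hGrad_eq_zero_of_notMem_tsupport hxA
      have h2 : 0 ≤ C * (1 + (s + ‖ξ‖)) := by positivity
      simp only [quotientGrad, h0, h1, smul_zero, zero_smul, add_zero, norm_zero, zero_mul,
        abs_zero]
      exact ⟨h2, h2, hC1⟩
  set w : ℕ → M → ℝ := fun i z => A z * (V i z + ε) ^ (1 - p z) with hw
  have hwt : ∀ i, tsupport (w i) ⊆ tsupport A := fun i =>
    closure_mono fun z hz => left_ne_zero_of_mul hz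
  have hVε : ∀ i x, 0 < V i x + ε := fun i x => by linarith [hVpos i x]
  have hwd : ∀ i, ContMDiff (𝓡 n) 𝓘(ℝ, ℝ) 1 (w i) := fun i => by
    refine contMDiff_of_tsupport fun x hx => ?_
    exact (hA x).mul (contMDiffAt_rpow ((hV i x).add contMDiffAt_const)
      (contMDiffAt_const.sub (hpat x (hAs (hwt i hx)))) (hVε i x))
  have hwg : ∀ i, ∀ x ∈ Ω, hGrad X (w i) x = quotientGrad X p A ε x (V i x) (hGrad X (V i) x) :=
    fun i x hx => (hasHGradAt_quotient (hA x) (hV i x) (hpat x hx) (hVε i x)).2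
  -- Linear growth converts the majorant of the p-th powers for V and its gradient into one for the
  -- quotients.
  have hpow : ∀ x ∈ Ω, ∀ (r s : ℝ) (ξ : EuclideanSpace ℝ (Fin N)), 0 ≤ r → 0 ≤ s → 1 ≤ C →
      r ≤ C * (1 + (s + ‖ξ‖)) → s ^ p x ≤ H x → ‖ξ‖ ^ p x ≤ H x →
      r ^ p x ≤ C ^ P * (2 ^ P * (1 + 2 ^ P * (H x + H x))) := by
    intro x hx r s ξ hr hs hC1 hrle h1 h2
    have hpx := hp x hx
    have hp0 : 0 ≤ p x := by linarith
    calc r ^ p x ≤ (C * (1 + (s + ‖ξ‖))) ^ p x := Real.rpow_le_rpow hr hrle hp0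
      _ = C ^ p x * (1 + (s + ‖ξ‖)) ^ p x := Real.mul_rpow (by linarith) (by positivity)
      _ ≤ C ^ P * (2 ^ P * (1 ^ p x + (s + ‖ξ‖) ^ p x)) := by
        gcongr
        · exact hpx.2
        · exact add_rpow_le_two_rpow_mul zero_le_one (by positivity) hp0 hpx.2
      _ ≤ C ^ P * (2 ^ P * (1 + 2 ^ P * (s ^ p x + ‖ξ‖ ^ p x))) := by
        rw [Real.one_rpow]
        gcongr
        exact add_rpow_le_two_rpow_mul hs (norm_nonneg _) hp0 hpx.2
      _ ≤ _ := by gcongr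
  refine memW0_of_dominated hμ hX hΩ hpae hpm (φ := w)
    (H := fun x => C ^ P * (2 ^ P * (1 + 2 ^ P * (H x + H x)))) hwd
    (fun i => hAc.of_isClosed_subset (isClosed_tsupport _) (hwt i))
    (fun i => (hwt i).trans hAs) ?_ (fun i => ?_) (fun i => ?_) ?_ ?_
  · exact (((integrable_const 1).add ((hH.add hH).const_mul _)).const_mul _).const_mul _
  · filter_upwards [hle i, hgle i, ae_restrict_mem hΩ.measurableSet] with x h1 h2 hx
    have h3 := hbound x hx (V i x) (hGrad X (V i) x) (hVpos i x).le
    exact hpow x hx _ _ (hGrad X (V i) x) (norm_nonneg _) (hVpos i x).le h3.2.2 h3.1 h1 h2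
  · filter_upwards [hle i, hgle i, ae_restrict_mem hΩ.measurableSet] with x h1 h2 hx
    have h3 := hbound x hx (V i x) (hGrad X (V i) x) (hVpos i x).le
    rw [hwg i x hx]
    exact hpow x hx _ _ (hGrad X (V i) x) (norm_nonneg _) (hVpos i x).le h3.2.2 h3.2.1 h1 h2
  · filter_upwards [hlim, hv0] with x hx hx0
    have h1 : v x + ε ≠ 0 := by positivity
    exact ((hx.add_const ε).rpow_const (Or.inl h1)).const_mul _
  · filter_upwards [hlim, hglim, hv0, ae_restrict_mem hΩ.measurableSet] with x hx hgx hx0 hxΩ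
    have h1 : v x + ε ≠ 0 := by positivity
    have h2 := hx.add_const ε
    simp only [hwg _ x hxΩ, quotientGrad]
    exact ((h2.rpow_const (Or.inl h1)).smul_const _).add
      (((((h2.rpow_const (Or.inl h1)).const_mul _).smul hgx).sub
        (((h2.rpow_const (Or.inl h1)).mul (h2.log h1)).smul_const _)).const_smul _)

end Quotients

end SubLaplace

namespace SubLaplace

/-! ### The pointwise Picone inequality and its equality case -/

section PointwisePicone

/-- Young's inequality `p a^{p-1} b ≤ (p-1) a^p + b^p`. -/
theorem young_rpow {p a b : ℝ} (hp : 1 < p) (ha : 0 ≤ a) (hb : 0 ≤ b) :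
    p * a ^ (p - 1) * b ≤ (p - 1) * a ^ p + b ^ p := by
  rcases ha.eq_or_lt with rfl | ha
  · rw [Real.zero_rpow (by linarith), Real.zero_rpow (by linarith)]
    simpa using Real.rpow_nonneg hb p
  -- Young's inequality is Bernoulli's inequality for (b/a)^p, multiplied by a^p.
  · have h1 := one_add_mul_self_le_rpow_one_add (s := b / a - 1)
      (by have : 0 ≤ b / a := by positivity
          linarith) hp.le
    rw [add_sub_cancel, Real.div_rpow hb ha.le, le_div_iff₀ (by positivity)] at h1
    have h2 : a ^ p = a ^ (p - 1) * a := by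
      rw [← Real.rpow_add_one ha.ne']; congr 1; ring
    calc p * a ^ (p - 1) * b = (1 + p * (b / a - 1)) * a ^ p + (p - 1) * a ^ p := by
          rw [h2]; field_simp; ring
      _ ≤ _ := by linarith

/-- Bernoulli's inequality is strict unless b/a = 1. -/
theorem eq_of_young_rpow_eq {p a b : ℝ} (hp : 1 < p) (ha : 0 ≤ a) (hb : 0 ≤ b)
    (h : (p - 1) * a ^ p + b ^ p ≤ p * a ^ (p - 1) * b) : a = b := by
  rcases ha.eq_or_lt with rfl | ha
  · rw [Real.zero_rpow (by linarith), Real.zero_rpow (by linarith)] at h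
    have h1 : b ^ p = 0 := le_antisymm (by simpa using h) (Real.rpow_nonneg hb p)
    exact ((Real.rpow_eq_zero hb (by linarith)).1 h1).symm
  · by_contra hne
    have h0 : b / a - 1 ≠ 0 := by
      intro h0
      rw [sub_eq_zero, div_eq_one_iff_eq ha.ne'] at h0
      exact hne h0.symm
    have h1 := one_add_mul_self_lt_rpow_one_add (s := b / a - 1)
      (by have : 0 ≤ b / a := by positivity
          linarith) h0 hp
    rw [add_sub_cancel, Real.div_rpow hb ha.le, lt_div_iff₀ (by positivity)] at h1
    have h2 : a ^ p = a ^ (p - 1) * a := by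
      rw [← Real.rpow_add_one ha.ne']; congr 1; ring
    have h3 : p * a ^ (p - 1) * b = (1 + p * (b / a - 1)) * a ^ p + (p - 1) * a ^ p := by
      rw [h2]; field_simp; ring
    linarith

/-- A cruder form of Young's inequality without the factor p; it makes the flux pairing integrable.
-/
theorem rpow_sub_one_mul_le_add {p a b : ℝ} (hp : 1 < p) (ha : 0 ≤ a) (hb : 0 ≤ b) :
    a ^ (p - 1) * b ≤ a ^ p + b ^ p := by
  have h1 := young_rpow hp ha hb
  have h2 : 0 ≤ a ^ (p - 1) * b := by positivity
  have h3 : 0 ≤ a ^ p := by positivity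
  have h4 : 0 ≤ b ^ p := by positivity
  have h5 : p * (a ^ (p - 1) * b) ≤ p * (a ^ p + b ^ p) := by nlinarith
  exact le_of_mul_le_mul_left h5 (by linarith)

variable {F : Type*} [NormedAddCommGroup F] [InnerProductSpace ℝ F]

theorem norm_rpow_sub_two_mul_inner_self {p : ℝ} (hp : 1 < p) (ξ : F) :
    ‖ξ‖ ^ (p - 2) * inner ℝ ξ ξ = ‖ξ‖ ^ p := by
  rw [real_inner_self_eq_norm_sq]
  rcases (norm_nonneg ξ).eq_or_lt with h | h
  · rw [← h, Real.zero_rpow (by linarith : p ≠ 0)]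
    simp
  · rw [← Real.rpow_natCast ‖ξ‖ 2, ← Real.rpow_add h]
    congr 1
    push_cast
    ring

theorem abs_norm_rpow_sub_two_mul_inner_le (p : ℝ) (ξ η : F) :
    |‖ξ‖ ^ (p - 2) * inner ℝ ξ η| ≤ ‖ξ‖ ^ (p - 1) * ‖η‖ := by
  rcases (norm_nonneg ξ).eq_or_lt with h | h
  -- Both sides are settled by the other factors here: the value of 0^(p-2) plays no role because
  -- the inner product is 0.
  · have h0 : ξ = 0 := norm_eq_zero.1 h.symm
    rw [h0, inner_zero_left, mul_zero, abs_zero]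
    positivity
  · have h2 : ‖ξ‖ ^ (p - 1) = ‖ξ‖ ^ (p - 2) * ‖ξ‖ := by
      rw [← Real.rpow_add_one h.ne']; congr 1; ring
    rw [abs_mul, abs_of_nonneg (by positivity), h2, mul_assoc]
    gcongr
    exact abs_real_inner_le_norm ξ η

/-- The Picone function
`|η|^p - p c s^{1-p} |ξ|^{p-2} ⟨ξ, η⟩ + (p-1) f^p s^{-p} |ξ|^p`. -/
noncomputable def picone (p c f s : ℝ) (ξ η : F) : ℝ :=
  ‖η‖ ^ p - p * c * s ^ (1 - p) * (‖ξ‖ ^ (p - 2) * inner ℝ ξ η) +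
    (p - 1) * f ^ p * s ^ (-p) * ‖ξ‖ ^ p

/-- Cauchy–Schwarz leaves the scalar Young expression with a = f|ξ|/s and b = |η|. Requiring only
|c| ≤ f^{p-1} covers both c = sign(u)|u|^{p-1}, f = |u| and the regularized pair f = √(φ²+δ²), c =
f^{p-1}·φ/f. -/
theorem picone_ge {p c f s : ℝ} (hp : 1 < p) (hf : 0 ≤ f) (hs : 0 < s) (hc : |c| ≤ f ^ (p - 1))
    (ξ η : F) :
    ‖η‖ ^ p - p * (f * ‖ξ‖ / s) ^ (p - 1) * ‖η‖ + (p - 1) * (f * ‖ξ‖ / s) ^ p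
      ≤ picone p c f s ξ η := by
  have h1 : (f * ‖ξ‖ / s) ^ p = f ^ p * s ^ (-p) * ‖ξ‖ ^ p := by
    rw [Real.div_rpow (by positivity) hs.le, Real.mul_rpow hf (norm_nonneg _), Real.rpow_neg hs.le]
    field_simp
  have h2 : (f * ‖ξ‖ / s) ^ (p - 1) = f ^ (p - 1) * s ^ (1 - p) * ‖ξ‖ ^ (p - 1) := by
    rw [Real.div_rpow (by positivity) hs.le, Real.mul_rpow hf (norm_nonneg _),
      show 1 - p = -(p - 1) by ring, Real.rpow_neg hs.le]
    field_simp
  have h3 : p * c * s ^ (1 - p) * (‖ξ‖ ^ (p - 2) * inner ℝ ξ η)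
      ≤ p * (f ^ (p - 1) * s ^ (1 - p) * ‖ξ‖ ^ (p - 1)) * ‖η‖ := by
    have hsp : 0 ≤ s ^ (1 - p) := by positivity
    calc p * c * s ^ (1 - p) * (‖ξ‖ ^ (p - 2) * inner ℝ ξ η)
        = (p * s ^ (1 - p)) * (c * (‖ξ‖ ^ (p - 2) * inner ℝ ξ η)) := by ring
      _ ≤ (p * s ^ (1 - p)) * (f ^ (p - 1) * (‖ξ‖ ^ (p - 1) * ‖η‖)) := by
          refine mul_le_mul_of_nonneg_left ((le_abs_self _).trans ?_) (by positivity)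
          rw [abs_mul]
          gcongr
          exact abs_norm_rpow_sub_two_mul_inner_le p ξ η
      _ = _ := by ring
  rw [picone, h1, h2]
  have h4 : (p - 1) * (f ^ p * s ^ (-p) * ‖ξ‖ ^ p) = (p - 1) * f ^ p * s ^ (-p) * ‖ξ‖ ^ p := by
    ring
  linarith

theorem picone_nonneg {p c f s : ℝ} (hp : 1 < p) (hf : 0 ≤ f) (hs : 0 < s)
    (hc : |c| ≤ f ^ (p - 1)) (ξ η : F) : 0 ≤ picone p c f s ξ η := by
  have h1 := picone_ge hp hf hs hc ξ η
  have h2 := young_rpow hp (show 0 ≤ f * ‖ξ‖ / s by positivity) (norm_nonneg η)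
  linarith

/-- The Picone function controls `(f |ξ| / s)^p` up to a multiple of `|η|^p`. -/
theorem rpow_le_picone {p c f s : ℝ} (hp : 1 < p) (hf : 0 ≤ f) (hs : 0 < s)
    (hc : |c| ≤ f ^ (p - 1)) (ξ η : F) :
    (p - 1) / 2 * (f * ‖ξ‖ / s) ^ p ≤ picone p c f s ξ η + (2 ^ (p - 1) * ‖η‖) ^ p := by
  have h1 := picone_ge hp hf hs hc ξ η
  set a := f * ‖ξ‖ / s
  have ha : 0 ≤ a := by positivity
  -- Rescaling to a/2 and 2^{p-1}b leaves the mixed term unchanged but, as 2^p ≥ 2, at least halves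
  -- the term (p-1)a^p, so half of it survives.
  have h2 := young_rpow hp (show 0 ≤ a / 2 by positivity)
    (show 0 ≤ 2 ^ (p - 1) * ‖η‖ by positivity)
  have h3 : p * (a / 2) ^ (p - 1) * (2 ^ (p - 1) * ‖η‖) = p * a ^ (p - 1) * ‖η‖ := by
    rw [Real.div_rpow ha (by norm_num)]
    field_simp
  have h4 : (a / 2) ^ p ≤ a ^ p / 2 := by
    rw [Real.div_rpow ha (by norm_num)]
    gcongr
    exact Real.self_le_rpow_of_one_le (by norm_num) hp.le
  have h5 : (p - 1) * (a / 2) ^ p ≤ (p - 1) * (a ^ p / 2) := by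
    gcongr
  have h6 : 0 ≤ ‖η‖ ^ p := by positivity
  rw [h3] at h2
  nlinarith

/-- The sign of u is written u/|u|, which is 0 at u = 0; hence an inequality. This form is the limit
of the regularized coefficient. -/
theorem abs_rpow_mul_div_abs_le (u q : ℝ) : |(|u| ^ q * (u / |u|))| ≤ |u| ^ q := by
  rw [abs_mul, abs_of_nonneg (by positivity), abs_div, abs_abs]
  exact mul_le_of_le_one_right (by positivity) (div_self_le_one _)

/-- The equality case of Picone's inequality. -/
theorem eq_smul_of_picone_eq_zero {p u s : ℝ} (hp : 1 < p) (hs : 0 < s) {ξ η : F}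
    (h : picone p (|u| ^ (p - 1) * (u / |u|)) |u| s ξ η = 0) : η = (u / s) • ξ := by
  have h1 := picone_ge hp (abs_nonneg u) hs (abs_rpow_mul_div_abs_le u (p - 1)) ξ η
  rw [h] at h1
  -- Equality in Young fixes the length of η; equality in Cauchy–Schwarz will then fix its
  -- direction.
  have h2 : |u| * ‖ξ‖ / s = ‖η‖ :=
    eq_of_young_rpow_eq hp (by positivity) (norm_nonneg η) (by linarith)
  by_cases hη : η = 0
  · rw [hη, norm_zero, div_eq_zero_iff, mul_eq_zero, abs_eq_zero, norm_eq_zero] at h2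
    rcases h2 with (h2 | h2) | h2
    · simp [hη, h2]
    · simp [hη, h2]
    · exact absurd h2 hs.ne'
  · have hη0 : 0 < ‖η‖ := norm_pos_iff.2 hη
    have hu : u ≠ 0 := by
      rintro rfl
      simp only [abs_zero, zero_mul, zero_div] at h2
      exact hη0.ne h2
    have hξ : ξ ≠ 0 := by
      rintro rfl
      simp only [norm_zero, mul_zero, zero_div] at h2
      exact hη0.ne h2
    have hu0 : 0 < |u| := abs_pos.2 hu
    have hξ0 : 0 < ‖ξ‖ := norm_pos_iff.2 hξ
    have e1 : |u| ^ p * s ^ (-p) * ‖ξ‖ ^ p = ‖η‖ ^ p := by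
      rw [← h2, Real.div_rpow (by positivity) hs.le, Real.mul_rpow (abs_nonneg _) (norm_nonneg _),
        Real.rpow_neg hs.le]
      field_simp
    have e2 : |u| ^ (p - 1) * s ^ (1 - p) * ‖ξ‖ ^ (p - 2) * ‖ξ‖ = ‖η‖ ^ (p - 1) := by
      rw [← h2, Real.div_rpow (by positivity) hs.le, Real.mul_rpow (abs_nonneg _) (norm_nonneg _),
        show 1 - p = -(p - 1) by ring, Real.rpow_neg hs.le, mul_assoc (_ * _),
        ← Real.rpow_add_one hξ0.ne', show p - 2 + 1 = p - 1 by ring]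
      field_simp
    have e3 : ‖η‖ ^ (p - 1) * ‖η‖ = ‖η‖ ^ p := by
      rw [← Real.rpow_add_one hη0.ne']; congr 1; ring
    have e4 : p * ‖η‖ ^ p = p * (‖η‖ ^ (p - 1) / ‖ξ‖ * (u / |u|) * inner ℝ ξ η) := by
      have : p * (|u| ^ (p - 1) * (u / |u|)) * s ^ (1 - p) * (‖ξ‖ ^ (p - 2) * inner ℝ ξ η)
          = p * (‖η‖ ^ (p - 1) / ‖ξ‖ * (u / |u|) * inner ℝ ξ η) := by
        rw [← e2]; field_simp
      rw [← this]
      have h3 := h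
      rw [picone] at h3
      have h4 : (p - 1) * |u| ^ p * s ^ (-p) * ‖ξ‖ ^ p = (p - 1) * ‖η‖ ^ p := by
        rw [← e1]; ring
      linarith
    have e5 : ‖η‖ * ‖ξ‖ = (u / |u|) * inner ℝ ξ η := by
      have h3 := mul_left_cancel₀ (by linarith : p ≠ 0) e4
      rw [← e3] at h3
      have h4 : (0 : ℝ) < ‖η‖ ^ (p - 1) := by positivity
      have h5 : ‖η‖ ^ (p - 1) * ‖η‖ = ‖η‖ ^ (p - 1) * (((u / |u|) * inner ℝ ξ η) / ‖ξ‖) := by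
        rw [h3]; ring
      have h6 := mul_left_cancel₀ h4.ne' h5
      rw [h6]; field_simp
    have hσ : |(u / |u|)| = 1 := by rw [abs_div, abs_abs, div_self hu0.ne']
    -- Equality in Cauchy–Schwarz for ξ turned by the sign of u, so η is a nonnegative multiple of
    -- that vector.
    have e6 : inner ℝ ((u / |u|) • ξ) η = ‖(u / |u|) • ξ‖ * ‖η‖ := by
      rw [real_inner_smul_left, ← e5, norm_smul, Real.norm_eq_abs, hσ, one_mul, mul_comm]
    have e7 := inner_eq_norm_mul_iff_real.1 e6
    rw [norm_smul, Real.norm_eq_abs, hσ, one_mul, ← h2, smul_smul] at e7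
    have e8 : η = ‖ξ‖⁻¹ • (‖ξ‖ • η) := by rw [smul_smul, inv_mul_cancel₀ hξ0.ne', one_smul]
    rw [e8, ← e7, smul_smul]
    congr 1
    field_simp

end PointwisePicone

end SubLaplace

namespace SubLaplace

variable {n N : ℕ} {M : Type*} [TopologicalSpace M] [ChartedSpace (EuclideanSpace ℝ (Fin n)) M]

/-! ### Integrability of the flux and the standing assumptions -/

section Integrability

variable [MeasurableSpace M] {μ : Measure M} {Ω : Set M} {p : M → ℝ} {P : ℝ}
  {F : Type*} [NormedAddCommGroup F] [InnerProductSpace ℝ F] [MeasurableSpace F] [BorelSpace F]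
  [SecondCountableTopology F]

omit [TopologicalSpace M] in
theorem MemLpVar.integrable_flux (hp : ∀ᵐ x ∂(μ.restrict Ω), 1 < p x ∧ p x ≤ P)
    (hpm : AEMeasurable p (μ.restrict Ω)) {G H : M → F} (hG : MemLpVar μ Ω p G)
    (hH : MemLpVar μ Ω p H) :
    Integrable (fun x => ‖G x‖ ^ (p x - 2) * inner ℝ (G x) (H x)) (μ.restrict Ω) := by
  refine ((hG.integrable_rpow hpm).add (hH.integrable_rpow hpm)).mono'
    (((hG.1.norm.pow (hpm.sub_const 2)).mul (hG.1.inner hH.1)).aestronglyMeasurable) ?_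
  filter_upwards [hp] with x hx
  exact (abs_norm_rpow_sub_two_mul_inner_le _ _ _).trans
    (rpow_sub_one_mul_le_add hx.1 (norm_nonneg _) (norm_nonneg _))

end Integrability

/-- The standing assumptions: a positive solution `v` for `lam` with `∇_X p · ∇_X v = 0`. -/
structure IsPositiveSolution [MeasurableSpace M] [IsManifold (𝓡 n) ∞ M] (μ : Measure M)
    (Ω : Set M) (p g : M → ℝ) (X : Fin N → VField n M) (P C lam : ℝ) (v : M → ℝ)
    (Gv : M → EuclideanSpace ℝ (Fin N)) : Prop where
  volume : IsSmoothVolume n μ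
  smooth : ∀ k, IsSmoothField (X k)
  isOpen : IsOpen Ω
  finite : IsFiniteMeasure (μ.restrict Ω)
  exponent : ∀ x ∈ Ω, 1 < p x ∧ p x ≤ P
  exponent_C1 : ContMDiffOn (𝓡 n) 𝓘(ℝ, ℝ) 1 p Ω
  weight_meas : AEMeasurable g (μ.restrict Ω)
  weight : ∀ x ∈ Ω, 0 < g x ∧ g x ≤ C
  solution : IsWeakSolution μ Ω p g X lam v Gv
  pos : ∀ᵐ x ∂(μ.restrict Ω), 0 < v x
  orth : ∀ᵐ x ∂(μ.restrict Ω), inner ℝ (hGrad X p x) (Gv x) = 0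

/-! ### The regularized test function -/

section PiconeTest

variable {X : Fin N → VField n M} {φ p : M → ℝ} {δ : ℝ} {x : M}

theorem hasHGradAt_const (X : Fin N → VField n M) (c : ℝ) (x : M) :
    HasHGradAt X (fun _ => c) 0 x := by
  refine ⟨mdifferentiableAt_const, ?_⟩
  ext k
  simp only [hGrad, mfderiv_const]
  rfl

/-- A regularization of `|φ|^p` that keeps the support of `φ`. -/
noncomputable def regPow (φ p : M → ℝ) (δ : ℝ) (x : M) : ℝ :=
  √(φ x ^ 2 + δ ^ 2) ^ p x - δ ^ p x

/-- The coefficient of ∇_X p, which contains the logarithms, is left unnamed: it is later paired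
with ∇_X v and disappears by orthogonality. -/
theorem hGrad_regPow (hδ : 0 < δ) (hφ : ContMDiffAt (𝓡 n) 𝓘(ℝ, ℝ) 1 φ x)
    (hp : ContMDiffAt (𝓡 n) 𝓘(ℝ, ℝ) 1 p x) :
    ∃ κ : ℝ, hGrad X (regPow φ p δ) x =
      (p x * (√(φ x ^ 2 + δ ^ 2) ^ (p x - 1) * (φ x / √(φ x ^ 2 + δ ^ 2)))) • hGrad X φ x
        + κ • hGrad X p x := by
  have hpg := hasHGradAt_of_contMDiffAt (X := X) hp
  have h1 := (((hasHGradAt_of_contMDiffAt (X := X) hφ).sqrt_sq_add hδ).rpow hpg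
    (by positivity)).sub ((hasHGradAt_const X δ x).rpow hpg hδ)
  refine ⟨√(φ x ^ 2 + δ ^ 2) ^ p x * Real.log (√(φ x ^ 2 + δ ^ 2)) - δ ^ p x * Real.log δ, ?_⟩
  have h2 : hGrad X (regPow φ p δ) x = _ := h1.2
  rw [h2, smul_zero, zero_add, smul_smul, sub_smul, ← mul_assoc, add_sub_assoc]

theorem contMDiffAt_regPow (hδ : 0 < δ) (hφ : ContMDiffAt (𝓡 n) 𝓘(ℝ, ℝ) 1 φ x)
    (hp : ContMDiffAt (𝓡 n) 𝓘(ℝ, ℝ) 1 p x) :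
    ContMDiffAt (𝓡 n) 𝓘(ℝ, ℝ) 1 (regPow φ p δ) x :=
  (contMDiffAt_rpow (contMDiffAt_sqrt_sq_add (m := 1) hφ hδ) hp (by positivity)).sub
    (contMDiffAt_rpow contMDiffAt_const hp hδ)

omit [ChartedSpace (EuclideanSpace ℝ (Fin n)) M] in
-- Subtracting δ^p makes the function vanish wherever φ does.
theorem tsupport_regPow_subset (hδ : 0 ≤ δ) : tsupport (regPow φ p δ) ⊆ tsupport φ := by
  refine closure_mono fun z hz => ?_
  intro h0
  apply hz
  simp [regPow, h0, Real.sqrt_sq hδ]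

omit [TopologicalSpace M] in
theorem regPow_bounds {P : ℝ} (hp : 1 < p x ∧ p x ≤ P) (hδ0 : 0 ≤ δ) (hδ1 : δ ≤ 1) :
    0 ≤ regPow φ p δ x ∧ regPow φ p δ x ≤ 2 ^ P * (|φ x| ^ p x + 1) := by
  have hp0 : 0 ≤ p x := by linarith
  constructor
  · rw [regPow, sub_nonneg]
    exact Real.rpow_le_rpow hδ0 (le_sqrt_sq_add _ _) hp0
  · have h1 : 0 ≤ δ ^ p x := by positivity
    have h2 : √(φ x ^ 2 + δ ^ 2) ^ p x ≤ (|φ x| + 1) ^ p x :=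
      Real.rpow_le_rpow (Real.sqrt_nonneg _)
        ((sqrt_sq_add_le _ hδ0).trans (by linarith)) hp0
    have h3 := add_rpow_le_two_rpow_mul (abs_nonneg (φ x)) zero_le_one hp0 hp.2
    rw [Real.one_rpow] at h3
    rw [regPow]
    linarith

/-- This is where ∇_X p · ∇_X v = 0 enters: the terms from both variable exponents drop out and
Picone's identity remains. The last summand compensates for the δ^p subtracted in `regPow`. -/
theorem norm_rpow_mul_inner_quotientGrad {ε s : ℝ} (hp : 1 < p x) (hδ : 0 < δ)
    (hφ : ContMDiffAt (𝓡 n) 𝓘(ℝ, ℝ) 1 φ x) (hpd : ContMDiffAt (𝓡 n) 𝓘(ℝ, ℝ) 1 p x)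
    {ξ : EuclideanSpace ℝ (Fin N)} (horth : inner ℝ (hGrad X p x) ξ = 0) :
    picone (p x) (√(φ x ^ 2 + δ ^ 2) ^ (p x - 1) * (φ x / √(φ x ^ 2 + δ ^ 2)))
      (√(φ x ^ 2 + δ ^ 2)) (s + ε) ξ (hGrad X φ x)
    = ‖hGrad X φ x‖ ^ p x
      - ‖ξ‖ ^ (p x - 2) * inner ℝ ξ (quotientGrad X p (regPow φ p δ) ε x s ξ)
      + (p x - 1) * δ ^ p x * (s + ε) ^ (-p x) * ‖ξ‖ ^ p x := by
  obtain ⟨κ, hκ⟩ := hGrad_regPow (X := X) hδ hφ hpd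
  have h0 : inner ℝ ξ (hGrad X p x) = 0 := by rw [real_inner_comm]; exact horth
  have h1 := norm_rpow_sub_two_mul_inner_self hp ξ
  rw [quotientGrad, hκ]
  simp only [inner_add_right, inner_sub_right, inner_smul_right, h0, mul_zero, add_zero, sub_zero]
  rw [picone, ← h1, regPow]
  ring

end PiconeTest

/-! ### Picone's inequality in W₀ -/

section Picone

variable [T2Space M] [SecondCountableTopology M] [IsManifold (𝓡 n) ∞ M] [MeasurableSpace M]
  [BorelSpace M] {μ : Measure M} {X : Fin N → VField n M} {Ω : Set M} {p g : M → ℝ}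
  {P C lam : ℝ} {v : M → ℝ} {Gv : M → EuclideanSpace ℝ (Fin N)}

omit [T2Space M] [SecondCountableTopology M] [BorelSpace M] in
theorem IsPositiveSolution.exponent_ae [OpensMeasurableSpace M]
    (S : IsPositiveSolution μ Ω p g X P C lam v Gv) :
    ∀ᵐ x ∂(μ.restrict Ω), 1 < p x ∧ p x ≤ P :=
  (ae_restrict_mem S.isOpen.measurableSet).mono fun x hx => S.exponent x hx

omit [T2Space M] [SecondCountableTopology M] in
theorem IsPositiveSolution.exponent_meas (S : IsPositiveSolution μ Ω p g X P C lam v Gv) :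
    AEMeasurable p (μ.restrict Ω) :=
  S.exponent_C1.continuousOn.aemeasurable S.isOpen.measurableSet

omit [T2Space M] [SecondCountableTopology M] in
theorem IsPositiveSolution.integrable_weight_mul
    (S : IsPositiveSolution μ Ω p g X P C lam v Gv) {u : M → ℝ} (hu : MemLpVar μ Ω p u) :
    Integrable (fun x => g x * |u x| ^ p x) (μ.restrict Ω) := by
  refine ((hu.integrable_rpow S.exponent_meas).const_mul C).mono'
    (S.weight_meas.mul (hu.1.norm.pow S.exponent_meas)).aestronglyMeasurable ?_
  filter_upwards [ae_restrict_mem S.isOpen.measurableSet] with x hx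
  have h1 := S.weight x hx
  rw [Real.norm_eq_abs, abs_mul, abs_of_pos h1.1, abs_of_nonneg (by positivity)]
  exact mul_le_mul_of_nonneg_right h1.2 (by positivity)

/-- The product is (v/(v+ε))^{p-1}. The bound is uniform in ε and dominates the right-hand side of
the equation tested with the quotient. -/
theorem mul_rpow_quotient_le {v ε p : ℝ} (hv : 0 < v) (hε : 0 ≤ ε) (hp : 1 < p) :
    0 ≤ |v| ^ (p - 2) * v * (v + ε) ^ (1 - p) ∧ |v| ^ (p - 2) * v * (v + ε) ^ (1 - p) ≤ 1 := by
  have hs : 0 < v + ε := by linarith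
  refine ⟨by positivity, ?_⟩
  rw [abs_of_pos hv, ← Real.rpow_add_one hv.ne', show p - 2 + 1 = p - 1 by ring,
    show 1 - p = -(p - 1) by ring, Real.rpow_neg hs.le, ← div_eq_mul_inv,
    div_le_one (by positivity)]
  exact Real.rpow_le_rpow hv.le (by linarith) (by linarith)

/-- Picone's inequality for elements of `W₀`. -/
theorem IsPositiveSolution.lintegral_picone_le (S : IsPositiveSolution μ Ω p g X P C lam v Gv)
    {u : M → ℝ} {G : M → EuclideanSpace ℝ (Fin N)} (hu : MemW0 μ Ω p X u G) :
    lam * ∫ x in Ω, g x * |u x| ^ p x ∂μ ≤ ∫ x in Ω, ‖G x‖ ^ p x ∂μ ∧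
    ∫⁻ x in Ω, ENNReal.ofReal (picone (p x) (|u x| ^ (p x - 1) * (u x / |u x|)) |u x| (v x)
        (Gv x) (G x)) ∂μ
      ≤ ENNReal.ofReal (∫ x in Ω, ‖G x‖ ^ p x ∂μ - lam * ∫ x in Ω, g x * |u x| ^ p x ∂μ) := by
  have := S.finite
  have hpae := S.exponent_ae
  have hpm := S.exponent_meas
  have hΩm := S.isOpen.measurableSet
  have hpat : ∀ x ∈ Ω, ContMDiffAt (𝓡 n) 𝓘(ℝ, ℝ) 1 p x := fun x hx =>
    (S.exponent_C1 x hx).contMDiffAt (S.isOpen.mem_nhds hx)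
  have hvW := S.solution.1
  obtain ⟨φ, H, hφ, hH, hle, hgle, hlim, hglim⟩ := hu.exists_dominated S.smooth hpae hpm
  set ε : ℕ → ℝ := fun i => 1 / ((i : ℝ) + 1) with hε
  have hε0 : ∀ i, 0 < ε i := fun i => by simp only [hε]; positivity
  have hε1 : ∀ i, ε i ≤ 1 := fun i => by
    simp only [hε]
    rw [div_le_one (by positivity)]
    linarith [(Nat.cast_nonneg i : (0 : ℝ) ≤ i)]
  have hεlim : Tendsto ε atTop (𝓝 0) := tendsto_one_div_add_atTop_nhds_zero_nat
  -- What matters is 0 < δ ≤ ε and δ → 0: the first keeps δ/(v+ε) ≤ 1 in the error term `c`, the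
  -- second makes that term vanish in the limit.
  set δ : ℕ → ℝ := fun i => ε i ^ 2 with hδ
  have hδ0 : ∀ i, 0 < δ i := fun i => pow_pos (hε0 i) 2
  have hδε : ∀ i, δ i ≤ ε i := fun i => by
    simp only [hδ]; nlinarith [hε0 i, hε1 i]
  have hδ1 : ∀ i, δ i ≤ 1 := fun i => (hδε i).trans (hε1 i)
  have hδlim : Tendsto δ atTop (𝓝 0) := by simpa using hεlim.pow 2
  have hφd : ∀ i x, ContMDiffAt (𝓡 n) 𝓘(ℝ, ℝ) 1 (φ i) x := fun i x =>
    ((hφ i).1 x).of_le (by simp)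
  set A : ℕ → M → ℝ := fun i => regPow (φ i) p (δ i) with hA
  have hAt : ∀ i, tsupport (A i) ⊆ tsupport (φ i) := fun i => tsupport_regPow_subset (hδ0 i).le
  have hAd : ∀ i, ContMDiff (𝓡 n) 𝓘(ℝ, ℝ) 1 (A i) := fun i => contMDiff_of_tsupport fun x hx =>
    contMDiffAt_regPow (hδ0 i) (hφd i x) (hpat x ((hφ i).2.2 (hAt i hx)))
  set W : ℕ → M → ℝ := fun i x => A i x * (v x + ε i) ^ (1 - p x) with hW
  set Q : ℕ → M → EuclideanSpace ℝ (Fin N) := fun i x =>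
    quotientGrad X p (A i) (ε i) x (v x) (Gv x) with hQ
  have hWQ : ∀ i, MemW0 μ Ω p X (W i) (Q i) := fun i =>
    memW0_quotient S.volume S.smooth S.isOpen S.exponent S.exponent_C1 hvW S.pos (hAd i)
      ((hφ i).2.1.of_isClosed_subset (isClosed_tsupport _) (hAt i))
      ((hAt i).trans (hφ i).2.2) (hε0 i) (hε1 i)
  -- the three parts of the integrated Picone function
  set a : ℕ → M → ℝ := fun i x => ‖hGrad X (φ i) x‖ ^ p x with ha
  set b : ℕ → M → ℝ := fun i x => g x * |v x| ^ (p x - 2) * v x * W i x with hb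
  set c : ℕ → M → ℝ := fun i x =>
    (p x - 1) * δ i ^ p x * (v x + ε i) ^ (-p x) * ‖Gv x‖ ^ p x with hc
  set f : ℕ → M → ℝ := fun i x => ‖Gv x‖ ^ (p x - 2) * inner ℝ (Gv x) (Q i x) with hf
  set R : ℕ → M → ℝ := fun i x => a i x - f i x + c i x with hR
  have hgm : ∀ i, AEMeasurable (hGrad X (φ i)) (μ.restrict Ω) := fun i =>
    (continuous_hGrad S.smooth (fun x => hφd i x)).measurable.aemeasurable
  have ham : ∀ i, AEStronglyMeasurable (a i) (μ.restrict Ω) := fun i =>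
    ((hgm i).norm.pow hpm).aestronglyMeasurable
  have hvm : AEMeasurable v (μ.restrict Ω) := hvW.1.1.1
  have hGvm : AEMeasurable Gv (μ.restrict Ω) := hvW.1.2.1.1
  have hale : ∀ i, ∀ᵐ x ∂(μ.restrict Ω), ‖a i x‖ ≤ H x := fun i => by
    filter_upwards [hgle i] with x hx
    rwa [Real.norm_eq_abs, abs_of_nonneg (by simp only [ha]; positivity)]
  have hai : ∀ i, Integrable (a i) (μ.restrict Ω) := fun i => hH.mono' (ham i) (hale i)
  have halim : Tendsto (fun i => ∫ x in Ω, a i x ∂μ) atTop (𝓝 (∫ x in Ω, ‖G x‖ ^ p x ∂μ)) := by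
    refine tendsto_integral_of_dominated_convergence H ham hH hale ?_
    filter_upwards [hglim, hpae] with x hx hpx
    exact hx.norm.rpow_const (Or.inr (by linarith))
  have hAm : ∀ i, AEMeasurable (A i) (μ.restrict Ω) := fun i =>
    (hAd i).continuous.measurable.aemeasurable
  have hbm : ∀ i, AEStronglyMeasurable (b i) (μ.restrict Ω) := fun i =>
    (((S.weight_meas.mul (hvm.norm.pow (hpm.sub_const 2))).mul hvm).mul
      ((hAm i).mul ((hvm.add_const _).pow (hpm.const_sub 1)))).aestronglyMeasurable
  have hble : ∀ i, ∀ᵐ x ∂(μ.restrict Ω), ‖b i x‖ ≤ C * (2 ^ P * (H x + 1)) := fun i => by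
    filter_upwards [hle i, S.pos, ae_restrict_mem hΩm] with x hx hx0 hxΩ
    have h1 := S.weight x hxΩ
    obtain ⟨h2, h3⟩ := mul_rpow_quotient_le hx0 (hε0 i).le (S.exponent x hxΩ).1
    obtain ⟨h4, h5⟩ := regPow_bounds (φ := φ i) (S.exponent x hxΩ) (hδ0 i).le (hδ1 i)
    have h6 : b i x = g x * A i x * (|v x| ^ (p x - 2) * v x * (v x + ε i) ^ (1 - p x)) := by
      simp only [hb, hW]; ring
    have hgA : 0 ≤ g x * A i x := mul_nonneg h1.1.le h4
    rw [h6, Real.norm_eq_abs, abs_of_nonneg (mul_nonneg hgA h2)]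
    calc g x * A i x * (|v x| ^ (p x - 2) * v x * (v x + ε i) ^ (1 - p x))
        ≤ g x * A i x * 1 := by gcongr
      _ = g x * A i x := mul_one _
      _ ≤ C * (2 ^ P * (H x + 1)) := by
        refine mul_le_mul h1.2 (h5.trans ?_) h4 (h1.1.le.trans h1.2)
        gcongr
        exact hx
  have hbdom : Integrable (fun x => C * (2 ^ P * (H x + 1))) (μ.restrict Ω) :=
    ((hH.add (integrable_const 1)).const_mul _).const_mul _
  have hbi : ∀ i, Integrable (b i) (μ.restrict Ω) := fun i => hbdom.mono' (hbm i) (hble i)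
  have hroot : ∀ x, Tendsto (fun i => φ i x) atTop (𝓝 (u x)) →
      Tendsto (fun i => √(φ i x ^ 2 + δ i ^ 2)) atTop (𝓝 |u x|) := fun x hx => by
    have h1 := ((hx.pow 2).add (hδlim.pow 2)).sqrt
    rwa [zero_pow two_ne_zero, add_zero, Real.sqrt_sq_eq_abs] at h1
  have hblim : Tendsto (fun i => ∫ x in Ω, b i x ∂μ) atTop
      (𝓝 (∫ x in Ω, g x * |u x| ^ p x ∂μ)) := by
    refine tendsto_integral_of_dominated_convergence _ hbm hbdom hble ?_
    filter_upwards [hlim, S.pos, hpae] with x hx hx0 hpx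
    have hp0 : 0 < p x := by linarith
    have h1 : Tendsto (fun i => A i x) atTop (𝓝 (|u x| ^ p x - 0 ^ p x)) :=
      ((hroot x hx).rpow_const (Or.inr hp0.le)).sub (hδlim.rpow_const (Or.inr hp0.le))
    rw [Real.zero_rpow hp0.ne', sub_zero] at h1
    have h2 : Tendsto (fun i => (v x + ε i) ^ (1 - p x)) atTop (𝓝 ((v x + 0) ^ (1 - p x))) :=
      (hεlim.const_add _).rpow_const (Or.inl (by rw [add_zero]; exact hx0.ne'))
    rw [add_zero] at h2
    have h3 := (h1.mul h2).const_mul (g x * |v x| ^ (p x - 2) * v x)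
    have h4 : g x * |v x| ^ (p x - 2) * v x * (|u x| ^ p x * v x ^ (1 - p x))
        = g x * |u x| ^ p x := by
      have h5 : |v x| ^ (p x - 2) * v x * v x ^ (1 - p x) = 1 := by
        rw [abs_of_pos hx0, ← Real.rpow_add_one hx0.ne', ← Real.rpow_add hx0,
          show p x - 2 + 1 + (1 - p x) = 0 by ring, Real.rpow_zero]
      calc _ = g x * |u x| ^ p x * (|v x| ^ (p x - 2) * v x * v x ^ (1 - p x)) := by ring
        _ = _ := by rw [h5, mul_one]
    rw [h4] at h3
    exact h3
  have hcm : ∀ i, AEStronglyMeasurable (c i) (μ.restrict Ω) := fun i =>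
    ((((hpm.sub_const 1).mul (hpm.const_pow (δ i))).mul ((hvm.add_const _).pow hpm.neg)).mul
      (hGvm.norm.pow hpm)).aestronglyMeasurable
  have hcle : ∀ i, ∀ᵐ x ∂(μ.restrict Ω), 0 ≤ c i x ∧ ‖c i x‖ ≤ P * ‖Gv x‖ ^ p x := fun i => by
    filter_upwards [S.pos, hpae] with x hx0 hpx
    have hs : 0 < v x + ε i := by linarith [hε0 i]
    have h0 := hδ0 i
    have hp1 : 0 ≤ p x - 1 := by linarith
    have hc0 : 0 ≤ c i x := by simp only [hc]; positivity
    refine ⟨hc0, ?_⟩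
    rw [Real.norm_eq_abs, abs_of_nonneg hc0]
    have h1 : δ i ^ p x * (v x + ε i) ^ (-p x) ≤ 1 := by
      rw [Real.rpow_neg hs.le, ← div_eq_mul_inv, div_le_one (by positivity)]
      exact Real.rpow_le_rpow h0.le (by linarith [hδε i]) (by linarith)
    calc c i x = (p x - 1) * (δ i ^ p x * (v x + ε i) ^ (-p x)) * ‖Gv x‖ ^ p x := by
          simp only [hc]; ring
      _ ≤ P * 1 * ‖Gv x‖ ^ p x := by
          gcongr
          · linarith
          · linarith
      _ = _ := by rw [mul_one]
  have hcdom : Integrable (fun x => P * ‖Gv x‖ ^ p x) (μ.restrict Ω) :=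
    (hvW.1.2.1.integrable_rpow hpm).const_mul P
  have hci : ∀ i, Integrable (c i) (μ.restrict Ω) := fun i =>
    hcdom.mono' (hcm i) ((hcle i).mono fun _ h => h.2)
  have hclim : Tendsto (fun i => ∫ x in Ω, c i x ∂μ) atTop (𝓝 0) := by
    have h0 : ∫ x in Ω, (0 : ℝ) ∂μ = 0 := integral_zero _ _
    rw [← h0]
    refine tendsto_integral_of_dominated_convergence _ hcm hcdom
      (fun i => (hcle i).mono fun _ h => h.2) ?_
    filter_upwards [S.pos, hpae] with x hx0 hpx
    have hp0 : 0 < p x := by linarith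
    have h1 : Tendsto (fun i => (v x + ε i) ^ (-p x)) atTop (𝓝 ((v x + 0) ^ (-p x))) :=
      (hεlim.const_add _).rpow_const (Or.inl (by rw [add_zero]; exact hx0.ne'))
    have h2 := hδlim.rpow_const (p := p x) (Or.inr hp0.le)
    rw [Real.zero_rpow hp0.ne'] at h2
    simpa using ((h2.const_mul (p x - 1)).mul h1).mul_const (‖Gv x‖ ^ p x)
  have hfi : ∀ i, Integrable (f i) (μ.restrict Ω) := fun i =>
    hvW.1.2.1.integrable_flux hpae hpm (hWQ i).1.2.1
  have hRi : ∀ i, Integrable (R i) (μ.restrict Ω) := fun i => ((hai i).sub (hfi i)).add (hci i)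
  have hRint : ∀ i, ∫ x in Ω, R i x ∂μ
      = ∫ x in Ω, a i x ∂μ - lam * ∫ x in Ω, b i x ∂μ + ∫ x in Ω, c i x ∂μ := fun i => by
    have h1 : ∫ x in Ω, R i x ∂μ
        = ∫ x in Ω, a i x ∂μ - ∫ x in Ω, f i x ∂μ + ∫ x in Ω, c i x ∂μ := by
      rw [← integral_sub (hai i) (hfi i)]
      exact integral_add ((hai i).sub (hfi i)) (hci i)
    -- The equation of v, tested with the admissible quotient.
    have h2 : ∫ x in Ω, f i x ∂μ - lam * ∫ x in Ω, b i x ∂μ = 0 := S.solution.2 _ _ (hWQ i)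
    rw [h1]
    linarith
  have hReq : ∀ i, ∀ᵐ x ∂(μ.restrict Ω), R i x = picone (p x)
      (√(φ i x ^ 2 + δ i ^ 2) ^ (p x - 1) * (φ i x / √(φ i x ^ 2 + δ i ^ 2)))
      (√(φ i x ^ 2 + δ i ^ 2)) (v x + ε i) (Gv x) (hGrad X (φ i) x) := fun i => by
    filter_upwards [S.orth, ae_restrict_mem hΩm] with x hx hxΩ
    exact (norm_rpow_mul_inner_quotientGrad (S.exponent x hxΩ).1 (hδ0 i) (hφd i x) (hpat x hxΩ)
      hx).symm
  have habs : ∀ i x, |√(φ i x ^ 2 + δ i ^ 2) ^ (p x - 1) * (φ i x / √(φ i x ^ 2 + δ i ^ 2))|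
      ≤ √(φ i x ^ 2 + δ i ^ 2) ^ (p x - 1) := fun i x => by
    have h1 := norm_div_sqrt_smul_le (φ i x) (δ i) (1 : ℝ)
    rw [smul_eq_mul, mul_one, norm_one, Real.norm_eq_abs] at h1
    rw [abs_mul, abs_of_nonneg (by positivity)]
    exact mul_le_of_le_one_right (by positivity) h1
  have hR0 : ∀ i, ∀ᵐ x ∂(μ.restrict Ω), 0 ≤ R i x := fun i => by
    filter_upwards [hReq i, S.pos, hpae] with x hx hx0 hpx
    rw [hx]
    exact picone_nonneg hpx.1 (Real.sqrt_nonneg _) (by linarith [hε0 i]) (habs i x) _ _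
  have hRlim : ∀ᵐ x ∂(μ.restrict Ω), Tendsto (fun i => R i x) atTop
      (𝓝 (picone (p x) (|u x| ^ (p x - 1) * (u x / |u x|)) |u x| (v x) (Gv x) (G x))) := by
    filter_upwards [ae_all_iff.2 hReq, S.pos, hpae, hlim, hglim] with x hx hx0 hpx hlx hgx
    simp only [hx, picone]
    have hp0 : 0 < p x := by linarith
    have hΦ := hroot x hlx
    have hs : Tendsto (fun i => v x + ε i) atTop (𝓝 (v x)) := by
      simpa using hεlim.const_add (v x)
    have hΦ1 := hΦ.rpow_const (p := p x - 1) (Or.inr (by linarith))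
    -- Where u = 0 the factor φ/√(φ²+δ²) need not converge, but it is bounded by 1 and multiplies a
    -- power tending to 0. This agrees with the default value 0/0 = 0.
    have hcoef : Tendsto (fun i => √(φ i x ^ 2 + δ i ^ 2) ^ (p x - 1) *
        (φ i x / √(φ i x ^ 2 + δ i ^ 2))) atTop (𝓝 (|u x| ^ (p x - 1) * (u x / |u x|))) := by
      by_cases h0 : u x = 0
      · rw [h0, abs_zero, div_zero, mul_zero]
        rw [h0, abs_zero, Real.zero_rpow (by linarith)] at hΦ1
        exact squeeze_zero_norm (fun i => habs i x) hΦ1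
      · exact hΦ1.mul (hlx.div hΦ (abs_ne_zero.2 h0))
    refine ((hgx.norm.rpow_const (Or.inr hp0.le)).sub
      (((hcoef.const_mul (p x)).mul (hs.rpow_const (Or.inl hx0.ne'))).mul
        ((tendsto_const_nhds.inner hgx).const_mul _))).add
      ((((hΦ.rpow_const (Or.inr hp0.le)).const_mul _).mul
        (hs.rpow_const (Or.inl hx0.ne'))).mul_const _)
  have hlimI : Tendsto (fun i => ∫ x in Ω, R i x ∂μ) atTop
      (𝓝 (∫ x in Ω, ‖G x‖ ^ p x ∂μ - lam * ∫ x in Ω, g x * |u x| ^ p x ∂μ)) := by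
    simp only [hRint]
    simpa using (halim.sub (hblim.const_mul lam)).add hclim
  have hnonneg : 0 ≤ ∫ x in Ω, ‖G x‖ ^ p x ∂μ - lam * ∫ x in Ω, g x * |u x| ^ p x ∂μ :=
    ge_of_tendsto hlimI (Eventually.of_forall fun i => integral_nonneg_of_ae (hR0 i))
  refine ⟨by linarith, ?_⟩
  calc ∫⁻ x in Ω, ENNReal.ofReal (picone (p x) (|u x| ^ (p x - 1) * (u x / |u x|)) |u x| (v x)
        (Gv x) (G x)) ∂μ
      = ∫⁻ x in Ω, liminf (fun i => ENNReal.ofReal (R i x)) atTop ∂μ := by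
        refine lintegral_congr_ae ?_
        filter_upwards [hRlim] with x hx
        exact (ENNReal.tendsto_ofReal hx).liminf_eq.symm
    -- Fatou's lemma: the integrands are nonnegative, and their flux parts come with no majorant
    -- uniform in i.
    _ ≤ liminf (fun i => ∫⁻ x in Ω, ENNReal.ofReal (R i x) ∂μ) atTop :=
        lintegral_liminf_le' fun i => (hRi i).aestronglyMeasurable.aemeasurable.ennreal_ofReal
    _ = liminf (fun i => ENNReal.ofReal (∫ x in Ω, R i x ∂μ)) atTop := by
        congr 1
        funext i
        exact (ofReal_integral_eq_lintegral_ofReal (hRi i) (hR0 i)).symm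
    _ = _ := (ENNReal.tendsto_ofReal hlimI).liminf_eq

end Picone

end SubLaplace

namespace SubLaplace

variable {n N : ℕ} {M : Type*} [TopologicalSpace M] [ChartedSpace (EuclideanSpace ℝ (Fin n)) M]

/-! ### Bounds for arctan of a quotient -/

section Arctan

variable {X : Fin N → VField n M} {a b : M → ℝ} {α β : EuclideanSpace ℝ (Fin N)} {x : M}

theorem HasHGradAt.arctan_div (ha : HasHGradAt X a α x) (hb : HasHGradAt X b β x)
    (h : b x ≠ 0) :
    HasHGradAt X (fun z => Real.arctan (a z / b z))
      ((1 / (1 + (a x / b x) ^ 2)) • ((b x)⁻¹ • α + a x • ((-(b x ^ 2)⁻¹) • β))) x := by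
  have h1 := ha.mul (hb.comp (hasDerivAt_inv h))
  simp only [← div_eq_mul_inv] at h1
  exact h1.comp (Real.hasDerivAt_arctan _)

theorem contMDiffAt_arctan_div (ha : ContMDiffAt (𝓡 n) 𝓘(ℝ, ℝ) 1 a x)
    (hb : ContMDiffAt (𝓡 n) 𝓘(ℝ, ℝ) 1 b x) (h : b x ≠ 0) :
    ContMDiffAt (𝓡 n) 𝓘(ℝ, ℝ) 1 (fun z => Real.arctan (a z / b z)) x := by
  have h1 : ContDiffAt ℝ 1 (fun q : ℝ × ℝ => Real.arctan (q.1 / q.2)) (a x, b x) :=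
    Real.contDiff_arctan.contDiffAt.comp _ (contDiffAt_fst.div contDiffAt_snd h)
  exact ContMDiffAt.comp (g := fun q : ℝ × ℝ => Real.arctan (q.1 / q.2))
    (f := fun z => (a z, b z)) x h1.contMDiffAt (ha.prodMk_space hb)

/-- From (|t|-1)² ≥ 0. This damping is why arctan(u/v) is differentiated rather than u/v: its ∇v
part has factor t/(1+t²) with t = u/v. -/
theorem abs_div_one_add_sq_le (t : ℝ) : |t / (1 + t ^ 2)| ≤ 1 := by
  have h : 0 < 1 + t ^ 2 := by positivity
  rw [abs_div, abs_of_pos h, div_le_one h]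
  nlinarith [sq_abs t, sq_nonneg (|t| - 1), abs_nonneg t]

theorem abs_arctan_le_two (t : ℝ) : |Real.arctan t| ≤ 2 := by
  have h1 := Real.arctan_lt_pi_div_two t
  have h2 := Real.neg_pi_div_two_lt_arctan t
  have h3 := Real.pi_lt_four
  rw [abs_le]
  constructor <;> linarith

end Arctan

/-! ### Local integrability of the logarithmic gradient -/

section TestFunctionsInW0

variable [T2Space M] [SecondCountableTopology M] [IsManifold (𝓡 n) ∞ M] [MeasurableSpace M]
  [BorelSpace M] {μ : Measure M} {X : Fin N → VField n M} {Ω : Set M} {p g : M → ℝ}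
  {P C lam : ℝ} {v : M → ℝ} {Gv : M → EuclideanSpace ℝ (Fin N)}

theorem rpow_le_max_rpow {a c p P : ℝ} (ha : 0 ≤ a) (hac : a ≤ c) (hp : 1 < p ∧ p ≤ P) :
    a ^ p ≤ (max c 1) ^ P :=
  (Real.rpow_le_rpow ha (hac.trans (le_max_left c 1)) (by linarith)).trans
    (Real.rpow_le_rpow_of_exponent_le (le_max_right c 1) hp.2)

theorem IsPositiveSolution.memW0_of_isTestFunction
    (S : IsPositiveSolution μ Ω p g X P C lam v Gv) {φ : M → ℝ} (hφ : IsTestFunction n Ω φ) :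
    MemW0 μ Ω p X φ (hGrad X φ) := by
  have := S.finite
  have hφ1 : ContMDiff (𝓡 n) 𝓘(ℝ, ℝ) 1 φ := hφ.1.of_le (by simp)
  have hgc : HasCompactSupport (hGrad X φ) := hφ.2.1.mono' fun x hx => by
    by_contra h
    exact hx (hGrad_eq_zero_of_notMem_tsupport h)
  obtain ⟨C₁, hC₁⟩ := hφ.2.1.exists_bound_of_continuous hφ.1.continuous
  obtain ⟨C₂, hC₂⟩ := hgc.exists_bound_of_continuous (continuous_hGrad S.smooth hφ1)
  refine memW0_of_dominated S.volume S.smooth S.isOpen S.exponent_ae S.exponent_meas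
    (φ := fun _ => φ) (H := fun _ => (max C₁ 1) ^ P + (max C₂ 1) ^ P) (fun _ => hφ1)
    (fun _ => hφ.2.1) (fun _ => hφ.2.2) (integrable_const _) (fun _ => ?_) (fun _ => ?_)
    (Eventually.of_forall fun _ => tendsto_const_nhds)
    (Eventually.of_forall fun _ => tendsto_const_nhds)
  · filter_upwards [S.exponent_ae] with x hx
    exact (rpow_le_max_rpow (norm_nonneg _) (hC₁ x) hx).trans
      (le_add_of_nonneg_right (by positivity))
  · filter_upwards [S.exponent_ae] with x hx
    exact (rpow_le_max_rpow (norm_nonneg _) (hC₂ x) hx).trans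
      (le_add_of_nonneg_left (by positivity))

omit [MeasurableSpace M] [BorelSpace M] in
theorem exists_testFunction_eq_one (hΩ : IsOpen Ω) {K : Set M} (hK : IsCompact K) (hKΩ : K ⊆ Ω) :
    ∃ φ : M → ℝ, IsTestFunction n Ω φ ∧ ∀ x ∈ K, φ x = 1 := by
  have : LocallyCompactSpace M :=
    ChartedSpace.locallyCompactSpace (EuclideanSpace ℝ (Fin n)) M
  obtain ⟨L, hL, hKL, hLΩ⟩ := exists_compact_between hK hΩ hKΩ
  obtain ⟨φ, hφ, -, hsupp, hone⟩ := exists_contMDiff_support_eq_eq_one_iff (n := ⊤) (𝓡 n)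
    isOpen_interior hK.isClosed hKL
  have ht : tsupport φ ⊆ L :=
    closure_minimal (hsupp ▸ interior_subset) hL.isClosed
  exact ⟨φ, ⟨hφ, hL.of_isClosed_subset (isClosed_tsupport _) ht, ht.trans hLΩ⟩,
    fun x hx => (hone x).1 hx⟩

/-- The logarithmic gradient `|∇_X v| / v` of a positive solution is locally integrable. -/
theorem IsPositiveSolution.integrableOn_norm_div
    (S : IsPositiveSolution μ Ω p g X P C lam v Gv) {K : Set M} (hK : IsCompact K)
    (hKΩ : K ⊆ Ω) : IntegrableOn (fun x => ‖Gv x‖ / v x) K μ := by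
  have hfin := S.finite
  have hvW := S.solution.1
  obtain ⟨φ, hφ, hφK⟩ := exists_testFunction_eq_one (n := n) S.isOpen hK hKΩ
  -- Picone's inequality for a cutoff equal to 1 on K: the Picone function then controls (|∇v|/v)^p
  -- on K.
  have hlint := (S.lintegral_picone_le (S.memW0_of_isTestFunction hφ)).2
  -- Compactness keeps p above some q > 1 on K, so that the constant 2/(p-1) is bounded by k =
  -- 2/(q-1).
  obtain ⟨q, hq1, hq⟩ := hK.exists_forall_le' (S.exponent_C1.continuousOn.mono hKΩ)
    (fun x hx => (S.exponent x (hKΩ hx)).1)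
  obtain ⟨c, hc⟩ := hK.exists_bound_of_continuousOn (f := hGrad X φ)
    (continuous_hGrad S.smooth (hφ.1.of_le (by simp))).continuousOn
  set B := (max (2 ^ P * |c|) 1) ^ P with hB
  set k := 2 / (q - 1) with hk
  have hk0 : 0 < k := div_pos two_pos (by linarith)
  set R : M → ℝ := fun x => picone (p x) (|φ x| ^ (p x - 1) * (φ x / |φ x|)) |φ x| (v x)
        (Gv x) (hGrad X φ x) with hR
  have hres : μ.restrict K ≤ μ.restrict Ω := Measure.restrict_mono hKΩ le_rfl
  have hm : AEStronglyMeasurable (fun x => ‖Gv x‖ / v x) (μ.restrict K) :=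
    ((hvW.1.2.1.1.norm.div hvW.1.1.1).mono_measure hres).aestronglyMeasurable
  have hv0 : ∀ᵐ x ∂(μ.restrict K), 0 < v x := ae_restrict_of_ae_restrict_of_subset hKΩ S.pos
  refine ⟨hm, ?_⟩
  rw [hasFiniteIntegral_iff_ofReal (hv0.mono fun x hx => by positivity)]
  have hpt : ∀ᵐ x ∂(μ.restrict K), ‖Gv x‖ / v x ≤ (1 + k * B) + k * R x := by
    filter_upwards [hv0, ae_restrict_mem hK.measurableSet] with x hx hxK
    have hpx := S.exponent x (hKΩ hxK)
    have h1 := rpow_le_picone hpx.1 (abs_nonneg (φ x)) hx (abs_rpow_mul_div_abs_le (φ x) (p x - 1))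
      (Gv x) (hGrad X φ x)
    have h2 : (2 ^ (p x - 1) * ‖hGrad X φ x‖) ^ p x ≤ B := by
      refine rpow_le_max_rpow (by positivity) ?_ hpx
      gcongr
      · exact one_le_two
      · linarith
      · exact (hc x hxK).trans (le_abs_self c)
    have h3 : |φ x| * ‖Gv x‖ / v x = ‖Gv x‖ / v x := by rw [hφK x hxK, abs_one, one_mul]
    rw [h3] at h1
    have h4 := le_one_add_rpow (show 0 ≤ ‖Gv x‖ / v x by positivity) hpx.1.le
    have h5 : (q - 1) / 2 * (‖Gv x‖ / v x) ^ p x ≤ R x + B := by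
      refine le_trans ?_ (h1.trans (by gcongr))
      gcongr
      exact hq x hxK
    have h6 : (‖Gv x‖ / v x) ^ p x ≤ k * (R x + B) := by
      have hkq : k * ((q - 1) / 2) = 1 := by
        rw [hk]
        field_simp [(by linarith : q - 1 ≠ 0)]
      calc (‖Gv x‖ / v x) ^ p x = k * ((q - 1) / 2 * (‖Gv x‖ / v x) ^ p x) := by
            rw [← mul_assoc, hkq, one_mul]
        _ ≤ _ := by gcongr
    linarith
  have hB0 : 0 ≤ B := by positivity
  calc ∫⁻ x in K, ENNReal.ofReal (‖Gv x‖ / v x) ∂μ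
      ≤ ∫⁻ x in K, (ENNReal.ofReal (1 + k * B) + ENNReal.ofReal k * ENNReal.ofReal (R x)) ∂μ := by
        refine lintegral_mono_ae (hpt.mono fun x hx => ?_)
        rw [← ENNReal.ofReal_mul hk0.le]
        exact (ENNReal.ofReal_le_ofReal hx).trans ENNReal.ofReal_add_le
    _ = ∫⁻ x in K, ENNReal.ofReal (1 + k * B) ∂μ
        + ENNReal.ofReal k * ∫⁻ x in K, ENNReal.ofReal (R x) ∂μ := by
        rw [lintegral_add_left measurable_const, lintegral_const_mul' _ _ ENNReal.ofReal_ne_top]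
    _ < ⊤ := by
        refine ENNReal.add_lt_top.2 ⟨?_, ENNReal.mul_lt_top ENNReal.ofReal_lt_top ?_⟩
        · rw [setLIntegral_const]
          refine ENNReal.mul_lt_top ENNReal.ofReal_lt_top ?_
          have := measure_lt_top (μ.restrict Ω) K
          rwa [Measure.restrict_apply hK.measurableSet, inter_eq_self_of_subset_left hKΩ] at this
        · exact (lintegral_mono' hres le_rfl).trans_lt (hlint.trans_lt ENNReal.ofReal_lt_top)

end TestFunctionsInW0

/-! ### Equality in Picone and the gradient of arctan(u/v) -/

section Quotient

variable [T2Space M] [SecondCountableTopology M] [IsManifold (𝓡 n) ∞ M] [MeasurableSpace M]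
  [BorelSpace M] {μ : Measure M} {X : Fin N → VField n M} {Ω : Set M} {p g : M → ℝ}
  {P C lam : ℝ} {v : M → ℝ} {Gv : M → EuclideanSpace ℝ (Fin N)}
  {u : M → ℝ} {G : M → EuclideanSpace ℝ (Fin N)}

omit [SecondCountableTopology M] in
-- The chain rule holds classically for the approximants. With the denominator at least ε, their
-- gradients are bounded by (|∇φ| + |∇V|)/ε, which is dominated.
theorem IsPositiveSolution.hasWeakDerivAlong_arctan_div_add
    (S : IsPositiveSolution μ Ω p g X P C lam v Gv) (hu : MemW0 μ Ω p X u G) {ε : ℝ}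
    (hε : 0 < ε) (k : Fin N) :
    HasWeakDerivAlong Ω (X k) (fun x => Real.arctan (u x / (v x + ε)))
      (fun x => ((1 / (1 + (u x / (v x + ε)) ^ 2)) • ((v x + ε)⁻¹ • G x +
        u x • ((-((v x + ε) ^ 2)⁻¹) • Gv x))) k) := by
  have := S.finite
  have hpae := S.exponent_ae
  have hpm := S.exponent_meas
  obtain ⟨φ, H, hφ, hH, -, hgle, hlim, hglim⟩ := hu.exists_dominated S.smooth hpae hpm
  obtain ⟨V, H', hV, hVpos, hH', -, hgle', hlim', hglim'⟩ :=
    S.solution.1.exists_pos_dominated S.smooth hpae hpm S.pos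
  have hs : ∀ i x, 0 < V i x + ε := fun i x => by linarith [hVpos i x]
  have hφ1 : ∀ i, ContMDiff (𝓡 n) 𝓘(ℝ, ℝ) 1 (φ i) := fun i => (hφ i).1.of_le (by simp)
  have hTd : ∀ i, ContMDiff (𝓡 n) 𝓘(ℝ, ℝ) 1 (fun z => Real.arctan (φ i z / (V i z + ε))) :=
    fun i x => contMDiffAt_arctan_div (hφ1 i x) ((hV i x).add contMDiffAt_const) (hs i x).ne'
  have hTg : ∀ i x, hGrad X (fun z => Real.arctan (φ i z / (V i z + ε))) x
      = (1 / (1 + (φ i x / (V i x + ε)) ^ 2)) • ((V i x + ε)⁻¹ • hGrad X (φ i) x +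
        φ i x • ((-((V i x + ε) ^ 2)⁻¹) • hGrad X (V i) x)) := fun i x =>
    ((hasHGradAt_of_contMDiffAt (hφ1 i x)).arctan_div
      ((hasHGradAt_of_contMDiffAt (hV i x)).add_const ε) (hs i x).ne').2
  have hproj : ∀ i, AEStronglyMeasurable (dirDeriv (X k)
      (fun z => Real.arctan (φ i z / (V i z + ε)))) (μ.restrict Ω) := fun i => by
    have h1 : Continuous (fun x => hGrad X (fun z => Real.arctan (φ i z / (V i z + ε))) x k) :=
      (EuclideanSpace.proj k).continuous.comp (continuous_hGrad S.smooth (hTd i))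
    exact h1.measurable.aestronglyMeasurable
  refine hasWeakDerivAlong_of_dominated S.volume (S.smooth k) S.isOpen
    (f := fun i z => Real.arctan (φ i z / (V i z + ε)))
    (w := fun i => dirDeriv (X k) (fun z => Real.arctan (φ i z / (V i z + ε))))
    (h := fun x => 2 + ε⁻¹ * (2 + |H x| + |H' x|))
    (fun i => (hTd i).continuous.measurable.aestronglyMeasurable) hproj (fun K _ hKΩ => ?_)
    (fun i => ?_) (fun i => ?_) ?_ ?_
    (fun i => hasWeakDerivAlong_mfderiv (S.smooth k) fun x _ => hTd i x)
  · exact ((integrable_const (2 : ℝ)).add ((((integrable_const (2 : ℝ)).add hH.abs).add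
      hH'.abs).const_mul _)).mono_measure (Measure.restrict_mono hKΩ le_rfl)
  · refine Eventually.of_forall fun x => (abs_arctan_le_two _).trans ?_
    have : 0 ≤ ε⁻¹ * (2 + |H x| + |H' x|) := by positivity
    linarith
  · filter_upwards [hgle i, hgle' i, hpae] with x h1 h2 hpx
    have hsx := hs i x
    set s := V i x + ε with hs_def
    set t := φ i x / s with ht
    have hεs : ε ≤ s := by linarith [hVpos i x]
    have hsi : s⁻¹ ≤ ε⁻¹ := inv_anti₀ hε hεs
    have ha := (le_one_add_rpow (norm_nonneg (hGrad X (φ i) x)) hpx.1.le).trans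
      (add_le_add_right (h1.trans (le_abs_self _)) 1)
    have hb := (le_one_add_rpow (norm_nonneg (hGrad X (V i) x)) hpx.1.le).trans
      (add_le_add_right (h2.trans (le_abs_self _)) 1)
    have h3 : |dirDeriv (X k) (fun z => Real.arctan (φ i z / (V i z + ε))) x|
        ≤ ‖hGrad X (fun z => Real.arctan (φ i z / (V i z + ε))) x‖ :=
      PiLp.norm_apply_le (hGrad X (fun z => Real.arctan (φ i z / (V i z + ε))) x) k
    refine h3.trans ?_
    rw [hTg i x, ← hs_def, ← ht]
    -- One factor φ/s is absorbed into t, so the coefficient of ∇V becomes (t/(1+t²))/s, bounded by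
    -- 1/ε regardless of φ.
    have e1 : (1 / (1 + t ^ 2)) • (s⁻¹ • hGrad X (φ i) x +
        φ i x • ((-(s ^ 2)⁻¹) • hGrad X (V i) x))
        = (1 / (1 + t ^ 2) * s⁻¹) • hGrad X (φ i) x
          - (t / (1 + t ^ 2) * s⁻¹) • hGrad X (V i) x := by
      rw [smul_add, smul_smul, smul_smul, smul_smul, sub_eq_add_neg, ← neg_smul]
      congr 2
      rw [ht]
      field_simp
    rw [e1]
    have e2 : ‖(1 / (1 + t ^ 2) * s⁻¹) • hGrad X (φ i) x‖ ≤ ε⁻¹ * ‖hGrad X (φ i) x‖ := by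
      rw [norm_smul, Real.norm_eq_abs, abs_of_nonneg (by positivity)]
      gcongr
      have : 1 / (1 + t ^ 2) ≤ 1 := by
        rw [div_le_one (by positivity)]
        linarith [sq_nonneg t]
      calc 1 / (1 + t ^ 2) * s⁻¹ ≤ 1 * s⁻¹ := by gcongr
        _ ≤ ε⁻¹ := by rw [one_mul]; exact hsi
    have e3 : ‖(t / (1 + t ^ 2) * s⁻¹) • hGrad X (V i) x‖ ≤ ε⁻¹ * ‖hGrad X (V i) x‖ := by
      rw [norm_smul, Real.norm_eq_abs, abs_mul, abs_of_nonneg (inv_nonneg.2 hsx.le)]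
      gcongr
      calc |t / (1 + t ^ 2)| * s⁻¹ ≤ 1 * s⁻¹ := by
            gcongr
            exact abs_div_one_add_sq_le t
        _ ≤ ε⁻¹ := by rw [one_mul]; exact hsi
    have hε' : 0 < ε⁻¹ := inv_pos.2 hε
    calc _ ≤ ε⁻¹ * ‖hGrad X (φ i) x‖ + ε⁻¹ * ‖hGrad X (V i) x‖ :=
          (norm_sub_le _ _).trans (add_le_add e2 e3)
      _ ≤ ε⁻¹ * (1 + |H x|) + ε⁻¹ * (1 + |H' x|) := by
          have h5 : ‖hGrad X (φ i) x‖ ≤ 1 + |H x| := by linarith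
          have h6 : ‖hGrad X (V i) x‖ ≤ 1 + |H' x| := by linarith
          gcongr
      _ ≤ _ := by linarith
  · filter_upwards [hlim, hlim', S.pos] with x h1 h2 hx0
    have hne : v x + ε ≠ 0 := by positivity
    exact (Real.continuous_arctan.tendsto _).comp (h1.div (h2.add_const ε) hne)
  · filter_upwards [hlim, hlim', hglim, hglim', S.pos] with x h1 h2 h3 h4 hx0
    have hne : v x + ε ≠ 0 := by positivity
    have hs' := h2.add_const ε
    have h5 : Tendsto (fun i => hGrad X (fun z => Real.arctan (φ i z / (V i z + ε))) x) atTop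
        (𝓝 ((1 / (1 + (u x / (v x + ε)) ^ 2)) • ((v x + ε)⁻¹ • G x +
        u x • ((-((v x + ε) ^ 2)⁻¹) • Gv x)))) := by
      simp only [hTg]
      refine Tendsto.smul (tendsto_const_nhds.div
        (tendsto_const_nhds.add ((h1.div hs' hne).pow 2)) (by positivity)) ?_
      exact ((hs'.inv₀ hne).smul h3).add
        (h1.smul (((hs'.pow 2).inv₀ (pow_ne_zero 2 hne)).neg.smul h4))
    exact ((EuclideanSpace.proj (𝕜 := ℝ) k).continuous.tendsto _).comp h5

/-- If `∇_X u = (u/v) ∇_X v`, then the horizontal gradient of `arctan (u/v)` vanishes. -/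
theorem IsPositiveSolution.hasWeakDerivAlong_arctan_div
    (S : IsPositiveSolution μ Ω p g X P C lam v Gv) (hu : MemW0 μ Ω p X u G)
    (hG : ∀ᵐ x ∂(μ.restrict Ω), G x = (u x / v x) • Gv x) (k : Fin N) :
    HasWeakDerivAlong Ω (X k) (fun x => Real.arctan (u x / v x)) (fun _ => 0) := by
  have := S.finite
  have hum : AEMeasurable u (μ.restrict Ω) := hu.1.1.1
  have hGm : AEMeasurable G (μ.restrict Ω) := hu.1.2.1.1
  have hvm : AEMeasurable v (μ.restrict Ω) := S.solution.1.1.1.1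
  have hGvm : AEMeasurable Gv (μ.restrict Ω) := S.solution.1.1.2.1.1
  set ε : ℕ → ℝ := fun i => 1 / ((i : ℝ) + 1) with hε
  have hε0 : ∀ i, 0 < ε i := fun i => by simp only [hε]; positivity
  have hεlim : Tendsto ε atTop (𝓝 0) := tendsto_one_div_add_atTop_nhds_zero_nat
  set w : ℕ → M → EuclideanSpace ℝ (Fin N) := fun i x =>
    (1 / (1 + (u x / (v x + ε i)) ^ 2)) • ((v x + ε i)⁻¹ • G x +
        u x • ((-((v x + ε i) ^ 2)⁻¹) • Gv x)) with hw
  have hwm : ∀ i, AEMeasurable (w i) (μ.restrict Ω) := fun i =>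
    (aemeasurable_const.div (aemeasurable_const.add
      ((hum.div (hvm.add_const _)).pow_const 2))).smul
      (((hvm.add_const _).inv.smul hGm).add
        (hum.smul (((hvm.add_const _).pow_const 2).inv.neg.smul hGvm)))
  have hwk : ∀ i, AEMeasurable (fun x => w i x k) (μ.restrict Ω) := fun i =>
    (EuclideanSpace.proj (𝕜 := ℝ) k).continuous.measurable.comp_aemeasurable (hwm i)
  -- Inserting G = (u/v)∇v makes the two terms nearly cancel. The remaining factor ε/(v+ε) is at
  -- most 1 and tends to 0, so |∇v|/v is a majorant and the limit is 0.
  have hweq : ∀ i, ∀ᵐ x ∂(μ.restrict Ω), w i x =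
      ((u x / (v x + ε i)) / (1 + (u x / (v x + ε i)) ^ 2) * (ε i / (v x + ε i))) •
        ((v x)⁻¹ • Gv x) := fun i => by
    filter_upwards [hG, S.pos] with x hx hx0
    have hs : 0 < v x + ε i := by linarith [hε0 i]
    have hd : 0 < 1 + (u x / (v x + ε i)) ^ 2 := by positivity
    simp only [hw]
    rw [hx, smul_smul, smul_smul, smul_smul, ← add_smul, smul_smul]
    congr 1
    generalize 1 + (u x / (v x + ε i)) ^ 2 = d at hd
    have hv' := hx0.ne'
    have hs' := hs.ne'
    field_simp
    ring
  refine hasWeakDerivAlong_of_dominated S.volume (S.smooth k) S.isOpen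
    (f := fun i x => Real.arctan (u x / (v x + ε i))) (w := fun i x => w i x k)
    (h := fun x => 2 + |‖Gv x‖ / v x|) (fun i => ?_) (fun i => (hwk i).aestronglyMeasurable)
    (fun K hK hKΩ => ?_) (fun i => ?_) (fun i => ?_) ?_ ?_
    (fun i => S.hasWeakDerivAlong_arctan_div_add hu (hε0 i) k)
  · exact (Real.measurable_arctan.comp_aemeasurable
      (hum.div (hvm.add_const _))).aestronglyMeasurable
  · exact ((integrable_const (2 : ℝ)).mono_measure (Measure.restrict_mono hKΩ le_rfl)).add
      (S.integrableOn_norm_div hK hKΩ).abs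
  · exact Eventually.of_forall fun x => (abs_arctan_le_two _).trans
      (le_add_of_nonneg_right (abs_nonneg _))
  · filter_upwards [hweq i, S.pos] with x hx hx0
    have hs : 0 < v x + ε i := by linarith [hε0 i]
    have h1 : |w i x k| ≤ ‖w i x‖ := PiLp.norm_apply_le (w i x) k
    refine h1.trans ?_
    rw [hx, norm_smul, norm_smul, Real.norm_eq_abs, Real.norm_eq_abs, abs_mul,
      abs_of_pos (inv_pos.2 hx0), abs_of_pos (div_pos (hε0 i) hs)]
    have h2 := abs_div_one_add_sq_le (u x / (v x + ε i))
    have h3 : ε i / (v x + ε i) ≤ 1 := (div_le_one hs).2 (by linarith)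
    have h4 : (v x)⁻¹ * ‖Gv x‖ = ‖Gv x‖ / v x := by rw [div_eq_inv_mul]
    rw [h4]
    calc |u x / (v x + ε i) / (1 + (u x / (v x + ε i)) ^ 2)| * (ε i / (v x + ε i)) *
          (‖Gv x‖ / v x) ≤ 1 * 1 * (‖Gv x‖ / v x) := by
          have : 0 ≤ ε i / (v x + ε i) := (div_pos (hε0 i) hs).le
          gcongr
      _ ≤ 2 + |‖Gv x‖ / v x| := by linarith [le_abs_self (‖Gv x‖ / v x)]
  · filter_upwards [S.pos] with x hx0
    have h1 : Tendsto (fun i => v x + ε i) atTop (𝓝 (v x)) := by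
      simpa using hεlim.const_add (v x)
    exact (Real.continuous_arctan.tendsto _).comp (tendsto_const_nhds.div h1 hx0.ne')
  · filter_upwards [ae_all_iff.2 hweq, S.pos] with x hx hx0
    have h1 : Tendsto (fun i => v x + ε i) atTop (𝓝 (v x)) := by
      simpa using hεlim.const_add (v x)
    have h2 : Tendsto (fun i => u x / (v x + ε i)) atTop (𝓝 (u x / v x)) :=
      tendsto_const_nhds.div h1 hx0.ne'
    have h3 : Tendsto (fun i => w i x) atTop (𝓝 0) := by
      simp only [hx]
      have h4 := (((h2.div ((h2.pow 2).const_add 1) (by positivity)).mul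
        (hεlim.div h1 hx0.ne')).smul_const ((v x)⁻¹ • Gv x))
      simpa using h4
    have h5 := ((EuclideanSpace.proj (𝕜 := ℝ) k).continuous.tendsto _).comp h3
    simpa [Function.comp_def] using h5

omit [T2Space M] [SecondCountableTopology M] in
theorem IsPositiveSolution.aemeasurable_picone
    (S : IsPositiveSolution μ Ω p g X P C lam v Gv) (hu : MemW0 μ Ω p X u G) :
    AEMeasurable (fun x => picone (p x) (|u x| ^ (p x - 1) * (u x / |u x|)) |u x| (v x)
      (Gv x) (G x)) (μ.restrict Ω) := by
  have hpm := S.exponent_meas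
  have hum : AEMeasurable u (μ.restrict Ω) := hu.1.1.1
  have hGm : AEMeasurable G (μ.restrict Ω) := hu.1.2.1.1
  have hvm : AEMeasurable v (μ.restrict Ω) := S.solution.1.1.1.1
  have hGvm : AEMeasurable Gv (μ.restrict Ω) := S.solution.1.1.2.1.1
  have hua : AEMeasurable (fun x => |u x|) (μ.restrict Ω) := hum.norm
  unfold picone
  exact ((hGm.norm.pow hpm).sub (((hpm.mul ((hua.pow (hpm.sub_const 1)).mul
    (hum.div hua))).mul (hvm.pow (hpm.const_sub 1))).mul
    ((hGvm.norm.pow (hpm.sub_const 2)).mul (hGvm.inner hGm)))).add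
    ((((hpm.sub_const 1).mul (hua.pow hpm)).mul (hvm.pow hpm.neg)).mul (hGvm.norm.pow hpm))

omit [T2Space M] [SecondCountableTopology M] in
/-- Testing the equation with the solution itself. -/
theorem IsPositiveSolution.integral_eq_of_isWeakSolution
    (S : IsPositiveSolution μ Ω p g X P C lam v Gv) {κ : ℝ}
    (hu : IsWeakSolution μ Ω p g X κ u G) :
    ∫ x in Ω, ‖G x‖ ^ p x ∂μ = κ * ∫ x in Ω, g x * |u x| ^ p x ∂μ := by
  have h1 := hu.2 u G hu.1
  have h2 : ∫ x in Ω, ‖G x‖ ^ (p x - 2) * inner ℝ (G x) (G x) ∂μ = ∫ x in Ω, ‖G x‖ ^ p x ∂μ := by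
    refine integral_congr_ae ?_
    filter_upwards [S.exponent_ae] with x hx
    exact norm_rpow_sub_two_mul_inner_self hx.1 (G x)
  have h3 : ∫ x in Ω, g x * |u x| ^ (p x - 2) * u x * u x ∂μ
      = ∫ x in Ω, g x * |u x| ^ p x ∂μ := by
    refine integral_congr_ae ?_
    filter_upwards [S.exponent_ae] with x hx
    have h4 := norm_rpow_sub_two_mul_inner_self hx.1 (u x)
    rw [real_inner_self_eq_norm_sq, Real.norm_eq_abs, sq_abs] at h4
    rw [← h4]
    ring
  rw [h2, h3] at h1
  linarith

/-- Tested with itself, u has Rayleigh quotient λ, so the nonnegative Picone function has zero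
integral and the equality case applies a.e. -/
theorem IsPositiveSolution.gradient_eq_smul (S : IsPositiveSolution μ Ω p g X P C lam v Gv)
    (hu : IsWeakSolution μ Ω p g X lam u G) :
    ∀ᵐ x ∂(μ.restrict Ω), G x = (u x / v x) • Gv x := by
  have h1 := (S.lintegral_picone_le hu.1).2
  rw [S.integral_eq_of_isWeakSolution hu, sub_self, ENNReal.ofReal_zero, nonpos_iff_eq_zero,
    lintegral_eq_zero_iff' (S.aemeasurable_picone hu.1).ennreal_ofReal] at h1
  filter_upwards [h1, S.pos, S.exponent_ae] with x hx hx0 hpx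
  have h2 := picone_nonneg hpx.1 (abs_nonneg (u x)) hx0
    (abs_rpow_mul_div_abs_le (u x) (p x - 1)) (Gv x) (G x)
  exact eq_smul_of_picone_eq_zero hpx.1 hx0 (le_antisymm (ENNReal.ofReal_eq_zero.1 hx) h2)

omit [T2Space M] [SecondCountableTopology M] in
theorem IsPositiveSolution.integral_weight_pos
    (S : IsPositiveSolution μ Ω p g X P C lam v Gv) (hu : MemLpVar μ Ω p u)
    (hu0 : ¬ (u =ᵐ[μ.restrict Ω] 0)) : 0 < ∫ x in Ω, g x * |u x| ^ p x ∂μ := by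
  have hΩ := ae_restrict_mem (μ := μ) S.isOpen.measurableSet
  have h0 : 0 ≤ᵐ[μ.restrict Ω] fun x => g x * |u x| ^ p x := by
    filter_upwards [hΩ] with x hx
    exact mul_nonneg (S.weight x hx).1.le (by positivity)
  refine lt_of_le_of_ne (integral_nonneg_of_ae h0) fun h => hu0 ?_
  have h1 := (integral_eq_zero_iff_of_nonneg_ae h0 (S.integrable_weight_mul hu)).1 h.symm
  filter_upwards [h1, hΩ] with x hx hxΩ
  have h2 : |u x| ^ p x = 0 := (mul_eq_zero.1 hx).resolve_left (S.weight x hxΩ).1.ne'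
  have h3 := (Real.rpow_eq_zero (abs_nonneg _) (by linarith [(S.exponent x hxΩ).1])).1 h2
  exact abs_eq_zero.1 h3

end Quotient

end SubLaplace

namespace SubLaplace

variable {n : ℕ}

/-! ### Formal adjoints and brackets -/

section Divergence

/-- The divergence `∑ⱼ ∂ⱼ (aⱼ φ)` of the vector field `φ a`. -/
noncomputable def divMul (a : EuclideanSpace ℝ (Fin n) → EuclideanSpace ℝ (Fin n))
    (φ : EuclideanSpace ℝ (Fin n) → ℝ) (y : EuclideanSpace ℝ (Fin n)) : ℝ :=
  ∑ j : Fin n, fderiv ℝ (fun z => a z j * φ z) y (EuclideanSpace.single j 1)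

variable {a b : EuclideanSpace ℝ (Fin n) → EuclideanSpace ℝ (Fin n)}
  {φ ψ : EuclideanSpace ℝ (Fin n) → ℝ} {U : Set (EuclideanSpace ℝ (Fin n))}
  {y : EuclideanSpace ℝ (Fin n)}

theorem divMul_congr (h : ∀ᶠ z in 𝓝 y, ∀ j, a z j * φ z = b z j * ψ z) :
    divMul a φ y = divMul b ψ y :=
  Finset.sum_congr rfl fun j _ => by
    rw [Filter.EventuallyEq.fderiv_eq (h.mono fun z hz => hz j)]

theorem contDiff_divMul (hU : IsOpen U) (ha : ContDiffOn ℝ ∞ a U) (hφ : ContDiff ℝ ∞ φ)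
    (hs : tsupport φ ⊆ U) : ContDiff ℝ ∞ (divMul a φ) := by
  refine ContDiff.sum fun j _ => ?_
  exact ((contDiff_mul_of_tsupport_subset hU ((contDiffOn_piLp 2).1 ha j) hφ hs).fderiv_right
    (m := ∞) (by simp)).clm_apply contDiff_const

theorem tsupport_divMul_subset : tsupport (divMul a φ) ⊆ tsupport φ := by
  refine closure_minimal (fun y hy => ?_) (isClosed_tsupport _)
  by_contra hn
  apply hy
  have h1 : divMul a φ y = divMul a (fun _ => 0) y := by
    refine divMul_congr ?_
    filter_upwards [notMem_tsupport_iff_eventuallyEq.1 hn] with z hz j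
    simp [hz]
  rw [h1]
  simp [divMul]

/-- The formal adjoints form a representation of the Lie algebra of vector fields. -/
theorem divMul_lieBracket (hU : IsOpen U) (ha : ContDiffOn ℝ ∞ a U) (hb : ContDiffOn ℝ ∞ b U)
    (hφ : ContDiffOn ℝ ∞ φ U) (hy : y ∈ U) :
    divMul (VectorField.lieBracket ℝ a b) φ y
      = divMul a (divMul b φ) y - divMul b (divMul a φ) y := by
  have haj : ∀ j, ContDiffOn ℝ ∞ (fun z => a z j) U := fun j => (contDiffOn_piLp 2).1 ha j
  have hbj : ∀ j, ContDiffOn ℝ ∞ (fun z => b z j) U := fun j => (contDiffOn_piLp 2).1 hb j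
  have hdiff : ∀ {f : EuclideanSpace ℝ (Fin n) → ℝ}, ContDiffOn ℝ ∞ f U → ∀ z ∈ U,
      DifferentiableAt ℝ f z := fun hf z hz =>
    ((hf z hz).contDiffAt (hU.mem_nhds hz)).differentiableAt (by simp)
  have hfd : ∀ {f : EuclideanSpace ℝ (Fin n) → ℝ}, ContDiffOn ℝ ∞ f U → ∀ w,
      ContDiffOn ℝ ∞ (fun z => fderiv ℝ f z w) U := fun hf w =>
    (hf.fderiv_of_isOpen hU (by simp)).clm_apply contDiffOn_const
  -- The rule aᵢ ∂ⱼ(bⱼφ) = ∂ⱼ(aᵢbⱼφ) - (∂ⱼaᵢ)bⱼφ separates a pure second-order part from a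
  -- first-order remainder.
  have key : ∀ a b : EuclideanSpace ℝ (Fin n) → EuclideanSpace ℝ (Fin n),
      (∀ j, ContDiffOn ℝ ∞ (fun z => a z j) U) → (∀ j, ContDiffOn ℝ ∞ (fun z => b z j) U) →
      divMul a (divMul b φ) y = ∑ i, ∑ j,
        (fderiv ℝ (fun z => fderiv ℝ (fun z => a z i * b z j * φ z) z
          (EuclideanSpace.single j 1)) y (EuclideanSpace.single i 1)
        - fderiv ℝ (fun z => fderiv ℝ (fun z => a z i) z (EuclideanSpace.single j 1)
          * b z j * φ z) y (EuclideanSpace.single i 1)) := by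
    intro a b haj hbj
    refine Finset.sum_congr rfl fun i _ => ?_
    have h1 : (fun z => a z i * divMul b φ z) =ᶠ[𝓝 y] fun z => ∑ j,
        (fderiv ℝ (fun z => a z i * b z j * φ z) z (EuclideanSpace.single j 1)
        - fderiv ℝ (fun z => a z i) z (EuclideanSpace.single j 1) * b z j * φ z) := by
      filter_upwards [hU.mem_nhds hy] with z hz
      rw [divMul, Finset.mul_sum]
      refine Finset.sum_congr rfl fun j _ => ?_
      have h2 : (fun z => a z i * b z j * φ z) = fun z => a z i * (b z j * φ z) := by
        funext z
        ring
      rw [h2, fderiv_fun_mul (hdiff (haj i) z hz) (hdiff ((hbj j).mul hφ) z hz)]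
      simp only [add_apply, smul_apply, smul_eq_mul]
      ring
    rw [h1.fderiv_eq, fderiv_fun_sum fun j _ => ?_, sum_apply]
    · refine Finset.sum_congr rfl fun j _ => ?_
      rw [fderiv_fun_sub]
      · rfl
      · exact hdiff (hfd (((haj i).mul (hbj j)).mul hφ) _) y hy
      · exact hdiff (((hfd (haj i) _).mul (hbj j)).mul hφ) y hy
    · exact (hdiff (hfd (((haj i).mul (hbj j)).mul hφ) _) y hy).sub
        (hdiff (((hfd (haj i) _).mul (hbj j)).mul hφ) y hy)
  -- The second-order parts of the two compositions agree by symmetry of second derivatives, so the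
  -- commutator keeps only the remainders, which are the divergence for the bracket.
  have hsymm : ∀ i j,
      fderiv ℝ (fun z => fderiv ℝ (fun z => a z i * b z j * φ z) z
          (EuclideanSpace.single j 1)) y (EuclideanSpace.single i 1)
      = fderiv ℝ (fun z => fderiv ℝ (fun z => b z j * a z i * φ z) z
          (EuclideanSpace.single i 1)) y (EuclideanSpace.single j 1) := by
    intro i j
    have h0 : (fun z => b z j * a z i * φ z) = fun z => a z i * b z j * φ z := by
      funext z
      ring
    rw [h0]
    have hF : ContDiffAt ℝ ∞ (fun z => a z i * b z j * φ z) y :=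
      ((((haj i).mul (hbj j)).mul hφ) y hy).contDiffAt (hU.mem_nhds hy)
    have hd : DifferentiableAt ℝ (fderiv ℝ (fun z => a z i * b z j * φ z)) y :=
      (hF.fderiv_right (m := ∞) (by simp)).differentiableAt (by simp)
    rw [fderiv_clm_apply hd (differentiableAt_const _),
      fderiv_clm_apply hd (differentiableAt_const _)]
    simp only [fderiv_fun_const, Pi.zero_apply, ContinuousLinearMap.comp_zero, zero_add,
      ContinuousLinearMap.flip_apply]
    exact (hF.isSymmSndFDerivAt (by
      rw [minSmoothness_of_isRCLikeNormedField]
      exact WithTop.coe_le_coe.2 (le_top : (2 : ℕ∞) ≤ ⊤))) _ _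
  rw [key a b haj hbj, key b a hbj haj, Finset.sum_comm (f := fun i j =>
    fderiv ℝ (fun z => fderiv ℝ (fun z => b z i * a z j * φ z) z
          (EuclideanSpace.single j 1)) y (EuclideanSpace.single i 1)
        - fderiv ℝ (fun z => fderiv ℝ (fun z => b z i) z (EuclideanSpace.single j 1)
          * a z j * φ z) y (EuclideanSpace.single i 1))]
  simp only [Finset.sum_sub_distrib]
  have h3 : (∑ i, ∑ j, fderiv ℝ (fun z => fderiv ℝ (fun z => b z j * a z i * φ z) z
          (EuclideanSpace.single i 1)) y (EuclideanSpace.single j 1))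
      = ∑ i, ∑ j, fderiv ℝ (fun z => fderiv ℝ (fun z => a z i * b z j * φ z) z
          (EuclideanSpace.single j 1)) y (EuclideanSpace.single i 1) :=
    Finset.sum_congr rfl fun i _ => Finset.sum_congr rfl fun j _ => (hsymm i j).symm
  rw [h3, sub_sub_sub_cancel_left, Finset.sum_comm, ← Finset.sum_sub_distrib]
  refine Finset.sum_congr rfl fun i _ => ?_
  rw [← Finset.sum_sub_distrib]
  have h4 : (fun z => VectorField.lieBracket ℝ a b z i * φ z) =ᶠ[𝓝 y] fun z => ∑ j,
      (fderiv ℝ (fun z => b z i) z (EuclideanSpace.single j 1) * a z j * φ z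
        - fderiv ℝ (fun z => a z i) z (EuclideanSpace.single j 1) * b z j * φ z) := by
    filter_upwards [hU.mem_nhds hy] with z hz
    have hcoord : ∀ {c : EuclideanSpace ℝ (Fin n) → EuclideanSpace ℝ (Fin n)},
        ContDiffOn ℝ ∞ c U → ∀ w : EuclideanSpace ℝ (Fin n), (fderiv ℝ c z w) i
          = ∑ j, fderiv ℝ (fun z => c z i) z (EuclideanSpace.single j 1) * w j := by
      intro c hc w
      have hcd : DifferentiableAt ℝ c z :=
        ((hc z hz).contDiffAt (hU.mem_nhds hz)).differentiableAt (by simp)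
      have h5 : fderiv ℝ (fun z => c z i) z = (EuclideanSpace.proj i).comp (fderiv ℝ c z) :=
        ((EuclideanSpace.proj (𝕜 := ℝ) i).hasFDerivAt.comp z hcd.hasFDerivAt).fderiv
      have h6 : w = ∑ j, w j • EuclideanSpace.single j (1 : ℝ) := by
        ext k
        simp [Finset.sum_apply, Pi.single_apply]
      have h7 : (fderiv ℝ c z w) i = fderiv ℝ (fun z => c z i) z w := by
        rw [h5]
        rfl
      rw [h7]
      conv_lhs => rw [h6, map_sum]
      refine Finset.sum_congr rfl fun j _ => ?_
      rw [map_smul, smul_eq_mul, mul_comm]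
    have h8 : VectorField.lieBracket ℝ a b z i
        = (fderiv ℝ b z (a z)) i - (fderiv ℝ a z (b z)) i := rfl
    rw [h8, hcoord hb, hcoord ha, ← Finset.sum_sub_distrib, Finset.sum_mul]
    exact Finset.sum_congr rfl fun j _ => by ring
  have hd1 : ∀ j, DifferentiableAt ℝ (fun z => fderiv ℝ (fun z => b z i) z
      (EuclideanSpace.single j 1) * a z j * φ z) y := fun j =>
    hdiff (((hfd (hbj i) _).mul (haj j)).mul hφ) y hy
  have hd2 : ∀ j, DifferentiableAt ℝ (fun z => fderiv ℝ (fun z => a z i) z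
      (EuclideanSpace.single j 1) * b z j * φ z) y := fun j =>
    hdiff (((hfd (haj i) _).mul (hbj j)).mul hφ) y hy
  rw [h4.fderiv_eq, fderiv_fun_sum fun j _ => (hd1 j).fun_sub (hd2 j), sum_apply]
  refine Finset.sum_congr rfl fun j _ => ?_
  rw [fderiv_fun_sub (hd1 j) (hd2 j)]
  rfl

end Divergence

/-! ### Vanishing distributional gradient -/

section LocallyConstant

open scoped Convolution

variable {E : Type*} [NormedAddCommGroup E] [InnerProductSpace ℝ E] [FiniteDimensional ℝ E]
  [MeasurableSpace E] [BorelSpace E]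

/-- A locally integrable function whose distributional derivatives vanish is locally constant. -/
theorem exists_ae_eq_const_of_integral_mul_fderiv_eq_zero {w : E → ℝ} {U : Set E}
    (hU : IsOpen U) (hw : LocallyIntegrableOn w U)
    (h : ∀ φ : E → ℝ, ContDiff ℝ ∞ φ → HasCompactSupport φ → tsupport φ ⊆ U →
      ∀ ξ, ∫ y, w y * fderiv ℝ φ y ξ = 0) {y₀ : E} (hy : y₀ ∈ U) :
    ∃ r > 0, Metric.ball y₀ r ⊆ U ∧ ∃ c, ∀ᵐ y ∂(volume.restrict (Metric.ball y₀ r)), w y = c := by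
  obtain ⟨R, hR, hRU⟩ := Metric.nhds_basis_closedBall.mem_iff.1 (hU.mem_nhds hy)
  set K := Metric.closedBall y₀ R with hK
  have hKc : IsCompact K := isCompact_closedBall _ _
  -- Truncation makes w globally integrable. At points of the ball of radius R/2, mollifiers of
  -- radius at most R/2 see only K, where f = w.
  set f : E → ℝ := K.indicator w with hf
  have hfi : Integrable f := (integrable_indicator_iff hKc.measurableSet).2
    (hw.integrableOn_compact_subset hRU hKc)
  have hfl : LocallyIntegrable f := hfi.locallyIntegrable
  set r := R / 2 with hr
  have hr0 : 0 < r := by positivity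
  let η : ℕ → ContDiffBump (0 : E) := fun i =>
    ⟨r / 2 * (1 / (i + 1)), r * (1 / (i + 1)), by positivity, by
      have : 0 < r * (1 / ((i : ℝ) + 1)) := by positivity
      linarith⟩
  have hη0 : Tendsto (fun i => (η i).rOut) atTop (𝓝 0) := by
    have h1 := (tendsto_one_div_add_atTop_nhds_zero_nat (𝕜 := ℝ)).const_mul r
    rwa [mul_zero] at h1
  have hηr : ∀ i, (η i).rOut ≤ r := fun i => by
    have h1 : 1 / ((i : ℝ) + 1) ≤ 1 := by
      rw [div_le_one (by positivity)]
      linarith [(Nat.cast_nonneg i : (0 : ℝ) ≤ i)]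
    calc r * (1 / ((i : ℝ) + 1)) ≤ r * 1 := by gcongr
      _ = r := mul_one r
  have hae := ContDiffBump.ae_convolution_tendsto_right_of_locallyIntegrable (μ := volume)
    -- The outer radius is exactly twice the inner one; a bounded ratio is what a.e. convergence of
    -- the mollifications requires.
    (K := 2) hη0 (Eventually.of_forall fun i => le_of_eq (show r * (1 / ((i : ℝ) + 1))
      = 2 * (r / 2 * (1 / (i + 1))) by ring)) hfl
  have hder : ∀ i, ∀ x ∈ Metric.ball y₀ r,
      HasFDerivAt ((η i).normed volume ⋆[ContinuousLinearMap.lsmul ℝ ℝ, volume] f)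
        (0 : E →L[ℝ] ℝ) x := by
    intro i x hx
    set ψ := (η i).normed (volume : Measure E) with hψ
    have hψs : ContDiff ℝ ∞ ψ := (η i).contDiff_normed
    have hψc : HasCompactSupport ψ := (η i).hasCompactSupport_normed
    have h1 := hψc.hasFDerivAt_convolution_left (ContinuousLinearMap.lsmul ℝ ℝ)
      (hψs.of_le (by simp)) hfl x
    set L : (E →L[ℝ] ℝ) →L[ℝ] ℝ →L[ℝ] (E →L[ℝ] ℝ) :=
      (ContinuousLinearMap.lsmul ℝ ℝ : ℝ →L[ℝ] ℝ →L[ℝ] ℝ).precompL E with hL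
    have hex := (hψc.fderiv (𝕜 := ℝ)).convolutionExists_left L
      (hψs.continuous_fderiv (by simp)) hfl x
    suffices h0 : (fderiv ℝ ψ ⋆[L, volume] f) x = 0 by rwa [← h0]
    refine ContinuousLinearMap.ext fun ξ => ?_
    have h2 : ((fderiv ℝ ψ ⋆[L, volume] f) x) ξ
        = ∫ t, f (x - t) * fderiv ℝ ψ t ξ := by
      rw [convolution_def, ContinuousLinearMap.integral_apply hex]
      refine integral_congr_ae (Eventually.of_forall fun t => ?_)
      exact mul_comm _ _
    rw [h2, ← integral_sub_left_eq_self _ volume x]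
    simp only [sub_sub_cancel, zero_apply]
    -- The derivative of the mollification at x is, up to sign, w paired with the derivative of this
    -- reflected and translated bump, an admissible test function supported in K ⊆ U.
    set φ : E → ℝ := fun t => ψ (x - t) with hφ
    have hφt : tsupport φ ⊆ K := by
      refine closure_minimal (fun t ht => ?_) Metric.isClosed_closedBall
      have h3 : x - t ∈ Function.support ψ := ht
      rw [hψ, (η i).support_normed_eq, mem_ball_zero_iff, ← dist_eq_norm] at h3
      refine Metric.mem_closedBall.2 ((dist_triangle t x y₀).trans ?_)
      rw [dist_comm t x]
      linarith [Metric.mem_ball.1 hx, hηr i]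
    have hφd : ∀ t, fderiv ℝ φ t = - fderiv ℝ ψ (x - t) := fun t => by
      have h4 : HasFDerivAt (fun t => x - t) (-ContinuousLinearMap.id ℝ E) t :=
        (hasFDerivAt_id t).const_sub x
      have h5 := ((hψs.differentiable (by simp)) (x - t)).hasFDerivAt.comp t h4
      rw [hφ, show (fun t => ψ (x - t)) = ψ ∘ fun t => x - t from rfl, h5.fderiv]
      ext ξ
      simp
    have h6 := h φ (hψs.comp (contDiff_const.sub contDiff_id))
      (hKc.of_isClosed_subset (isClosed_tsupport _) hφt) (hφt.trans hRU) ξ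
    have h7 : ∀ t, f t * fderiv ℝ ψ (x - t) ξ = - (w t * fderiv ℝ φ t ξ) := fun t => by
      by_cases ht : t ∈ K
      · rw [hφd, hf, indicator_of_mem ht]
        simp
      · have h8 : fderiv ℝ φ t = 0 :=
          image_eq_zero_of_notMem_tsupport fun hn => ht (hφt (tsupport_fderiv_subset ℝ hn))
        have h9 := hφd t
        rw [h8, eq_comm, neg_eq_zero] at h9
        simp [h8, h9]
    simp only [h7, integral_neg, h6, neg_zero]
  have hconst : ∀ i, ∀ x ∈ Metric.ball y₀ r, ∀ x' ∈ Metric.ball y₀ r,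
      ((η i).normed volume ⋆[ContinuousLinearMap.lsmul ℝ ℝ, volume] f) x
      = ((η i).normed volume ⋆[ContinuousLinearMap.lsmul ℝ ℝ, volume] f) x' :=
    fun i x hx x' hx' => Metric.isOpen_ball.is_const_of_fderiv_eq_zero (𝕜 := ℝ)
      (convex_ball y₀ r).isPreconnected
      (fun z hz => (hder i z hz).differentiableAt.differentiableWithinAt)
      (fun z hz => (hder i z hz).fderiv) hx hx'
  have hbK : Metric.ball y₀ r ⊆ K := Metric.ball_subset_closedBall.trans
    (Metric.closedBall_subset_closedBall (by linarith))
  have haer := ae_restrict_of_ae (s := Metric.ball y₀ r) hae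
  -- Each mollification is constant on the ball, so its limit at one point of convergence is its
  -- limit at all of them.
  obtain ⟨x₁, hx₁, hx₁b⟩ : ∃ x₁, Tendsto (fun i => ((η i).normed volume
      ⋆[ContinuousLinearMap.lsmul ℝ ℝ, volume] f) x₁) atTop (𝓝 (f x₁)) ∧
      x₁ ∈ Metric.ball y₀ r := by
    have hne : NeBot (ae (volume.restrict (Metric.ball y₀ r))) := by
      rw [ae_neBot, Ne, Measure.restrict_eq_zero]
      exact (Metric.measure_ball_pos volume y₀ hr0).ne'
    exact (haer.and (ae_restrict_mem measurableSet_ball)).exists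
  refine ⟨r, hr0, hbK.trans hRU, f x₁, ?_⟩
  filter_upwards [haer, ae_restrict_mem measurableSet_ball] with x hx hxb
  have h1 : w x = f x := (indicator_of_mem (hbK hxb) w).symm
  rw [h1]
  exact tendsto_nhds_unique hx (hx₁.congr fun i => hconst i _ hx₁b _ hxb)

end LocallyConstant

end SubLaplace

namespace SubLaplace

variable {n N : ℕ} {M : Type*} [TopologicalSpace M] [ChartedSpace (EuclideanSpace ℝ (Fin n)) M]

theorem LocallyIntegrableOn.integrable_mul_of_tsupport_subset {E : Type*} [NormedAddCommGroup E]
    [NormedSpace ℝ E] [MeasurableSpace E] [BorelSpace E] {τ : Measure E} {w φ : E → ℝ} {U : Set E}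
    (hw : LocallyIntegrableOn w U τ) (hφ : Continuous φ) (hφc : HasCompactSupport φ)
    (hs : tsupport φ ⊆ U) : Integrable (fun y => w y * φ y) τ := by
  have h1 : IntegrableOn (fun y => w y * φ y) (tsupport φ) τ :=
    (hw.integrableOn_compact_subset hs hφc).mul_continuousOn hφ.continuousOn hφc
  refine (integrableOn_iff_integrable_of_support_subset fun z hz => ?_).1 h1
  exact subset_tsupport _ (right_ne_zero_of_mul hz)

/-! ### Brackets preserve weak annihilation -/

section Bracket

variable [IsManifold (𝓡 n) ∞ M] {X : Fin N → VField n M} {V W : VField n M} {Ω : Set M}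
  {w : M → ℝ} {e : OpenPartialHomeomorph M (EuclideanSpace ℝ (Fin n))}

theorem IsSmoothField.mlieBracket (hV : IsSmoothField V) (hW : IsSmoothField W) :
    IsSmoothField (VectorField.mlieBracket (𝓡 n) V W) := by
  have : IsManifold (𝓡 n) (minSmoothness ℝ 2) M := by
    rw [minSmoothness_of_isRCLikeNormedField]
    exact IsManifold.of_le (n := ∞) (WithTop.coe_le_coe.2 (le_top : (2 : ℕ∞) ≤ ⊤))
  have : IsManifold (𝓡 n) ((⊤ : ℕ∞) + 1) M := IsManifold.of_le (n := ∞) (by simp)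
  exact fun x => ContMDiffAt.mlieBracket_vectorField (m := ⊤) (n := ⊤) (hV x) (hW x)
    (by rw [minSmoothness_of_isRCLikeNormedField]; simp)

/-- The Lie bracket commutes with pullback by the inverse chart. -/
theorem chartField_mlieBracket (he : e ∈ atlas (EuclideanSpace ℝ (Fin n)) M)
    (hV : IsSmoothField V) (hW : IsSmoothField W) {y : EuclideanSpace ℝ (Fin n)}
    (hy : y ∈ e.target) :
    chartField e (VectorField.mlieBracket (𝓡 n) V W) y
      = VectorField.lieBracket ℝ (chartField e V) (chartField e W) y := by
  have h2 : minSmoothness ℝ 2 ≤ ∞ := by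
    rw [minSmoothness_of_isRCLikeNormedField]
    exact WithTop.coe_le_coe.2 (le_top : (2 : ℕ∞) ≤ ⊤)
  have : IsManifold (𝓡 n) (minSmoothness ℝ 2) M := IsManifold.of_le h2
  have hev : ∀ V : VField n M, chartField e V =ᶠ[𝓝 y]
      VectorField.mpullback (𝓡 n) (𝓡 n) e.symm V := fun V => by
    filter_upwards [e.open_target.mem_nhds hy] with z hz
    exact chartField_eq_mpullback he V hz
  rw [chartField_eq_mpullback he _ hy, VectorField.mpullback_mlieBracket (n := ∞)
    ((hV _).mdifferentiableAt (by simp)) ((hW _).mdifferentiableAt (by simp))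
    (contMDiffAt_chart_symm he hy) h2]
  rw [(hev V).lieBracket_vectorField_eq (hev W), ← VectorField.mlieBracketWithin_univ,
    VectorField.mlieBracketWithin_eq_lieBracketWithin]
  exact congrFun VectorField.lieBracketWithin_univ y

omit [IsManifold (𝓡 n) ∞ M] in
theorem hasWeakDerivAlong_zero_iff : HasWeakDerivAlong Ω V w (fun _ => 0) ↔
    ∀ e ∈ atlas (EuclideanSpace ℝ (Fin n)) M, ∀ φ : EuclideanSpace ℝ (Fin n) → ℝ,
      ContDiff ℝ ∞ φ → HasCompactSupport φ → tsupport φ ⊆ e.target ∩ e.symm ⁻¹' Ω →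
        ∫ y, w (e.symm y) * divMul (chartField e V) φ y = 0 := by
  have h : ∀ (e : OpenPartialHomeomorph M (EuclideanSpace ℝ (Fin n)))
      (φ : EuclideanSpace ℝ (Fin n) → ℝ), ∫ y, w (e.symm y) * chartAdjoint e V φ y
        = - ∫ y, w (e.symm y) * divMul (chartField e V) φ y := fun e φ => by
    rw [← integral_neg]
    refine integral_congr_ae (Eventually.of_forall fun y => ?_)
    simp [chartAdjoint, divMul]
  simp only [HasWeakDerivAlong, h, zero_mul, integral_zero, zero_eq_neg]

/-- The adjoint of one field maps test functions to test functions, so the equation for the other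
field can be tested with it. By `divMul_lieBracket` the difference of the two results is the
equation for the bracket. -/
theorem HasWeakDerivAlong.mlieBracket
    (hw : ∀ e ∈ atlas (EuclideanSpace ℝ (Fin n)) M,
      LocallyIntegrableOn (fun y => w (e.symm y)) (e.target ∩ e.symm ⁻¹' Ω))
    (hV : IsSmoothField V) (hW : IsSmoothField W)
    (hVw : HasWeakDerivAlong Ω V w (fun _ => 0)) (hWw : HasWeakDerivAlong Ω W w (fun _ => 0)) :
    HasWeakDerivAlong Ω (VectorField.mlieBracket (𝓡 n) V W) w (fun _ => 0) := by
  rw [hasWeakDerivAlong_zero_iff] at hVw hWw ⊢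
  intro e he φ hφ hφc hφs
  have hst : tsupport φ ⊆ e.target := hφs.trans inter_subset_left
  have hVc := hV.contDiffOn_chartField he
  have hWc := hW.contDiffOn_chartField he
  have hdc : ∀ {a : EuclideanSpace ℝ (Fin n) → EuclideanSpace ℝ (Fin n)}
      {φ : EuclideanSpace ℝ (Fin n) → ℝ}, HasCompactSupport φ → HasCompactSupport (divMul a φ) :=
    fun h => h.of_isClosed_subset (isClosed_tsupport _) tsupport_divMul_subset
  have hsub : ∀ a : EuclideanSpace ℝ (Fin n) → EuclideanSpace ℝ (Fin n),
      tsupport (divMul a φ) ⊆ e.target ∩ e.symm ⁻¹' Ω := fun _ => tsupport_divMul_subset.trans hφs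
  have hVφ := contDiff_divMul e.open_target hVc hφ hst
  have hWφ := contDiff_divMul e.open_target hWc hφ hst
  have hI : ∀ {a b : EuclideanSpace ℝ (Fin n) → EuclideanSpace ℝ (Fin n)},
      ContDiff ℝ ∞ (divMul a (divMul b φ)) →
      Integrable (fun y => w (e.symm y) * divMul a (divMul b φ) y) := fun h =>
    LocallyIntegrableOn.integrable_mul_of_tsupport_subset (hw e he) h.continuous (hdc (hdc hφc))
      (tsupport_divMul_subset.trans (hsub _))
  have hst' : ∀ a : EuclideanSpace ℝ (Fin n) → EuclideanSpace ℝ (Fin n),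
      tsupport (divMul a φ) ⊆ e.target := fun a => (hsub a).trans inter_subset_left
  have h1 := hVw e he _ hWφ (hdc hφc) (hsub _)
  have h2 := hWw e he _ hVφ (hdc hφc) (hsub _)
  have h3 : ∀ y, w (e.symm y) * divMul (chartField e (VectorField.mlieBracket (𝓡 n) V W)) φ y
      = w (e.symm y) * divMul (chartField e V) (divMul (chartField e W) φ) y
        - w (e.symm y) * divMul (chartField e W) (divMul (chartField e V) φ) y := by
    intro y
    rw [← mul_sub]
    congr 1
    by_cases hy : y ∈ e.target
    · rw [← divMul_lieBracket e.open_target hVc hWc hφ.contDiffOn hy]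
      refine divMul_congr ?_
      filter_upwards [e.open_target.mem_nhds hy] with z hz j
      rw [chartField_mlieBracket he hV hW hz]
    · have h0 : ∀ {ψ : EuclideanSpace ℝ (Fin n) → ℝ}, tsupport ψ ⊆ e.target → ψ y = 0 :=
        fun h => image_eq_zero_of_notMem_tsupport fun hn => hy (h hn)
      rw [h0 (hst' _), h0 (tsupport_divMul_subset.trans (hst' _)),
        h0 (tsupport_divMul_subset.trans (hst' _)), sub_zero]
  simp only [h3]
  rw [integral_sub (hI (contDiff_divMul e.open_target hVc hWφ (hst' _)))
    (hI (contDiff_divMul e.open_target hWc hVφ (hst' _))), h1, h2, sub_zero]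

theorem IsIteratedBracket.hasWeakDerivAlong_zero (hX : ∀ k, IsSmoothField (X k))
    (hw : ∀ e ∈ atlas (EuclideanSpace ℝ (Fin n)) M,
      LocallyIntegrableOn (fun y => w (e.symm y)) (e.target ∩ e.symm ⁻¹' Ω))
    (hXw : ∀ k, HasWeakDerivAlong Ω (X k) w (fun _ => 0)) (hV : IsIteratedBracket X V) :
    IsSmoothField V ∧ HasWeakDerivAlong Ω V w (fun _ => 0) := by
  induction hV with
  | base k => exact ⟨hX k, hXw k⟩
  | bracket V W _ _ h1 h2 =>
    exact ⟨h1.1.mlieBracket h2.1, HasWeakDerivAlong.mlieBracket hw h1.1 h2.1 h1.2 h2.2⟩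

end Bracket

/-! ### From a smooth frame to partial derivatives -/

section Frame

variable {a : Fin n → EuclideanSpace ℝ (Fin n) → EuclideanSpace ℝ (Fin n)}
  {φ : EuclideanSpace ℝ (Fin n) → ℝ} {U : Set (EuclideanSpace ℝ (Fin n))}
  {y₀ : EuclideanSpace ℝ (Fin n)}

/-- If the weak derivatives along the members of a smooth frame vanish, then so do all weak partial
derivatives. -/
theorem integral_mul_fderiv_eq_zero_of_frame (hU : IsOpen U) (ha : ∀ k, ContDiffOn ℝ ∞ (a k) U)
    (hy₀ : y₀ ∈ U) (hli : LinearIndependent ℝ fun k => a k y₀)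
    {w : EuclideanSpace ℝ (Fin n) → ℝ} (hw : LocallyIntegrableOn w U)
    (h : ∀ k, ∀ φ : EuclideanSpace ℝ (Fin n) → ℝ, ContDiff ℝ ∞ φ → HasCompactSupport φ →
      tsupport φ ⊆ U → ∫ y, w y * divMul (a k) φ y = 0) :
    ∃ U', IsOpen U' ∧ y₀ ∈ U' ∧ U' ⊆ U ∧ ∀ φ : EuclideanSpace ℝ (Fin n) → ℝ, ContDiff ℝ ∞ φ →
      HasCompactSupport φ → tsupport φ ⊆ U' → ∀ ξ, ∫ y, w y * fderiv ℝ φ y ξ = 0 := by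
  -- `A y` sends coefficients to the combination of the frame at y. Invertibility is an open
  -- condition, so the frame persists near y₀ and its inverse varies smoothly.
  set A : EuclideanSpace ℝ (Fin n) → EuclideanSpace ℝ (Fin n) →L[ℝ] EuclideanSpace ℝ (Fin n) :=
    fun y => ∑ k, (EuclideanSpace.proj (𝕜 := ℝ) k).smulRight (a k y) with hA
  have hAv : ∀ y v, A y v = ∑ k, v k • a k y := fun y v => by
    simp [hA, sum_apply]
  have hAc : ContDiffOn ℝ ∞ A U := ContDiffOn.sum fun k _ =>
    contDiffOn_const.smulRight (ha k)
  set R : Set (EuclideanSpace ℝ (Fin n) →L[ℝ] EuclideanSpace ℝ (Fin n)) :=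
    range (fun L : EuclideanSpace ℝ (Fin n) ≃L[ℝ] EuclideanSpace ℝ (Fin n) =>
      (L : EuclideanSpace ℝ (Fin n) →L[ℝ] EuclideanSpace ℝ (Fin n))) with hR
  have hRo : IsOpen R := ContinuousLinearEquiv.isOpen
  have hA0 : A y₀ ∈ R := by
    have hinj : Function.Injective
        (A y₀ : EuclideanSpace ℝ (Fin n) →ₗ[ℝ] EuclideanSpace ℝ (Fin n)) := by
      refine (injective_iff_map_eq_zero _).2 fun v hv => ?_
      have h1 : ∑ k, v k • a k y₀ = 0 := by rw [← hAv]; exact hv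
      ext k
      exact Fintype.linearIndependent_iff.1 hli (fun k => v k) h1 k
    refine ⟨(LinearEquiv.ofInjectiveEndo _ hinj).toContinuousLinearEquiv, ?_⟩
    ext v
    rfl
  refine ⟨U ∩ A ⁻¹' R, hAc.continuousOn.isOpen_inter_preimage hU hRo, ⟨hy₀, hA0⟩,
    inter_subset_left, fun φ hφ hφc hφs ξ => ?_⟩
  set U' := U ∩ A ⁻¹' R with hU'
  have hU'o : IsOpen U' := hAc.continuousOn.isOpen_inter_preimage hU hRo
  -- The coefficients of the constant vector ξ in the frame.
  set c : Fin n → EuclideanSpace ℝ (Fin n) → ℝ := fun k y => (A y).inverse ξ k with hc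
  have hcs : ∀ k, ContDiffOn ℝ ∞ (c k) U' := fun k => by
    have h1 : ContDiffOn ℝ ∞ (fun y => (A y).inverse) U' := fun y hy => by
      obtain ⟨L, hL⟩ := hy.2
      have h2 : ContDiffAt ℝ ∞ ContinuousLinearMap.inverse (A y) := by
        rw [← hL]
        exact contDiffAt_map_inverse L
      exact h2.comp_contDiffWithinAt y ((hAc y hy.1).mono inter_subset_left)
    exact (contDiffOn_piLp 2).1 (h1.clm_apply contDiffOn_const) k
  have hsum : ∀ y ∈ U', ∀ j, ∑ k, c k y * a k y j = ξ j := by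
    intro y hy j
    obtain ⟨L, hL⟩ := hy.2
    have h1 : A y ((A y).inverse ξ) = ξ := by
      rw [← hL]
      simp
    have h2 := congrArg (fun v => v j) ((hAv y _).symm.trans h1)
    simpa using h2
  have hcφ : ∀ k, ContDiff ℝ ∞ (fun z => c k z * φ z) := fun k =>
    contDiff_mul_of_tsupport_subset hU'o (hcs k) hφ hφs
  have hcc : ∀ k, HasCompactSupport (fun z => c k z * φ z) := fun k => hφc.mul_left
  have hct : ∀ k, tsupport (fun z => c k z * φ z) ⊆ U := fun k =>
    (tsupport_mul_subset_right'.trans hφs).trans inter_subset_left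
  -- Since Σ cₖaₖ = ξ is constant on the support of φ, the divergence of φ Σ cₖaₖ is just the
  -- derivative of φ along ξ.
  have key : ∀ y, fderiv ℝ φ y ξ = ∑ k, divMul (a k) (fun z => c k z * φ z) y := by
    intro y
    by_cases hy : y ∈ U
    swap
    · have h0 : fderiv ℝ φ y = 0 := image_eq_zero_of_notMem_tsupport fun hn =>
        hy (hφs (tsupport_fderiv_subset ℝ hn)).1
      have h1 : ∀ k, divMul (a k) (fun z => c k z * φ z) y = 0 := fun k =>
        image_eq_zero_of_notMem_tsupport fun hn => hy (hct k (tsupport_divMul_subset hn))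
      simp [h0, h1]
    have hd : ∀ k j, DifferentiableAt ℝ (fun z => a k z j * (c k z * φ z)) y := fun k j =>
      (((contDiffOn_piLp 2).1 (ha k) j).contDiffAt (hU.mem_nhds hy)).differentiableAt
        (by simp) |>.mul ((hcφ k).differentiable (by simp) y)
    unfold divMul
    rw [Finset.sum_comm]
    have h1 : ∀ j, ∑ k, fderiv ℝ (fun z => a k z j * (c k z * φ z)) y (EuclideanSpace.single j 1)
        = ξ j * fderiv ℝ φ y (EuclideanSpace.single j 1) := by
      intro j
      have h2 : (fun z => ∑ k, a k z j * (c k z * φ z)) = fun z => ξ j * φ z := by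
        funext z
        by_cases hz : z ∈ tsupport φ
        · rw [← hsum z (hφs hz) j, Finset.sum_mul]
          exact Finset.sum_congr rfl fun k _ => by ring
        · simp [image_eq_zero_of_notMem_tsupport hz]
      rw [← sum_apply, ← fderiv_fun_sum fun k _ => hd k j, h2,
        fderiv_const_mul (hφ.differentiable (by simp) y)]
      rfl
    have h6 : ξ = ∑ j, ξ j • EuclideanSpace.single j (1 : ℝ) := by
      ext k
      simp [Finset.sum_apply, Pi.single_apply]
    conv_lhs => rw [h6, map_sum]
    refine Finset.sum_congr rfl fun j _ => ?_
    rw [h1, map_smul, smul_eq_mul]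
  simp only [key, Finset.mul_sum]
  rw [integral_finsetSum]
  · exact Finset.sum_eq_zero fun k _ => h k _ (hcφ k) (hcc k) (hct k)
  · intro k _
    exact LocallyIntegrableOn.integrable_mul_of_tsupport_subset hw
      (contDiff_divMul hU (ha k) (hcφ k) (hct k)).continuous
      ((hcc k).of_isClosed_subset (isClosed_tsupport _) tsupport_divMul_subset)
      (tsupport_divMul_subset.trans (hct k))

end Frame

end SubLaplace

namespace SubLaplace

variable {n N : ℕ} {M : Type*} [TopologicalSpace M] [ChartedSpace (EuclideanSpace ℝ (Fin n)) M]

/-! ### Hörmander's condition and constancy -/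

section Hormander

/-- Overlapping neighbourhoods meet in a set of positive measure, so their constants agree.
Connectedness makes the constant global, and second countability glues the local null sets. -/
theorem exists_ae_eq_const_of_locally [SecondCountableTopology M] [MeasurableSpace M]
    [BorelSpace M] {μ : Measure M} [μ.IsOpenPosMeasure] {Ω : Set M} (hΩ : IsOpen Ω)
    (hconn : IsConnected Ω) {w : M → ℝ}
    (h : ∀ x ∈ Ω, ∃ U, IsOpen U ∧ x ∈ U ∧ ∃ c, ∀ᵐ z ∂(μ.restrict U), w z = c) :
    ∃ c, ∀ᵐ z ∂(μ.restrict Ω), w z = c := by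
  choose! U hUo hxU c hc using h
  have hloc : ∀ x ∈ Ω, ∀ y ∈ Ω, y ∈ U x → c x = c y := by
    intro x hx y hy hyx
    have hpos : μ (U x ∩ U y) ≠ 0 :=
      ((hUo x hx).inter (hUo y hy)).measure_ne_zero μ ⟨y, hyx, hxU y hy⟩
    have hne : NeBot (ae (μ.restrict (U x ∩ U y))) := by
      rwa [ae_neBot, Ne, Measure.restrict_eq_zero]
    obtain ⟨z, hz1, hz2⟩ := ((ae_restrict_of_ae_restrict_of_subset inter_subset_left
      (hc x hx)).and (ae_restrict_of_ae_restrict_of_subset inter_subset_right (hc y hy))).exists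
    exact hz1.symm.trans hz2
  obtain ⟨x₀, hx₀⟩ := hconn.nonempty
  have hall : ∀ x ∈ Ω, c x = c x₀ := fun x hx =>
    hconn.isPreconnected.induction₂ (fun x y => c x = c y)
      (fun x hx => by
        filter_upwards [mem_nhdsWithin_of_mem_nhds ((hUo x hx).mem_nhds (hxU x hx)),
          self_mem_nhdsWithin] with y hy hyΩ
        exact hloc x hx y hyΩ hy)
      (fun _ _ _ _ _ _ h1 h2 => h1.trans h2) (fun _ _ _ _ h1 => h1.symm) hx hx₀
  refine ⟨c x₀, ?_⟩
  rw [ae_restrict_iff' hΩ.measurableSet, ae_iff]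
  refine measure_null_of_locally_null _ fun x hx => ?_
  have hxΩ : x ∈ Ω := by
    by_contra hn
    exact hx fun h => absurd h hn
  refine ⟨_, inter_mem_nhdsWithin _ ((hUo x hxΩ).mem_nhds (hxU x hxΩ)), ?_⟩
  have h1 := hc x hxΩ
  rw [ae_restrict_iff' (hUo x hxΩ).measurableSet, hall x hxΩ, ae_iff] at h1
  refine measure_mono_null (fun z hz => ?_) h1
  exact fun h2 => hz.1 fun _ => h2 hz.2

variable [IsManifold (𝓡 n) ∞ M] {X : Fin N → VField n M} {Ω : Set M}

/-- The derivative of the chart is onto, so the images of the iterated brackets span ℝⁿ, and n of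
them form a basis. -/
theorem HormanderOn.exists_linearIndependent (hH : HormanderOn X Ω)
    {e : OpenPartialHomeomorph M (EuclideanSpace ℝ (Fin n))}
    (he : e ∈ atlas (EuclideanSpace ℝ (Fin n)) M) {y : EuclideanSpace ℝ (Fin n)}
    (hy : y ∈ e.target) (hyΩ : e.symm y ∈ Ω) :
    ∃ V : Fin n → VField n M, (∀ k, IsIteratedBracket X (V k)) ∧
      LinearIndependent ℝ fun k => chartField e (V k) y := by
  set L : EuclideanSpace ℝ (Fin n) →L[ℝ] EuclideanSpace ℝ (Fin n) :=
    mfderiv (𝓡 n) (𝓡 n) e (e.symm y) with hL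
  have hsurj : Function.Surjective L :=
    (chart_mdifferentiable he).mfderiv_surjective (e.map_target hy)
  set s : Set (EuclideanSpace ℝ (Fin n)) :=
    {w | ∃ V : VField n M, IsIteratedBracket X V ∧ w = V (e.symm y)} with hs
  have hspan : Submodule.span ℝ s = ⊤ := hH _ hyΩ
  have hspan' : Submodule.span ℝ (L '' s) = ⊤ := by
    have h1 := Submodule.map_span (L : EuclideanSpace ℝ (Fin n) →ₗ[ℝ] EuclideanSpace ℝ (Fin n)) s
    rw [hspan, Submodule.map_top, LinearMap.range_eq_top.2 hsurj] at h1
    exact h1.symm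
  obtain ⟨f, hf, -, hli⟩ := Submodule.exists_fun_fin_finrank_span_eq ℝ (L '' s)
  have hn : n = Module.finrank ℝ (Submodule.span ℝ (L '' s)) := by
    rw [hspan', finrank_top, finrank_euclideanSpace_fin]
  have hf' : ∀ k : Fin n, ∃ V : VField n M, IsIteratedBracket X V ∧
      chartField e V y = f (Fin.cast hn k) := fun k => by
    obtain ⟨w, ⟨V, hV, rfl⟩, hw⟩ := hf (Fin.cast hn k)
    exact ⟨V, hV, hw⟩
  choose V hV hVf using hf'
  refine ⟨V, hV, ?_⟩
  simp only [hVf]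
  exact hli.comp _ (Fin.cast_injective hn)

/-- Under Hörmander's condition a function whose horizontal gradient vanishes is constant. -/
theorem HormanderOn.exists_ae_eq_const [SecondCountableTopology M] [T2Space M] [MeasurableSpace M]
    [BorelSpace M]
    {μ : Measure M} (hμ : IsSmoothVolume n μ) (hX : ∀ k, IsSmoothField (X k))
    (hH : HormanderOn X Ω) (hΩ : IsOpen Ω) (hconn : IsConnected Ω) {w : M → ℝ}
    (hw : ∀ K, IsCompact K → K ⊆ Ω → IntegrableOn w K μ)
    (hXw : ∀ k, HasWeakDerivAlong Ω (X k) w (fun _ => 0)) :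
    ∃ c, ∀ᵐ z ∂(μ.restrict Ω), w z = c := by
  have := hμ.isOpenPosMeasure
  have hopen : ∀ e : OpenPartialHomeomorph M (EuclideanSpace ℝ (Fin n)),
      IsOpen (e.target ∩ e.symm ⁻¹' Ω) := fun e =>
    e.continuousOn_symm.isOpen_inter_preimage e.open_target hΩ
  have hwl : ∀ e ∈ atlas (EuclideanSpace ℝ (Fin n)) M,
      LocallyIntegrableOn (fun y => w (e.symm y)) (e.target ∩ e.symm ⁻¹' Ω) := fun e he => by
    refine (locallyIntegrableOn_iff (hopen e).isLocallyClosed).2 fun K hK hKc => ?_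
    have hKt : K ⊆ e.target := hK.trans inter_subset_left
    refine hμ.integrableOn_chart he hKc hKt (hw _
      (hKc.image_of_continuousOn (e.continuousOn_symm.mono hKt)) ?_)
    rintro _ ⟨y, hy, rfl⟩
    exact (hK hy).2
  refine exists_ae_eq_const_of_locally hΩ hconn fun x hx => ?_
  set e := chartAt (EuclideanSpace ℝ (Fin n)) x with he_def
  have he : e ∈ atlas (EuclideanSpace ℝ (Fin n)) M := chart_mem_atlas _ x
  have hxs : x ∈ e.source := mem_chart_source _ x
  have hyt : e x ∈ e.target := e.map_source hxs
  have hyU : e x ∈ e.target ∩ e.symm ⁻¹' Ω := ⟨hyt, by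
    rw [mem_preimage, e.left_inv hxs]
    exact hx⟩
  obtain ⟨V, hV, hli⟩ := hH.exists_linearIndependent he hyt hyU.2
  have hVs := fun k => (hV k).hasWeakDerivAlong_zero hX hwl hXw
  obtain ⟨U', hU'o, hyU', hU'U, hU'⟩ := integral_mul_fderiv_eq_zero_of_frame (hopen e)
    (fun k => ((hVs k).1.contDiffOn_chartField he).mono inter_subset_left) hyU hli (hwl e he)
    (fun k φ hφ hφc hφs => hasWeakDerivAlong_zero_iff.1 (hVs k).2 e he φ hφ hφc hφs)
  obtain ⟨r, hr, -, c, hc⟩ := exists_ae_eq_const_of_integral_mul_fderiv_eq_zero hU'o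
    ((hwl e he).mono_set hU'U) hU' hyU'
  exact ⟨e.source ∩ e ⁻¹' Metric.ball (e x) r,
    e.continuousOn.isOpen_inter_preimage e.open_source Metric.isOpen_ball,
    ⟨hxs, Metric.mem_ball_self hr⟩, c,
    hμ.ae_of_ae_chart he Metric.isOpen_ball (P := fun z => w z = c) hc⟩

end Hormander

end SubLaplace

namespace SubLaplace

variable {n N : ℕ} {M : Type*} [TopologicalSpace M] [ChartedSpace (EuclideanSpace ℝ (Fin n)) M]

/-! ### The principal eigenvalue and simplicity -/

section PrincipalEigenvalue

variable [T2Space M] [SecondCountableTopology M] [IsManifold (𝓡 n) ∞ M] [MeasurableSpace M]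
  [BorelSpace M] {μ : Measure M} {X : Fin N → VField n M} {Ω : Set M} {p g u : M → ℝ}
  {P C lam κ : ℝ} {v : M → ℝ} {G Gv : M → EuclideanSpace ℝ (Fin N)}

omit [T2Space M] [SecondCountableTopology M] in
theorem IsPositiveSolution.isEigenfunction (S : IsPositiveSolution μ Ω p g X P C lam v Gv)
    (hne : Ω.Nonempty) : IsEigenfunction μ Ω p g X lam v := by
  refine ⟨fun h0 => ?_, Gv, S.solution⟩
  have := S.volume.isOpenPosMeasure
  have hneb : NeBot (ae (μ.restrict Ω)) := by
    rw [ae_neBot, Ne, Measure.restrict_eq_zero]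
    exact S.isOpen.measure_ne_zero μ hne
  obtain ⟨x, hx0, hx⟩ := (h0.and S.pos).exists
  exact hx.ne' hx0

theorem IsPositiveSolution.le_rayleigh (S : IsPositiveSolution μ Ω p g X P C lam v Gv)
    (hu : MemW0 μ Ω p X u G) (hu0 : ¬ (u =ᵐ[μ.restrict Ω] 0)) :
    lam ≤ (∫ x in Ω, ‖G x‖ ^ p x ∂μ) / ∫ x in Ω, g x * |u x| ^ p x ∂μ :=
  (le_div_iff₀ (S.integral_weight_pos hu.1.1 hu0)).2 (S.lintegral_picone_le hu).1

omit [T2Space M] [SecondCountableTopology M] in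
-- The eigenfunction is tested with itself. Thus a lower bound for the Rayleigh quotients bounds all
-- eigenvalues.
theorem IsPositiveSolution.mem_rayleighSet (S : IsPositiveSolution μ Ω p g X P C lam v Gv)
    (hu : IsEigenfunction μ Ω p g X κ u) : κ ∈ rayleighSet μ Ω p g X := by
  obtain ⟨hu0, G, hG⟩ := hu
  refine ⟨u, G, hG.1, hu0, ?_⟩
  rw [S.integral_eq_of_isWeakSolution hG,
    mul_div_cancel_right₀ _ (S.integral_weight_pos hG.1.1.1 hu0).ne']

theorem IsPositiveSolution.isLeast_rayleighSet (S : IsPositiveSolution μ Ω p g X P C lam v Gv)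
    (hne : Ω.Nonempty) : IsLeast (rayleighSet μ Ω p g X) lam := by
  refine ⟨S.mem_rayleighSet (S.isEigenfunction hne), ?_⟩
  rintro _ ⟨u, G, hu, hu0, rfl⟩
  exact S.le_rayleigh hu hu0

/-- Under Hörmander's condition every eigenfunction is a multiple of the positive one. -/
theorem IsPositiveSolution.exists_ae_eq_mul (S : IsPositiveSolution μ Ω p g X P C lam v Gv)
    (hconn : IsConnected Ω) (hH : HormanderOn X Ω) (hu : IsWeakSolution μ Ω p g X lam u G) :
    ∃ c : ℝ, ∀ᵐ x ∂(μ.restrict Ω), u x = c * v x := by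
  have := S.finite
  have hw : AEStronglyMeasurable (fun x => Real.arctan (u x / v x)) (μ.restrict Ω) :=
    (Real.measurable_arctan.comp_aemeasurable
      (hu.1.1.1.1.div S.solution.1.1.1.1)).aestronglyMeasurable
  obtain ⟨c, hc⟩ := hH.exists_ae_eq_const S.volume S.smooth S.isOpen hconn
    (w := fun x => Real.arctan (u x / v x))
    (fun K _ hKΩ => ((integrable_const (2 : ℝ)).mono' hw
      (Eventually.of_forall fun x => abs_arctan_le_two _)).mono_measure
        (Measure.restrict_mono hKΩ le_rfl))
    (fun k => S.hasWeakDerivAlong_arctan_div hu.1 (S.gradient_eq_smul hu) k)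
  -- The tangent inverts arctan on all of ℝ, so u/v = tan c with no case distinction.
  refine ⟨Real.tan c, ?_⟩
  filter_upwards [hc, S.pos] with x hx hx0
  rw [← hx, Real.tan_arctan, div_mul_cancel₀ _ hx0.ne']

end PrincipalEigenvalue

end SubLaplace

theorem mainTheorem4 {n N : ℕ} {M : Type*} [TopologicalSpace M] [T2Space M]
    [SecondCountableTopology M] [ChartedSpace (EuclideanSpace ℝ (Fin n)) M]
    [IsManifold (𝓡 n) ∞ M] [MeasurableSpace M] [BorelSpace M]
    (μ : Measure M) (hμ : SubLaplace.IsSmoothVolume n μ)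
    (X : Fin N → SubLaplace.VField n M) (hX : ∀ k, SubLaplace.IsSmoothField (X k))
    (Ω : Set M) (hΩ_open : IsOpen Ω) (hΩ_conn : IsConnected Ω) (hΩ_bdd : IsCompact (closure Ω))
    (p : M → ℝ) (hp_cont : ContinuousOn p (closure Ω)) (hp_one : ∀ x ∈ closure Ω, 1 < p x)
    (hp_C1 : ContMDiffOn (𝓡 n) 𝓘(ℝ, ℝ) 1 p Ω)
    (g : M → ℝ) (hg_meas : AEMeasurable g (μ.restrict Ω)) (hg_pos : ∀ x ∈ Ω, 0 < g x)
    (hg_bdd : ∃ C : ℝ, ∀ x ∈ Ω, g x ≤ C)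
    (lam : ℝ) (hlam : 0 < lam)
    (v : M → ℝ) (Gv : M → EuclideanSpace ℝ (Fin N))
    (hv : SubLaplace.IsWeakSolution μ Ω p g X lam v Gv)
    (hv_pos : ∀ᵐ x ∂(μ.restrict Ω), 0 < v x)
    (hv_orth : ∀ᵐ x ∂(μ.restrict Ω), inner ℝ (SubLaplace.hGrad X p x) (Gv x) = 0) :
    SubLaplace.principalEigenvalue μ Ω p g X = lam ∧
    IsLeast {κ : ℝ | 0 < κ ∧ SubLaplace.IsEigenvalue μ Ω p g X κ} lam ∧
    (SubLaplace.HormanderOn X Ω →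
      ∀ u₁ u : M → ℝ,
        SubLaplace.IsEigenfunction μ Ω p g X (SubLaplace.principalEigenvalue μ Ω p g X) u₁ →
        SubLaplace.IsEigenfunction μ Ω p g X (SubLaplace.principalEigenvalue μ Ω p g X) u →
        ∃ c : ℝ, ∀ᵐ x ∂(μ.restrict Ω), u x = c * u₁ x) := by
  have hne := hΩ_conn.nonempty
  have := hμ.isLocallyFiniteMeasure
  obtain ⟨C, hC⟩ := hg_bdd
  -- The maximum of p on the compact closure supplies the uniform bound P.
  obtain ⟨x₁, -, hx₁⟩ := hΩ_bdd.exists_isMaxOn hne.closure hp_cont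
  have S : SubLaplace.IsPositiveSolution μ Ω p g X (p x₁) C lam v Gv :=
    { volume := hμ
      smooth := hX
      isOpen := hΩ_open
      finite := ⟨by
        rw [Measure.restrict_apply_univ]
        exact (measure_mono subset_closure).trans_lt hΩ_bdd.measure_lt_top⟩
      exponent := fun x hx => ⟨hp_one x (subset_closure hx), hx₁ (subset_closure hx)⟩
      exponent_C1 := hp_C1
      weight_meas := hg_meas
      weight := fun x hx => ⟨hg_pos x hx, hC x hx⟩
      solution := hv
      pos := hv_pos
      orth := hv_orth }
  have hleast := S.isLeast_rayleighSet hne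
  have hpe : SubLaplace.principalEigenvalue μ Ω p g X = lam := hleast.csInf_eq
  refine ⟨hpe, ⟨⟨hlam, v, S.isEigenfunction hne⟩, ?_⟩, fun hH u₁ u hu₁ hu => ?_⟩
  · rintro κ ⟨-, u, hu⟩
    exact hleast.2 (S.mem_rayleighSet hu)
  · rw [hpe] at hu₁ hu
    obtain ⟨hu₁0, G₁, hG₁⟩ := hu₁
    obtain ⟨-, G, hG⟩ := hu
    obtain ⟨c₁, hc₁⟩ := S.exists_ae_eq_mul hΩ_conn hH hG₁
    obtain ⟨c, hc⟩ := S.exists_ae_eq_mul hΩ_conn hH hG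
    -- Both eigenfunctions are multiples of v; as u₁ is not a.e. zero its factor is invertible, and
    -- the ratio of the factors is the constant.
    have hc₁0 : c₁ ≠ 0 := fun h0 => hu₁0 (hc₁.mono fun x hx => by
      rw [hx, h0, zero_mul]
      rfl)
    refine ⟨c / c₁, ?_⟩
    filter_upwards [hc₁, hc] with x hx₁ hx
    rw [hx₁, hx]
    field_simp
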